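/- **Notation.** $\mathbb N=\{0,1,2,\dots\}$, $\mathbb R_+=[0,\infty)$, and $|\cdot|$ is the Euclidean norm on $\mathbb R^l$. Let $U\subset\mathbb R^n$ be an open neighborhood of the origin and let $f=(f_1,\dots,f_l):U\to\mathbb R^l$ be a real-analytic mapping with $f(0)=0$ and Taylor series $f_i=\sum_m c_{m,i}x^m$ at the origin. Put $\operatorname{supp}(f_i)=\{m\in\mathbb N^n: c_{m,i}\ne0\}$. The Newton polyhedron $\Gamma(f)$ is the convex hull of $\bigcup_i\bigcup_{m\in \operatorname{supp}(f_i)}(m+\mathbb R_+^n)$. For a compact face $\tau$ of $\Gamma(f)$ put $f_{i,\tau}=\sum_{m\in\operatorname{supp}(f_i)\cap\tau}c_{m,i}x^m$ and $f_\tau=(f_{1,\tau},\dots,f_{l,\tau})$. The mapping $f$ is *strongly non-degenerate at the origin with respect to $\Gamma(f)$* if for every compact (nonempty) face $\tau$ of $\Gamma(f)$ and every $z\in(\mathbb R\setminus\{0\})^n$ with $f_\tau(z)=0$, the Jacobian matrix of $f_\tau$ at $z$ has rank $\min\{l,n\}$. For $a\in\mathbb N^n$ put $\sigma(a)=a_1+\dots+a_n$,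 $d(a)=\min_{x\in\Gamma(f)}\langle a,x\rangle$ and $F(a)=\{x\in\Gamma(f):\langle a,x\rangle=d(a)\}$. Let $a_1,\dots,a_n\in\mathbb N^n$ be linearly independent over $\mathbb R$, let $\overline\Delta=\{\sum_i\lambda_ia_i:\lambda_i\ge0\}$ and, for $K\subset\{1,\dots,n\}$, $\Delta_K=\{\sum_{i\in K}\lambda_ia_i:\lambda_i>0\}$ (so $\Delta_\emptyset=\{0\}$). Let $\mathcal L:(0,1]^n\to\mathbb R_+^n$, $\mathcal L(x)=(-\ln x_1,\dots,-\ln x_n)$, and $S_K=\mathcal L^{-1}(\Delta_K)$. The mapping $f$ is *compatible with $\mathcal L^{-1}(\overline\Delta)$* if for every partition $\{I,J,K\}$ of $\{1,\dots,n\}$ with $I\neq\emptyset$, $J\ne\emptyset$ ($K$ may be empty) such that $\tau'=\bigcap_{i\in I}F(a_i)$ is compact and nonempty, $0\in\mathbb R^l$ is not a critical value of the restriction of $f_{\tau'}$ to the submanifold $S_K$ (that is, at each zero of $f_{\tau'}$ on $S_K$ the differential of $f_{\tau'}|_{S_K}$ is onto $\mathbb R^l$). For $d(a_i)\neq0$ let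 $\mathcal P(a_i)=\{-\frac{\sigma(a_i)+k}{d(a_i)}:k\in\mathbb N\}$; for $d(a_i)=0$ let $\mathcal P(a_i)=\emptyset$. **Theorem.** Assume that $f$ is strongly non-degenerate at the origin with respect to $\Gamma(f)$, that $\tau=\bigcap_{i=1}^nF(a_i)$ is a vertex ($0$-dimensional face) of $\Gamma(f)$, and that $f$ is compatible with $\mathcal L^{-1}(\overline\Delta)$. Then there exists a neighborhood $V\subset U$ of the origin such that for every smooth function $\Phi:\mathbb R^n\to\mathbb C$ with compact support contained in $V$ the following holds for $$I(s)=\int_{\mathcal L^{-1}(\overline\Delta)}\Phi(x)\,|f(x)|^s\,dx .$$ (1) $I(s)$ converges absolutely and is holomorphic on $\operatorname{Re}(s)>\max\left(\{-l\}\cup\{-\sigma(a_i)/d(a_i): 1\le i\le n,\ d(a_i)\ne0\}\right)$. (2) $I(s)$ has a meromorphic continuation to $\mathbb C$ with poles of order at most $n$, all contained in $\bigcup_{i=1}^n\mathcal P(a_i)\cup(-(l+\mathbb N))$. (3) Let $\rho$ be a positive integer. If $s_0\notin-(l+\mathbb N)$ (respectively $s_0\in-(l+\mathbb N)$) is a pole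 of order $\rho$ of the continuation, then $\operatorname{Card}\{i: s_0\in\mathcal P(a_i)\}\ge\rho$ (respectively $\ge\rho-1$). -/

import Mathlib

open scoped Topology ContDiff

noncomputable section

namespace NewtonZeta

variable {n l : ℕ}

/-- The list of directions `0, …, 0, 1, …, 1, …` in which `j` is repeated `m j` times. -/
def directions (m : Fin n → ℕ) : List (Fin n) :=
  (List.finRange n).flatMap fun j => List.replicate (m j) j

/-- The coefficient of `x ^ m` in the Taylor series of `g` at the origin, that is, the mixed
partial derivative `∂ ^ m g (0)` divided by `∏ j, (m j)!`. -/
def taylorCoeff (g : (Fin n → ℝ) → ℝ) (m : Fin n → ℕ) : ℝ :=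
  iteratedFDeriv ℝ (directions m).length g 0
      (fun t => Pi.single ((directions m).get t) (1 : ℝ)) /
    ∏ j, ((m j).factorial : ℝ)

/-- The union of the supports of the Taylor series at the origin of the components of `f`. -/
def taylorSupport (f : (Fin n → ℝ) → EuclideanSpace ℝ (Fin l)) : Set (Fin n → ℕ) :=
  {m | ∃ i : Fin l, taylorCoeff (fun x => f x i) m ≠ 0}

/-- The Newton polyhedron `Γ(G)` of a set `G` of exponents: the convex hull of
`⋃ m ∈ G, (m + ℝ₊ⁿ)`. -/
def newtonPolyhedronOf (G : Set (Fin n → ℕ)) : Set (Fin n → ℝ) :=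
  convexHull ℝ {x | ∃ m ∈ G, ∀ j, (m j : ℝ) ≤ x j}

/-- The Newton polyhedron `Γ(f)` of a mapping `f`. -/
def newtonPolyhedron (f : (Fin n → ℝ) → EuclideanSpace ℝ (Fin l)) : Set (Fin n → ℝ) :=
  newtonPolyhedronOf (taylorSupport f)

/-- An integer vector as a real vector. -/
def toReal (a : Fin n → ℕ) : Fin n → ℝ := fun j => (a j : ℝ)

/-- `d(a) = min_{x ∈ Γ} ⟨a, x⟩`. -/
def dMin (Γ : Set (Fin n → ℝ)) (a : Fin n → ℕ) : ℝ :=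
  sInf ((fun x => toReal a ⬝ᵥ x) '' Γ)

/-- The first meet locus `F(a) = {x ∈ Γ | ⟨a, x⟩ = d(a)}`. -/
def firstMeetLocus (Γ : Set (Fin n → ℝ)) (a : Fin n → ℕ) : Set (Fin n → ℝ) :=
  {x ∈ Γ | toReal a ⬝ᵥ x = dMin Γ a}

/-- `σ(a) = a₁ + ⋯ + aₙ`. -/
def sigma (a : Fin n → ℕ) : ℝ := ∑ j, (a j : ℝ)

/-- The face part `f_τ = (f_{1,τ}, …, f_{l,τ})`, where `f_{i,τ}` is the sum of the monomials of the
Taylor series of `f_i` at the origin whose exponents lie in `τ`. -/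
def facePart (f : (Fin n → ℝ) → EuclideanSpace ℝ (Fin l)) (τ : Set (Fin n → ℝ)) :
    (Fin n → ℝ) → EuclideanSpace ℝ (Fin l) :=
  open Classical in
  fun x => WithLp.toLp 2 fun i =>
    ∑' m : Fin n → ℕ,
      if toReal m ∈ τ then taylorCoeff (fun y => f y i) m * ∏ j, x j ^ m j else 0

/-- `f` is strongly non-degenerate at the origin with respect to `Γ(f)`: for every (nonempty)
compact face `τ` of `Γ(f)` and every common zero `z` of the `f_{i,τ}` with nonzero coordinates, the
Jacobian of `f_τ` at `z` has rank `min {l, n}`. -/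
def StronglyNonDegenerate (f : (Fin n → ℝ) → EuclideanSpace ℝ (Fin l)) : Prop :=
  ∀ τ : Set (Fin n → ℝ), IsExposed ℝ (newtonPolyhedron f) τ → τ.Nonempty → IsCompact τ →
    ∀ z : Fin n → ℝ, (∀ j, z j ≠ 0) → facePart f τ z = 0 →
      Module.finrank ℝ (LinearMap.range (fderiv ℝ (facePart f τ) z).toLinearMap) = min l n

/-- The closed cone spanned by `a₁, …, aₙ`. -/
def closedCone (a : Fin n → Fin n → ℕ) : Set (Fin n → ℝ) :=
  {v | ∃ t : Fin n → ℝ, (∀ i, 0 ≤ t i) ∧ v = ∑ i, t i • toReal (a i)}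

/-- The cone `Δ_K` strictly spanned by the `a_i`, `i ∈ K`; it is `{0}` if `K = ∅`. -/
def openCone (a : Fin n → Fin n → ℕ) (K : Finset (Fin n)) : Set (Fin n → ℝ) :=
  {v | ∃ t : Fin n → ℝ, (∀ i ∈ K, 0 < t i) ∧ v = ∑ i ∈ K, t i • toReal (a i)}

/-- The preimage of `C` under `𝓛 : (0,1]ⁿ → ℝ₊ⁿ`, `x ↦ (-ln x₁, …, -ln xₙ)`. -/
def logPreimage (C : Set (Fin n → ℝ)) : Set (Fin n → ℝ) :=
  {x | (∀ j, 0 < x j ∧ x j ≤ 1) ∧ (fun j => -Real.log (x j)) ∈ C}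

/-- The sector `S_K`, the preimage of `Δ_K` under `𝓛`. -/
def sector (a : Fin n → Fin n → ℕ) (K : Finset (Fin n)) : Set (Fin n → ℝ) :=
  logPreimage (openCone a K)

/-- The tangent space of the submanifold `S_K` at a point `z`. The sector `S_K` is parametrized by
`t ∈ (0,∞)^K`, `t ↦ z(t)`, `z(t)_j = exp (-∑ i ∈ K, t_i a_{i,j})`, and
`∂ z_j / ∂ t_i = -z_j a_{i,j}`. -/
def sectorTangent (a : Fin n → Fin n → ℕ) (K : Finset (Fin n)) (z : Fin n → ℝ) :
    Submodule ℝ (Fin n → ℝ) :=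
  Submodule.span ℝ {v | ∃ i ∈ K, v = fun j => z j * (a i j : ℝ)}

/-- The restriction of `g` to the sector `S_K` does not admit `0` as a critical value: at every
zero of `g` on `S_K` the differential of `g` maps the tangent space of `S_K` onto `ℝˡ`. -/
def ZeroNotCriticalOnSector (a : Fin n → Fin n → ℕ) (K : Finset (Fin n))
    (g : (Fin n → ℝ) → EuclideanSpace ℝ (Fin l)) : Prop :=
  ∀ z ∈ sector a K, g z = 0 →
    (sectorTangent a K z).map (fderiv ℝ g z).toLinearMap = ⊤

/-- `f` is compatible with the sector `S_K`. -/
def CompatibleWithSector (f : (Fin n → ℝ) → EuclideanSpace ℝ (Fin l))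
    (a : Fin n → Fin n → ℕ) (K : Finset (Fin n)) : Prop :=
  ∀ I J : Finset (Fin n), Disjoint I J → Disjoint I K → Disjoint J K →
    I ∪ J ∪ K = Finset.univ → I.Nonempty → J.Nonempty →
    IsCompact (⋂ i ∈ I, firstMeetLocus (newtonPolyhedron f) (a i)) →
    (⋂ i ∈ I, firstMeetLocus (newtonPolyhedron f) (a i)).Nonempty →
    ZeroNotCriticalOnSector a K
      (facePart f (⋂ i ∈ I, firstMeetLocus (newtonPolyhedron f) (a i)))

/-- `f` is compatible with the preimage under `𝓛` of the closed cone spanned by the `a_i`. -/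
def CompatibleWithCone (f : (Fin n → ℝ) → EuclideanSpace ℝ (Fin l))
    (a : Fin n → Fin n → ℕ) : Prop :=
  ∀ K : Finset (Fin n), CompatibleWithSector f a K

/-- The integrand `Φ(x) |f(x)|^s`, with the Euclidean norm on `ℝˡ`. -/
def zetaIntegrand (f : (Fin n → ℝ) → EuclideanSpace ℝ (Fin l)) (Φ : (Fin n → ℝ) → ℂ)
    (s : ℂ) (x : Fin n → ℝ) : ℂ :=
  Φ x * ((‖f x‖ : ℝ) : ℂ) ^ s

/-- The integral of `Φ |f|^s` over the preimage under `𝓛` of the closed cone spanned by the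
`a_i`. -/
def coneIntegral (f : (Fin n → ℝ) → EuclideanSpace ℝ (Fin l)) (Φ : (Fin n → ℝ) → ℂ)
    (a : Fin n → Fin n → ℕ) (s : ℂ) : ℂ :=
  ∫ x in logPreimage (closedCone a), zetaIntegrand f Φ s x

/-- The half-plane `Re s > max {-l, -σ(a₁)/d(a₁), …, -σ(aₙ)/d(aₙ)}`; an index `i` with
`d(a_i) = 0` imposes no condition. -/
def convergenceHalfPlane (f : (Fin n → ℝ) → EuclideanSpace ℝ (Fin l))
    (a : Fin n → Fin n → ℕ) : Set ℂ :=
  {s | -(l : ℝ) < s.re ∧ ∀ i, dMin (newtonPolyhedron f) (a i) ≠ 0 →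
    -(sigma (a i) / dMin (newtonPolyhedron f) (a i)) < s.re}

/-- The set `-(σ(ξ) + ℕ)/d(ξ)`, which is empty if `d(ξ) = 0`. -/
def candidatePoles (Γ : Set (Fin n → ℝ)) (ξ : Fin n → ℕ) : Set ℂ :=
  {s | dMin Γ ξ ≠ 0 ∧ ∃ k : ℕ, s = ((-((sigma ξ + k) / dMin Γ ξ) : ℝ) : ℂ)}

/-- The set `-(l + ℕ)`. -/
def negShift (l : ℕ) : Set ℂ := {s | ∃ k : ℕ, s = -((l : ℂ) + k)}

end NewtonZeta

end

/-!
The cone integral is computed in the monomial coordinates `x_j = ∏_i y_i ^ (a_i)_j`, which map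
`(0,1]^n` bijectively onto `𝓛⁻¹(Δ̄)` with Jacobian `|det a| ∏_i y_i ^ (σ(a_i) - 1)`. The preimage
of the origin in `[0,1]^n` is compact, so a partition of unity
(`exists_nhds_hasContinuation_coneIntegral`) reduces everything to integrals near one point `y₀`
with `x(y₀) = 0` (`exists_nhds_hasContinuation`).

Let `I` be the set of `i` with `y₀ i = 0`. As `τ` is a vertex `m₀`, the factor `∏_{i ∈ I} y_i ^
d(a_i)` can be split off: `f(x(y)) = ∏_{i ∈ I} y_i ^ d(a_i) • g(y)` with `g` smooth near `y₀`
(`exists_polydisc_localForm`). Where the coordinates in `I` vanish, `g` is up to a monomial factor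
the face part `f_τ'` with `τ' = ⋂_{i ∈ I} F(a_i)` (`localForm_eq_facePart`). If `g y₀ = 0`, the
derivatives of `g` in the coordinates strictly between `0` and `1` therefore span `ℝ^l`
(`span_fderiv_localForm_eq_top`): when some coordinate of `y₀` equals `1` this is the
compatibility with the cone, and otherwise it is strong non-degeneracy, because by Euler's
relation the directions `a_i`, `i ∈ I`, contribute nothing to the differential
(`map_sectorTangent_eq_top_of_nonDegenerate`). So `g` has a smooth right inverse of its
differential in directions along which the domain of integration has no boundary
(`TransverseFrame`).

Given such a frame there are two integrations by parts. The field which annihilates `g` and agrees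
with `∂/∂y_k` modulo the frame gives `(d_k s + σ_k + m_k) Z = Z'`, where the exponent of `y_k` in
`Z'` is larger by one (`integral_edgeAdj`). The Euler field of `g` gives `(s + l + k) Z = Z'`,
where the test function in `Z'` vanishes along `g = 0` to order `k + 1` instead of `k`
(`Vanishing.euler`). The integrals `Z` converge, and are holomorphic, on half-planes which move to
the left as these levels increase: `|g| ^ t` is locally integrable for `t > -l`
(`TransverseFrame.integrable_norm_rpow`). Hence `Z(s)` is an entire function times `Γ(s + l) ∏_k
Γ(d_k s + σ_k)`, the product being over `k ∈ I` with `d_k ≠ 0` (`exists_entire_mul_gammaProd`).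
Near points with `g y₀ ≠ 0` the same argument works without a frame and without the factor `Γ(s +
l)` (`exists_entire_locZeta_of_ne_zero`).

A Gamma factor has simple poles only, so the order of a pole is at most the number of factors with
a pole there. This number is at most `n`: when `Γ(s + l)` occurs, the derivatives of `g` span
`ℝ^l` with `l ≥ 1`, so that some coordinate of `y₀` lies strictly between `0` and `1` and `I` has
fewer than `n` elements.
-/

noncomputable section

namespace NewtonZeta

variable {n l : ℕ}

/-! ### Taylor expansion in monomials -/

/-- The exponent vector of the word `t` in the letters `Fin n`: the number of occurrences of each
letter. -/
def content {k : ℕ} (t : Fin k → Fin n) : Fin n → ℕ := fun j => Fintype.card {s // t s = j}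

lemma sum_content {k : ℕ} (t : Fin k → Fin n) : ∑ j, content t j = k := by
  have := Fintype.card_congr (Equiv.sigmaFiberEquiv t)
  rw [Fintype.card_sigma] at this
  simpa [content] using this

lemma prod_comp_content {k : ℕ} (t : Fin k → Fin n) (x : Fin n → ℝ) :
    ∏ s, x (t s) = ∏ j, x j ^ content t j := by
  rw [← Finset.prod_fiberwise (s := Finset.univ) (g := t)]
  refine Finset.prod_congr rfl fun j _ => ?_
  rw [Finset.prod_congr rfl (g := fun _ => x j), Finset.prod_const, content, Fintype.card_subtype]
  intro s hs
  rw [(Finset.mem_filter.1 hs).2]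

lemma count_directions (m : Fin n → ℕ) (j : Fin n) : (directions m).count j = m j := by
  have : ∀ i, List.count j (List.replicate (m i) i) = if i = j then m j else 0 := by
    intro i
    rw [List.count_replicate]
    by_cases h : i = j <;> simp [h]
  rw [directions, List.count_flatMap]
  simp only [Function.comp_def, this]
  rw [← List.ofFn_eq_map, List.sum_ofFn]
  simp

lemma content_directions (m : Fin n → ℕ) : content (directions m).get = m := by
  funext j
  rw [content, ← count_directions m j]
  rw [Fintype.card_subtype]
  exact Fin.card_filter_univ_eq_vector_get_eq_count j ⟨directions m, rfl⟩

lemma exists_perm_of_content_eq {k : ℕ} {t u : Fin k → Fin n} (h : content t = content u) :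
    ∃ σ : Equiv.Perm (Fin k), u ∘ σ = t := by
  have e : ∀ c, Nonempty ({s // t s = c} ≃ {s // u s = c}) := fun c =>
    ⟨Fintype.equivOfCardEq (congrFun h c)⟩
  exact ⟨Equiv.ofFiberEquiv fun c => (e c).some, funext fun s => Equiv.ofFiberEquiv_map _ s⟩

lemma content_comp_perm {k : ℕ} (t : Fin k → Fin n) (σ : Equiv.Perm (Fin k)) :
    content (t ∘ σ) = content t := by
  funext j
  exact Fintype.card_congr (σ.subtypeEquiv fun s => Iff.rfl)

/-- The permutations rearranging the word `t` into a given rearrangement `u` of it. -/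
lemma card_perm_comp_eq {k : ℕ} {t u : Fin k → Fin n} (h : content u = content t) :
    Fintype.card {σ : Equiv.Perm (Fin k) // t ∘ σ = u} = ∏ j, (content t j).factorial := by
  obtain ⟨σ₀, h₀⟩ := exists_perm_of_content_eq h
  have h1 : Fintype.card {g : Equiv.Perm (Fin k) // t ∘ g = t} = ∏ j, (content t j).factorial :=
    DomMulAct.stabilizer_card t
  rw [← h1]
  refine Fintype.card_congr ((Equiv.mulRight σ₀⁻¹).subtypeEquiv fun σ => ?_)
  simp only [Equiv.coe_mulRight, Equiv.Perm.coe_mul, ← Function.comp_assoc]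
  constructor
  · intro h
    rw [h, ← h₀]
    ext s; simp
  · intro h
    rw [← h₀]
    nth_rewrite 2 [← h]
    ext s; simp

/-- Summing over all rearrangements of `t` is the same as averaging over permutations. -/
lemma sum_perm_eq_sum_content {k : ℕ} (t : Fin k → Fin n) (b : (Fin k → Fin n) → ℝ) :
    ∑ σ : Equiv.Perm (Fin k), b (t ∘ σ) =
      (∏ j, ((content t j).factorial : ℝ)) * ∑ u with content u = content t, b u := by
  rw [← Finset.sum_fiberwise_of_maps_to (s := Finset.univ)
    (t := Finset.univ.filter fun u => content u = content t)
    (g := fun σ : Equiv.Perm (Fin k) => t ∘ σ)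
    (fun σ _ => by simp [content_comp_perm]), Finset.mul_sum]
  refine Finset.sum_congr rfl fun u hu => ?_
  have hu' : content u = content t := (Finset.mem_filter.1 hu).2
  rw [Finset.sum_congr rfl (g := fun _ => b u), Finset.sum_const, nsmul_eq_mul]
  · have := card_perm_comp_eq hu'
    rw [Fintype.card_subtype] at this
    rw [this]; push_cast; rfl
  · intro σ hσ
    rw [(Finset.mem_filter.1 hσ).2]

/-- The Taylor coefficient is obtained from any power series by collecting the words with a given
exponent vector. -/
lemma taylorCoeff_eq_sum {F : (Fin n → ℝ) → ℝ} {p : FormalMultilinearSeries ℝ (Fin n → ℝ) ℝ}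
    {r : ENNReal} (hp : HasFPowerSeriesOnBall F p 0 r) (m : Fin n → ℕ) :
    taylorCoeff F m = ∑ t : Fin (directions m).length → Fin n with content t = m,
      p _ fun s => Pi.single (t s) 1 := by
  rw [taylorCoeff, hp.iteratedFDeriv_eq_sum_of_completeSpace]
  have h := sum_perm_eq_sum_content (directions m).get
    (fun t => p (directions m).length fun s => Pi.single (t s) 1)
  simp only [content_directions, Function.comp_apply] at h
  rw [h, mul_div_cancel_left₀]
  exact Finset.prod_ne_zero_iff.2 fun j _ => by positivity

lemma multilinear_diag_eq_sum {k : ℕ}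
    (p : ContinuousMultilinearMap ℝ (fun _ : Fin k => Fin n → ℝ) ℝ)
    (x : Fin n → ℝ) :
    p (fun _ => x) =
      ∑ t : Fin k → Fin n, (p fun s => Pi.single (t s) 1) * ∏ j, x j ^ content t j := by
  have hx : x = ∑ j, x j • (Pi.single j (1 : ℝ) : Fin n → ℝ) := by
    ext i
    simp [Finset.sum_apply, Pi.single_apply]
  conv_lhs => rw [hx]
  rw [p.map_sum]
  refine Finset.sum_congr rfl fun t _ => ?_
  rw [p.map_smul_univ (fun s => x (t s)) (fun s => Pi.single (t s) (1 : ℝ)), prod_comp_content,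
    smul_eq_mul, mul_comm]

lemma abs_multilinear_single_le {k : ℕ}
    (p : ContinuousMultilinearMap ℝ (fun _ : Fin k => Fin n → ℝ) ℝ) (t : Fin k → Fin n) :
    |p fun s => Pi.single (t s) 1| ≤ ‖p‖ := by
  have h := p.le_opNorm fun s => Pi.single (t s) (1 : ℝ)
  simpa [Pi.norm_single] using h

/-- The absolute convergence of a power series on a small cube, as a series over words. -/
lemma summable_words (p : FormalMultilinearSeries ℝ (Fin n → ℝ) ℝ) {r : ℝ} {r₀ : NNReal}
    (hr : 0 < r) (hnr : n * r ≤ r₀) (hp : (r₀ : ENNReal) < p.radius) :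
    Summable fun w : (k : ℕ) × (Fin k → Fin n) =>
      |p w.1 fun s => Pi.single (w.2 s) 1| * ∏ j, r ^ content w.2 j := by
  rw [summable_sigma_of_nonneg fun w => by positivity]
  refine ⟨fun k => Summable.of_finite, ?_⟩
  refine Summable.of_nonneg_of_le (fun k => tsum_nonneg fun t => by positivity) (fun k => ?_)
    (p.summable_norm_mul_pow hp)
  rw [tsum_fintype]
  calc ∑ t : Fin k → Fin n, |p k fun s => Pi.single (t s) 1| * ∏ j, r ^ content t j
      ≤ ∑ t : Fin k → Fin n, ‖p k‖ * r ^ k := by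
        refine Finset.sum_le_sum fun t _ => ?_
        rw [Finset.prod_pow_eq_pow_sum, sum_content]
        exact mul_le_mul_of_nonneg_right (abs_multilinear_single_le _ _) (by positivity)
    _ = ‖p k‖ * (n * r) ^ k := by
        rw [Finset.sum_const, nsmul_eq_mul, mul_pow]
        simp; ring
    _ ≤ _ := by gcongr

/-- The words with exponent vector `m`, all of which have the same length. -/
def fiberEquiv (m : Fin n → ℕ) : {t : Fin (directions m).length → Fin n // content t = m} ≃
    {w : (k : ℕ) × (Fin k → Fin n) // content w.2 = m} :=
  Equiv.ofBijective (fun t => ⟨⟨_, t.1⟩, t.2⟩) <| by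
    constructor
    · intro t u h
      simpa [Subtype.ext_iff] using h
    · rintro ⟨⟨k, t⟩, h⟩
      have hk : k = (directions m).length := by
        rw [← sum_content t, ← sum_content (directions m).get, content_directions]
        exact congrArg (fun f : Fin n → ℕ => ∑ j, f j) h
      subst hk
      exact ⟨⟨t, h⟩, rfl⟩

lemma hasSum_words_fiber {F : (Fin n → ℝ) → ℝ} {p : FormalMultilinearSeries ℝ (Fin n → ℝ) ℝ}
    {R : ENNReal} (hp : HasFPowerSeriesOnBall F p 0 R) (m : Fin n → ℕ) (x : Fin n → ℝ) :
    HasSum (fun w : {w : (k : ℕ) × (Fin k → Fin n) // content w.2 = m} =>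
        (p w.1.1 fun s => Pi.single (w.1.2 s) 1) * ∏ j, x j ^ content w.1.2 j)
      (taylorCoeff F m * ∏ j, x j ^ m j) := by
  have h := hasSum_fintype fun t : {t : Fin (directions m).length → Fin n // content t = m} =>
    (p (directions m).length fun s => Pi.single (t.1 s) 1) * ∏ j, x j ^ m j
  rw [← Finset.sum_subtype (Finset.univ.filter fun t => content t = m) (p := fun t => content t = m)
    (fun t => by simp) (fun t => (p (directions m).length fun s => Pi.single (t s) 1) *
      ∏ j, x j ^ m j), ← Finset.sum_mul, ← taylorCoeff_eq_sum hp] at h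
  rw [← (fiberEquiv m).hasSum_iff]
  convert h using 1
  funext t
  change (p (directions m).length fun s => Pi.single (t.1 s) 1) * ∏ j, x j ^ content t.1 j = _
  rw [t.2]

/-- Collecting the terms of an absolutely convergent series of monomials with equal exponents. -/
lemma summable_and_hasSum_of_fibers {W : Type*} {a : W → ℝ} {c : W → Fin n → ℕ} {r : ℝ}
    (hr : 0 < r) (hS : Summable fun w => |a w| * ∏ j, r ^ c w j) {C : (Fin n → ℕ) → ℝ}
    (hfib : ∀ (m : Fin n → ℕ) (x : Fin n → ℝ),
      HasSum (fun w : {w // c w = m} => a w * ∏ j, x j ^ c w j) (C m * ∏ j, x j ^ m j)) :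
    Summable (fun m : Fin n → ℕ => |C m| * ∏ j, r ^ m j) ∧
      ∀ x : Fin n → ℝ, (∀ j, |x j| ≤ r) → ∃ S, HasSum (fun w => a w * ∏ j, x j ^ c w j) S ∧
        HasSum (fun m : Fin n → ℕ => C m * ∏ j, x j ^ m j) S := by
  have hsig : Summable fun q : (m : Fin n → ℕ) × {w // c w = m} =>
      |a q.2.1| * ∏ j, r ^ c q.2.1 j := by
    have h0 := ((Equiv.sigmaFiberEquiv c).summable_iff (f := fun w => |a w| * ∏ j, r ^ c w j)).2 hS
    simpa only [Function.comp_def, Equiv.sigmaFiberEquiv_apply] using h0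
  constructor
  · refine Summable.of_nonneg_of_le (fun m => by positivity) (fun m => ?_) hsig.sigma
    have h1 : C m * ∏ j, r ^ m j = ∑' w : {w // c w = m}, a w.1 * ∏ j, r ^ c w.1 j :=
      (hfib m fun _ => r).tsum_eq.symm
    have h2 : |C m| * ∏ j, r ^ m j = ‖C m * ∏ j, r ^ m j‖ := by
      rw [norm_mul, Real.norm_eq_abs, Real.norm_of_nonneg]; positivity
    have h3 : ∀ w, ‖a w * ∏ j, r ^ c w j‖ = |a w| * ∏ j, r ^ c w j := fun w => by
      rw [norm_mul, Real.norm_eq_abs, Real.norm_of_nonneg (r := ∏ j, r ^ c w j)]; positivity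
    rw [h2, h1]
    refine (norm_tsum_le_tsum_norm ?_).trans_eq (tsum_congr fun w => h3 w.1)
    simp only [h3]
    exact hsig.sigma_factor m
  · intro x hx
    have hle : ∀ w, ‖a w * ∏ j, x j ^ c w j‖ ≤ |a w| * ∏ j, r ^ c w j := fun w => by
      rw [norm_mul, Real.norm_eq_abs, norm_prod]
      gcongr with j
      rw [norm_pow]
      exact pow_le_pow_left₀ (norm_nonneg _) (hx j) _
    have hsum : Summable fun w => a w * ∏ j, x j ^ c w j := Summable.of_norm_bounded hS hle
    have h0 := ((Equiv.sigmaFiberEquiv c).hasSum_iff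
      (f := fun w => a w * ∏ j, x j ^ c w j)).2 hsum.hasSum
    simp only [Function.comp_def, Equiv.sigmaFiberEquiv_apply] at h0
    exact ⟨_, hsum.hasSum, h0.sigma fun m => hfib m x⟩

/-- Near the origin a real-analytic function is the absolutely convergent sum of its Taylor
monomials. -/
theorem exists_hasSum_taylorCoeff {F : (Fin n → ℝ) → ℝ} (hF : AnalyticAt ℝ F 0) :
    ∃ r : ℝ, 0 < r ∧ Summable (fun m : Fin n → ℕ => |taylorCoeff F m| * ∏ j, r ^ m j) ∧
      ∀ x : Fin n → ℝ, (∀ j, |x j| ≤ r) →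
        HasSum (fun m : Fin n → ℕ => taylorCoeff F m * ∏ j, x j ^ m j) (F x) := by
  obtain ⟨p, R, hp⟩ := hF
  obtain ⟨r₀, hr₀, hr₀R⟩ := ENNReal.lt_iff_exists_nnreal_btwn.1 hp.r_pos
  have hr₀' : (0 : ℝ) < r₀ := by exact_mod_cast hr₀
  have hn : (0 : ℝ) ≤ n := by positivity
  obtain ⟨r, hr⟩ : ∃ r : ℝ, r = r₀ / (n + 2) := ⟨_, rfl⟩
  have hrpos : 0 < r := by rw [hr]; positivity
  have hnr : n * r ≤ r₀ := by
    rw [hr, mul_div_assoc', div_le_iff₀ (by positivity)]; nlinarith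
  have hrr : r < r₀ := by
    rw [hr, div_lt_iff₀ (by positivity)]; nlinarith
  have hS := summable_words p hrpos hnr (lt_of_lt_of_le hr₀R hp.r_le)
  obtain ⟨h1, h2⟩ := summable_and_hasSum_of_fibers hrpos hS (hasSum_words_fiber hp)
  refine ⟨r, hrpos, h1, fun x hx => ?_⟩
  obtain ⟨S, hS1, hS2⟩ := h2 x hx
  have hxR : x ∈ Metric.eball (0 : Fin n → ℝ) R := by
    refine Metric.eball_subset_eball hr₀R.le ?_
    rw [Metric.eball_coe, Metric.mem_ball, dist_zero_right]
    exact lt_of_le_of_lt ((pi_norm_le_iff_of_nonneg hrpos.le).2 hx) hrr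
  have hF : HasSum (fun k => p k fun _ => x) (F x) := by
    simpa using hp.hasSum (y := x) (by simpa using hxR)
  have h3 := hS1.sigma fun k => hasSum_fintype _
  simp only [← multilinear_diag_eq_sum] at h3
  rwa [← h3.unique hF]

/-! ### Smoothness of sums of monomials -/

section PowerSeries
variable {ι F : Type*} [NormedAddCommGroup F] [NormedSpace ℝ F]

/-- The monomial `∏ y_i ^ e_i`. -/
def mono (e : Fin n → ℕ) (y : Fin n → ℝ) : ℝ := ∏ i, y i ^ e i

/-- The open polydisc `{|y_i| < R_i}`. -/
def polydisc (R : Fin n → ℝ) : Set (Fin n → ℝ) := {y | ∀ i, |y i| < R i}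

lemma isOpen_polydisc (R : Fin n → ℝ) : IsOpen (polydisc R) := by
  have : polydisc R = ⋂ i, {y : Fin n → ℝ | |y i| < R i} := by
    ext y; simp [polydisc]
  rw [this]
  exact isOpen_iInter_of_finite fun i => isOpen_lt (by fun_prop) continuous_const

lemma convex_polydisc (R : Fin n → ℝ) : Convex ℝ (polydisc R) := by
  have : polydisc R = Set.pi Set.univ fun i => Metric.ball (0 : ℝ) (R i) := by
    ext y; simp [polydisc]
  rw [this]
  exact convex_pi fun i _ => convex_ball _ _

lemma abs_mono_le {e : Fin n → ℕ} {y R : Fin n → ℝ} (h : ∀ i, |y i| ≤ R i) :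
    |mono e y| ≤ mono e R := by
  rw [mono, Finset.abs_prod, mono]
  gcongr with i
  rw [abs_pow]
  exact pow_le_pow_left₀ (abs_nonneg _) (h i) _

lemma mono_nonneg {e : Fin n → ℕ} {R : Fin n → ℝ} (h : ∀ i, 0 ≤ R i) : 0 ≤ mono e R :=
  Finset.prod_nonneg fun i _ => pow_nonneg (h i) _

/-- The exponent lowered by one in the coordinate `i`. -/
def lower (e : Fin n → ℕ) (i : Fin n) : Fin n → ℕ := Function.update e i (e i - 1)

lemma mono_lower (e : Fin n → ℕ) (i : Fin n) (y : Fin n → ℝ) :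
    mono (lower e i) y = y i ^ (e i - 1) * ∏ j ∈ Finset.univ.erase i, y j ^ e j := by
  rw [mono, ← Finset.mul_prod_erase _ _ (Finset.mem_univ i), lower, Function.update_self]
  congr 1
  refine Finset.prod_congr rfl fun j hj => ?_
  rw [Function.update_of_ne (Finset.ne_of_mem_erase hj)]

lemma hasFDerivAt_mono (e : Fin n → ℕ) (y : Fin n → ℝ) :
    HasFDerivAt (mono e) (∑ i, ((e i : ℝ) * mono (lower e i) y) •
      (ContinuousLinearMap.proj i : (Fin n → ℝ) →L[ℝ] ℝ)) y := by
  have h := HasFDerivAt.finsetProd (u := Finset.univ) (x := y)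
    (g := fun i (y : Fin n → ℝ) => y i ^ e i) (g' := fun i => ((e i : ℝ) * y i ^ (e i - 1)) •
      (ContinuousLinearMap.proj i : (Fin n → ℝ) →L[ℝ] ℝ)) fun i _ => by
        have := (ContinuousLinearMap.proj (R := ℝ) (φ := fun _ : Fin n => ℝ) i).hasFDerivAt (x := y)
        simpa using this.pow (e i)
  refine h.congr_fderiv (Finset.sum_congr rfl fun i _ => ?_)
  rw [smul_smul]
  congr 1
  rw [mono_lower]
  ring

lemma natCast_mul_pow_pred_le {r R : ℝ} (hr : 0 ≤ r) (hR : r < R) (k : ℕ) :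
    k * r ^ (k - 1) ≤ (R - r)⁻¹ * R ^ k := by
  have h : k * r ^ (k - 1) * (R - r) ≤ R ^ k := by
    cases k with
    | zero => simp
    | succ k =>
      have h1 : (∑ i ∈ Finset.range (k + 1), R ^ i * r ^ (k + 1 - 1 - i)) * (R - r) =
        R ^ (k + 1) - r ^ (k + 1) := geom_sum₂_mul R r (k + 1)
      have h2 : ((k + 1 : ℕ) : ℝ) * r ^ k ≤
          ∑ i ∈ Finset.range (k + 1), R ^ i * r ^ (k + 1 - 1 - i) := by
        have h5 := Finset.card_nsmul_le_sum (Finset.range (k + 1))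
          (fun i => R ^ i * r ^ (k + 1 - 1 - i)) (r ^ k) fun i hi => ?_
        · simpa using h5
        have hi' : i ≤ k := by simpa [Nat.lt_succ_iff] using hi
        calc r ^ k = r ^ i * r ^ (k - i) := by rw [← pow_add]; congr 1; omega
          _ ≤ _ := by
            have := pow_le_pow_left₀ hr hR.le i
            have := pow_nonneg hr (k - i)
            simp only [Nat.add_sub_cancel]
            gcongr
      have h3 := pow_nonneg hr (k + 1)
      have h4 := mul_le_mul_of_nonneg_right h2 (sub_nonneg.2 hR.le)
      simp only [Nat.add_sub_cancel]
      linarith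
  rw [inv_mul_eq_div, le_div_iff₀ (sub_pos.2 hR)]
  exact h

lemma mono_lower_le {e : Fin n → ℕ} {r R : Fin n → ℝ} (hr : ∀ i, 0 ≤ r i) (hR : ∀ i, r i < R i)
    (i : Fin n) : e i * mono (lower e i) r ≤ (R i - r i)⁻¹ * mono e R := by
  rw [mono_lower, mono, ← Finset.mul_prod_erase _ _ (Finset.mem_univ i), ← mul_assoc, ← mul_assoc]
  refine mul_le_mul (natCast_mul_pow_pred_le (hr i) (hR i) _) ?_ ?_ ?_
  · exact Finset.prod_le_prod (fun j _ => pow_nonneg (hr j) _)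
      fun j _ => pow_le_pow_left₀ (hr j) (hR j).le _
  · exact Finset.prod_nonneg fun j _ => pow_nonneg (hr j) _
  · have := hR i; have := hr i
    have : 0 ≤ R i - r i := by linarith
    have : 0 ≤ R i := by linarith
    positivity

lemma exists_between_polydisc {R y : Fin n → ℝ} (hy : y ∈ polydisc R) :
    ∃ r : Fin n → ℝ, y ∈ polydisc r ∧ (∀ i, 0 ≤ r i) ∧ ∀ i, r i < R i := by
  refine ⟨fun i => (|y i| + R i) / 2, fun i => ?_, fun i => ?_, fun i => ?_⟩ <;>
  · have := hy i
    have := abs_nonneg (y i)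
    dsimp only
    linarith

variable [CompleteSpace F]

/-- Absolutely convergent series of monomials are differentiated termwise. -/
lemma hasFDerivAt_tsum_mono {c : ι → F} {e : ι → Fin n → ℕ} {R : Fin n → ℝ}
    (hS : Summable fun t => ‖c t‖ * mono (e t) R) {y : Fin n → ℝ} (hy : y ∈ polydisc R) :
    HasFDerivAt (fun y => ∑' t, mono (e t) y • c t)
      (∑ i, (ContinuousLinearMap.proj i : (Fin n → ℝ) →L[ℝ] ℝ).smulRight
        (∑' t, mono (lower (e t) i) y • ((e t i : ℝ) • c t))) y := by
  obtain ⟨r, hyr, hr, hrR⟩ := exists_between_polydisc hy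
  have hR : ∀ i, 0 ≤ R i := fun i => (hr i).trans (hrR i).le
  have hSi : ∀ i, Summable fun t => ‖(e t i : ℝ) • c t‖ * mono (lower (e t) i) r := fun i => by
    refine Summable.of_nonneg_of_le (fun t => mul_nonneg (norm_nonneg _) (mono_nonneg hr))
      (fun t => ?_) (hS.mul_left (R i - r i)⁻¹)
    rw [norm_smul, Real.norm_natCast]
    calc e t i * ‖c t‖ * mono (lower (e t) i) r
        = ‖c t‖ * (e t i * mono (lower (e t) i) r) := by ring
      _ ≤ ‖c t‖ * ((R i - r i)⁻¹ * mono (e t) R) :=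
        mul_le_mul_of_nonneg_left (mono_lower_le hr hrR i) (norm_nonneg _)
      _ = _ := by ring
  have hle : ∀ i t, ∀ z ∈ polydisc r, ‖mono (lower (e t) i) z • ((e t i : ℝ) • c t)‖ ≤
      ‖(e t i : ℝ) • c t‖ * mono (lower (e t) i) r := fun i t z hz => by
    rw [norm_smul, mul_comm, Real.norm_eq_abs]
    exact mul_le_mul_of_nonneg_left (abs_mono_le fun j => (hz j).le) (norm_nonneg _)
  have hd : ∀ t, ∀ z ∈ polydisc r, HasFDerivAt (fun y => mono (e t) y • c t)
      (∑ i, (ContinuousLinearMap.proj i : (Fin n → ℝ) →L[ℝ] ℝ).smulRight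
        (mono (lower (e t) i) z • ((e t i : ℝ) • c t))) z := fun t z _ => by
    refine ((hasFDerivAt_mono (e t) z).smul_const (c t)).congr_fderiv ?_
    ext v
    simp [Finset.sum_smul, smul_smul, mul_comm]
  have hsum : Summable fun t => mono (e t) y • c t := by
    refine Summable.of_norm_bounded hS fun t => ?_
    rw [norm_smul, mul_comm, Real.norm_eq_abs]
    exact mul_le_mul_of_nonneg_left (abs_mono_le fun j => (hy j).le) (norm_nonneg _)
  have h := hasFDerivAt_tsum_of_isPreconnected (u := fun t => ∑ i,
      ‖(e t i : ℝ) • c t‖ * mono (lower (e t) i) r) (summable_sum fun i _ => hSi i)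
    (isOpen_polydisc r) (convex_polydisc r).isPreconnected hd (fun t z hz => ?_) hyr hsum hyr
  · refine h.congr_fderiv ?_
    have hs : ∀ i, Summable fun t => mono (lower (e t) i) y • ((e t i : ℝ) • c t) := fun i =>
      Summable.of_norm_bounded (hSi i) fun t => hle i t y hyr
    rw [Summable.tsum_finsetSum]
    · exact Finset.sum_congr rfl fun i _ => ((ContinuousLinearMap.smulRightL ℝ (Fin n → ℝ) F
        (ContinuousLinearMap.proj i)).map_tsum (hs i)).symm
    · exact fun i _ => (ContinuousLinearMap.smulRightL ℝ (Fin n → ℝ) F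
        (ContinuousLinearMap.proj i)).summable (hs i)
  · refine (norm_sum_le _ _).trans (Finset.sum_le_sum fun i _ => ?_)
    rw [ContinuousLinearMap.norm_smulRight_apply]
    refine le_trans ?_ (hle i t z hz)
    refine mul_le_of_le_one_left (norm_nonneg _) ?_
    refine ContinuousLinearMap.opNorm_le_bound _ zero_le_one fun v => ?_
    simpa using norm_le_pi_norm v i

/-- An absolutely convergent series of monomials is smooth in the open polydisc of convergence. -/
theorem contDiffOn_tsum_mono {c : ι → F} {e : ι → Fin n → ℕ} {R : Fin n → ℝ}
    (hS : Summable fun t => ‖c t‖ * mono (e t) R) :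
    ContDiffOn ℝ ∞ (fun y => ∑' t, mono (e t) y • c t) (polydisc R) := by
  rw [contDiffOn_infty]
  intro k
  induction k generalizing c e R with
  | zero =>
    rw [Nat.cast_zero, contDiffOn_zero]
    exact fun y hy => (hasFDerivAt_tsum_mono hS hy).continuousAt.continuousWithinAt
  | succ k ih =>
    push_cast
    rw [contDiffOn_succ_iff_fderiv_of_isOpen (isOpen_polydisc R)]
    refine ⟨fun y hy => (hasFDerivAt_tsum_mono hS hy).differentiableAt.differentiableWithinAt,
      by simp, ?_⟩
    refine ContDiffOn.congr (f := fun y => ∑ i,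
      (ContinuousLinearMap.proj i : (Fin n → ℝ) →L[ℝ] ℝ).smulRight
        (∑' t, mono (lower (e t) i) y • ((e t i : ℝ) • c t))) ?_
      fun y hy => (hasFDerivAt_tsum_mono hS hy).fderiv
    refine ContDiffOn.sum fun i _ => ?_
    refine (ContinuousLinearMap.smulRightL ℝ (Fin n → ℝ) F
      (ContinuousLinearMap.proj i)).contDiff.comp_contDiffOn ?_
    intro y hy
    obtain ⟨r, hyr, hr, hrR⟩ := exists_between_polydisc hy
    refine ContDiffAt.contDiffWithinAt ?_
    refine ContDiffOn.contDiffAt (ih (R := r) ?_) ((isOpen_polydisc r).mem_nhds hyr)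
    refine Summable.of_nonneg_of_le (fun t => mul_nonneg (norm_nonneg _) (mono_nonneg hr))
      (fun t => ?_) (hS.mul_left (R i - r i)⁻¹)
    rw [norm_smul, Real.norm_natCast]
    calc e t i * ‖c t‖ * mono (lower (e t) i) r
        = ‖c t‖ * (e t i * mono (lower (e t) i) r) := by ring
      _ ≤ ‖c t‖ * ((R i - r i)⁻¹ * mono (e t) R) :=
        mul_le_mul_of_nonneg_left (mono_lower_le hr hrR i) (norm_nonneg _)
      _ = _ := by ring

end PowerSeries

/-! ### Meromorphic continuation by shifts -/

section Shift
open Filter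

/-- Holomorphic functions on a half-plane that agree at all large real numbers are equal. -/
lemma eqOn_of_eq_on_large_reals {f g : ℂ → ℂ} {S : Set ℂ} (hS : IsOpen S) (hc : Convex ℝ S)
    {R₀ : ℝ} (hR₀ : ∀ x : ℝ, R₀ < x → (x : ℂ) ∈ S) (hf : DifferentiableOn ℂ f S)
    (hg : DifferentiableOn ℂ g S) {R : ℝ} (h : ∀ x : ℝ, R < x → f x = g x) : Set.EqOn f g S := by
  set x₀ : ℝ := max R₀ R + 1
  have hx₀ : R < x₀ := lt_of_le_of_lt (le_max_right _ _) (lt_add_one _)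
  have hx₀' : R₀ < x₀ := lt_of_le_of_lt (le_max_left _ _) (lt_add_one _)
  refine (hf.analyticOnNhd hS).eqOn_of_preconnected_of_frequently_eq (hg.analyticOnNhd hS)
    hc.isPreconnected (hR₀ x₀ hx₀') ?_
  have ht : Tendsto (fun x : ℝ => (x : ℂ)) (𝓝[≠] x₀) (𝓝[≠] (x₀ : ℂ)) := by
    refine tendsto_nhdsWithin_iff.2 ⟨(Complex.continuous_ofReal.tendsto x₀).mono_left
      nhdsWithin_le_nhds, ?_⟩
    filter_upwards [self_mem_nhdsWithin] with x hx
    simpa using hx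
  refine ht.frequently (Eventually.frequently ?_)
  filter_upwards [nhdsWithin_le_nhds (lt_mem_nhds hx₀)] with x hx
  exact h x hx

/-- Functions holomorphic on the half-planes `Re s > -R`, all agreeing with a given function at
large real numbers, glue to an entire function. -/
lemma exists_entire_of_halfPlanes {φ : ℝ → ℂ}
    (h : ∀ R : ℝ, ∃ E : ℂ → ℂ, DifferentiableOn ℂ E {s | -R < s.re} ∧
      ∃ R' : ℝ, ∀ x : ℝ, R' < x → E x = φ x) :
    ∃ E : ℂ → ℂ, Differentiable ℂ E ∧ ∃ R' : ℝ, ∀ x : ℝ, R' < x → E x = φ x := by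
  choose E hE R' hR' using h
  have hopen : ∀ R : ℝ, IsOpen {s : ℂ | -R < s.re} := fun R =>
    isOpen_lt continuous_const Complex.continuous_re
  have key : ∀ R T : ℝ, R ≤ T → Set.EqOn (E R) (E T) {s | -R < s.re} := fun R T hRT => by
    refine eqOn_of_eq_on_large_reals (hopen R) (convex_halfSpace_re_gt _) (R₀ := -R)
      (fun x hx => by simpa using hx) (hE R)
      ((hE T).mono fun s (hs : -R < s.re) => show -T < s.re by linarith) (R := max (R' R) (R' T))
      fun x hx => ?_
    rw [hR' R x (lt_of_le_of_lt (le_max_left _ _) hx),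
      hR' T x (lt_of_le_of_lt (le_max_right _ _) hx)]
  have key' : ∀ (s : ℂ) (T : ℝ), |s.re| + 1 ≤ T → E (|s.re| + 1) s = E T s := fun s T hT =>
    key _ _ hT (by have := neg_abs_le s.re; show -(|s.re| + 1) < s.re; linarith)
  refine ⟨fun s => E (|s.re| + 1) s, fun s₀ => ?_, R' 0 ⊔ 0, fun x hx => ?_⟩
  · have hd : DifferentiableAt ℂ (E (|s₀.re| + 2)) s₀ :=
      (hE _).differentiableAt ((hopen _).mem_nhds (by
        have := neg_abs_le s₀.re; show -(|s₀.re| + 2) < s₀.re; linarith))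
    refine hd.congr_of_eventuallyEq ?_
    have hc : Continuous fun s : ℂ => |s.re| := Complex.continuous_re.abs
    filter_upwards [(hc.tendsto s₀).eventually_lt_const (lt_add_one _)] with s hs
    exact key' s _ (by linarith)
  · change E (|(x : ℂ).re| + 1) x = φ x
    rw [← key 0 _ (by positivity) (show -0 < (x : ℂ).re by
      simpa using lt_of_le_of_lt (le_max_right _ _) hx)]
    exact hR' 0 x (lt_of_le_of_lt (le_max_left _ _) hx)

variable {ι : Type*}

/-- The half-plane on which the arguments `d_i s + σ_i + m_i` have positive real parts. -/
def shiftPlane (d σ : ι → ℝ) (m : ι → ℕ) : Set ℂ := {s | ∀ i, 0 < d i * s.re + σ i + m i}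

/-- The product of the Gamma factors `Γ(d_i s + σ_i + m_i)`. -/
def gammaProd [Fintype ι] (d σ : ι → ℝ) (m : ι → ℕ) (s : ℂ) : ℂ :=
  ∏ i, Complex.Gamma (d i * s + σ i + m i)

lemma gammaProd_ne_zero [Fintype ι] {d σ : ι → ℝ} {m : ι → ℕ} {s : ℂ} (hs : s ∈ shiftPlane d σ m) :
    gammaProd d σ m s ≠ 0 := by
  refine Finset.prod_ne_zero_iff.2 fun i _ => Complex.Gamma_ne_zero_of_re_pos ?_
  simpa using hs i

lemma differentiable_inv_gammaProd [Fintype ι] (d σ : ι → ℝ) (m : ι → ℕ) :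
    Differentiable ℂ fun s => (gammaProd d σ m s)⁻¹ := by
  have : (fun s => (gammaProd d σ m s)⁻¹) =
      fun s => ∏ i, (Complex.Gamma (d i * s + σ i + m i))⁻¹ := by
    funext s; simp [gammaProd]
  rw [this]
  refine Differentiable.fun_finsetProd fun i _ => ?_
  exact Complex.differentiable_one_div_Gamma.comp (by fun_prop)

lemma inv_gammaProd_shift [Fintype ι] [DecidableEq ι] (d σ : ι → ℝ) (m : ι → ℕ) (i : ι) (s : ℂ) :
    (gammaProd d σ m s)⁻¹ = (d i * s + σ i + m i) * (gammaProd d σ (m + Pi.single i 1) s)⁻¹ := by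
  rw [gammaProd, gammaProd, ← Finset.mul_prod_erase _ _ (Finset.mem_univ i),
    ← Finset.mul_prod_erase _ _ (Finset.mem_univ i), mul_inv, mul_inv, ← mul_assoc,
    Complex.one_div_Gamma_eq_self_mul_one_div_Gamma_add_one]
  congr 2
  · simp only [Pi.add_apply, Pi.single_eq_same]
    push_cast
    ring_nf
  · refine Finset.prod_congr rfl fun j hj => ?_
    simp [Finset.ne_of_mem_erase hj]

lemma isOpen_shiftPlane [Fintype ι] (d σ : ι → ℝ) (m : ι → ℕ) : IsOpen (shiftPlane d σ m) := by
  have : shiftPlane d σ m = ⋂ i, {s : ℂ | 0 < d i * s.re + σ i + m i} := by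
    ext; simp [shiftPlane]
  rw [this]
  exact isOpen_iInter_of_finite fun i => isOpen_lt continuous_const (by fun_prop)

lemma convex_shiftPlane (d σ : ι → ℝ) (m : ι → ℕ) : Convex ℝ (shiftPlane d σ m) := by
  intro s hs t ht a b ha hb hab i
  have h1 := hs i
  have h2 := ht i
  have h3 : d i * (a • s + b • t).re + σ i + m i =
      a * (d i * s.re + σ i + m i) + b * (d i * t.re + σ i + m i) := by
    simp only [Complex.add_re, Complex.real_smul, Complex.re_ofReal_mul]
    linear_combination (-(σ i) - m i) * hab
  rw [h3]
  rcases ha.eq_or_lt with h | h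
  · have : b = 1 := by linarith
    subst this; rw [← h]; simpa using h2
  · have := mul_pos h h1
    have := mul_nonneg hb h2.le
    linarith

/-- A family of functions, holomorphic on half-planes moving to the left, which multiplication by
`d_i s + σ_i + m_i` sends from level `m` to level `m + e_i`, consists of entire multiples of
products of Gamma factors. -/
theorem exists_entire_mul_gammaProd [Fintype ι] [DecidableEq ι] {d σ : ι → ℝ}
    (hd : ∀ i, 0 < d i) (hσ : ∀ i, 0 < σ i)
    {𝒞 : (ι → ℕ) → Set (ℂ → ℂ)}
    (h1 : ∀ m, ∀ F ∈ 𝒞 m, DifferentiableOn ℂ F (shiftPlane d σ m))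
    (h2 : ∀ m, ∀ F ∈ 𝒞 m, ∀ i, ∃ F₁ ∈ 𝒞 (m + Pi.single i 1), ∃ F₂ ∈ 𝒞 (m + Pi.single i 1),
      ∃ R : ℝ, ∀ x : ℝ, R < x → ((d i * x + σ i + m i : ℝ) : ℂ) * F x = F₁ x + x * F₂ x)
    {m : ι → ℕ} {F : ℂ → ℂ} (hF : F ∈ 𝒞 m) :
    ∃ E : ℂ → ℂ, Differentiable ℂ E ∧ ∀ s ∈ shiftPlane d σ m, F s = E s * gammaProd d σ m s := by
  -- `F / gammaProd d σ m` extends to `Re s > -R`, by induction on `∑ (M - m i)`: once all `m i`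
  -- reach `M` the domain of `F` suffices, and before that a functional equation raises one of them
  have claim : ∀ (R : ℝ) (M : ℕ), (∀ i, d i * R ≤ M) → ∀ (N : ℕ) (m : ι → ℕ), ∀ F ∈ 𝒞 m,
      ∑ i, (M - m i) ≤ N → ∃ E : ℂ → ℂ, DifferentiableOn ℂ E {s | -R < s.re} ∧
        ∃ R' : ℝ, ∀ x : ℝ, R' < x → E x = F x * (gammaProd d σ m x)⁻¹ := by
    intro R M hM N
    induction N with
    | zero =>
      intro m F hF hN
      have hm : ∀ i, M ≤ m i := fun i => by
        have := (Finset.sum_eq_zero_iff.1 (Nat.le_zero.1 hN)) i (Finset.mem_univ i)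
        omega
      refine ⟨fun s => F s * (gammaProd d σ m s)⁻¹, ?_, 0, fun _ _ => rfl⟩
      refine ((h1 m F hF).mono fun s (hs : -R < s.re) i => ?_).mul
        (differentiable_inv_gammaProd d σ m).differentiableOn
      have := mul_lt_mul_of_pos_left hs (hd i)
      have h4 : (M : ℝ) ≤ m i := by exact_mod_cast hm i
      have := hM i
      have := hσ i
      linarith
    | succ N ih =>
      intro m F hF hN
      by_cases hm : ∀ i, M ≤ m i
      · refine ih m F hF ?_
        rw [Finset.sum_eq_zero fun i _ => by have := hm i; omega]
        exact Nat.zero_le _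
      push Not at hm
      obtain ⟨i, hi⟩ := hm
      obtain ⟨F₁, hF₁, F₂, hF₂, R₁, hR₁⟩ := h2 m F hF i
      have hN' : ∑ j, (M - (m + Pi.single i 1 : ι → ℕ) j) ≤ N := by
        have : ∑ j, (M - (m + Pi.single i 1 : ι → ℕ) j) < ∑ j, (M - m j) := by
          refine Finset.sum_lt_sum (fun j _ => ?_) ⟨i, Finset.mem_univ i, ?_⟩
          · simp only [Pi.add_apply]; omega
          · simp only [Pi.add_apply, Pi.single_eq_same]; omega
        omega
      obtain ⟨E₁, hE₁, R₂, hR₂⟩ := ih _ F₁ hF₁ hN'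
      obtain ⟨E₂, hE₂, R₃, hR₃⟩ := ih _ F₂ hF₂ hN'
      refine ⟨fun s => E₁ s + s * E₂ s, hE₁.add (differentiableOn_id.mul hE₂),
        max R₁ (max R₂ R₃), fun x hx => ?_⟩
      simp only [max_lt_iff] at hx
      beta_reduce
      rw [hR₂ x hx.2.1, hR₃ x hx.2.2, inv_gammaProd_shift d σ m i]
      have := hR₁ x hx.1
      push_cast at this
      linear_combination -(gammaProd d σ (m + Pi.single i 1) x)⁻¹ * this
  obtain ⟨E, hE, R', hR'⟩ := exists_entire_of_halfPlanes
    (φ := fun x => F x * (gammaProd d σ m x)⁻¹) fun R => by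
      obtain ⟨M, hM⟩ := exists_nat_ge (∑ i, |d i * R|)
      refine claim R M (fun i => ?_) _ m F hF le_rfl
      exact (le_abs_self _).trans ((Finset.single_le_sum (f := fun i => |d i * R|)
        (fun i _ => abs_nonneg _) (Finset.mem_univ i)).trans hM)
  refine ⟨E, hE, fun s hs => ?_⟩
  have hpos : ∀ x : ℝ, 0 < x → (x : ℂ) ∈ shiftPlane d σ m := fun x hx i => by
    have := hσ i; have := hd i
    simp only [Complex.ofReal_re]
    positivity
  have := eqOn_of_eq_on_large_reals (isOpen_shiftPlane d σ m) (convex_shiftPlane d σ m) hpos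
    ((h1 m F hF).mul (differentiable_inv_gammaProd d σ m).differentiableOn) hE.differentiableOn
    (R := R') (fun x hx => (hR' x hx).symm) hs
  rw [← this]
  simp only [Pi.mul_apply]
  rw [mul_assoc, inv_mul_cancel₀ (gammaProd_ne_zero hs), mul_one]

lemma inv_Gamma_eq_prod_mul (k : ℕ) (z : ℂ) :
    (Complex.Gamma z)⁻¹ = (∏ j ∈ Finset.range k, (z + j)) * (Complex.Gamma (z + k))⁻¹ := by
  induction k with
  | zero => simp
  | succ k ih =>
    rw [ih, Finset.prod_range_succ, Complex.one_div_Gamma_eq_self_mul_one_div_Gamma_add_one (z + k)]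
    push_cast
    ring_nf

/-- `Γ(d s + σ)` has simple poles where `d s + σ` is a nonpositive integer, and order `0`
elsewhere. -/
lemma meromorphicOrderAt_Gamma_affine {d : ℝ} (hd : 0 < d) (σ : ℝ) (s₀ : ℂ) :
    MeromorphicAt (fun s : ℂ => Complex.Gamma (d * s + σ)) s₀ ∧
      meromorphicOrderAt (fun s : ℂ => Complex.Gamma (d * s + σ)) s₀ =
        open Classical in if ∃ k : ℕ, (d : ℂ) * s₀ + σ = -k then ((-1 : ℤ) : WithTop ℤ) else 0 := by
  have hinv : ∀ c : ℂ, Differentiable ℂ fun s : ℂ => (Complex.Gamma (d * s + σ + c))⁻¹ := fun c =>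
    Complex.differentiable_one_div_Gamma.comp (by fun_prop)
  have han : AnalyticAt ℂ (fun s : ℂ => (Complex.Gamma (d * s + σ))⁻¹) s₀ := by
    simpa using (hinv 0).analyticAt s₀
  have heq : (fun s : ℂ => Complex.Gamma (d * s + σ)) =
      (fun s : ℂ => (Complex.Gamma (d * s + σ))⁻¹)⁻¹ := by
    funext s; simp
  refine ⟨by rw [heq]; exact han.meromorphicAt.inv, ?_⟩
  rw [heq, meromorphicOrderAt_inv]
  split_ifs with h
  · obtain ⟨k, hk⟩ := h
    have h1 : meromorphicOrderAt (fun s : ℂ => (Complex.Gamma (d * s + σ))⁻¹) s₀ = (1 : ℤ) := by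
      rw [meromorphicOrderAt_eq_int_iff han.meromorphicAt]
      refine ⟨fun s => d * ((∏ j ∈ Finset.range k, (d * s + σ + j)) *
        (Complex.Gamma (d * s + σ + (k + 1)))⁻¹), ?_, ?_, ?_⟩
      · refine Differentiable.analyticAt ?_ s₀
        refine (Differentiable.fun_finsetProd fun j _ => by fun_prop).mul (hinv _) |>.const_mul _
      · beta_reduce
        rw [hk]
        refine mul_ne_zero (by exact_mod_cast hd.ne') (mul_ne_zero ?_ ?_)
        · refine Finset.prod_ne_zero_iff.2 fun j hj => ?_
          have : j < k := Finset.mem_range.1 hj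
          intro h
          have : (j : ℂ) = k := by linear_combination h
          norm_cast at this
          omega
        · simp
      · refine Filter.Eventually.of_forall fun s => ?_
        rw [inv_Gamma_eq_prod_mul (k + 1), Finset.prod_range_succ]
        have : (d : ℂ) * s + σ + k = d * (s - s₀) := by linear_combination hk
        rw [this]
        push_cast
        simp only [zpow_one, smul_eq_mul]
        ring
    rw [h1]; rfl
  · push Not at h
    have hne : (Complex.Gamma (d * s₀ + σ))⁻¹ ≠ 0 := inv_ne_zero (Complex.Gamma_ne_zero h)
    rw [han.meromorphicOrderAt_eq, han.analyticOrderAt_eq_zero.2 hne]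
    rfl

/-- The order of a pole of an entire multiple of `∏ Γ(d_i s + σ_i)` is at most the number of Gamma
factors which have a pole there. -/
lemma meromorphicOrderAt_mul_gammaProd [Fintype ι] {d σ : ι → ℝ} (hd : ∀ i, 0 < d i) {E : ℂ → ℂ}
    (hE : Differentiable ℂ E) (s₀ : ℂ) :
    MeromorphicAt (fun s => E s * gammaProd d σ 0 s) s₀ ∧
      ((-({i | ∃ k : ℕ, (d i : ℂ) * s₀ + σ i = -k}.ncard : ℤ) : ℤ) : WithTop ℤ) ≤
        meromorphicOrderAt (fun s => E s * gammaProd d σ 0 s) s₀ := by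
  classical
  have hG : gammaProd d σ 0 = fun s => ∏ i, Complex.Gamma (d i * s + σ i) := by
    funext s; simp [gammaProd]
  have hm : ∀ i, MeromorphicAt (fun s : ℂ => Complex.Gamma (d i * s + σ i)) s₀ := fun i =>
    (meromorphicOrderAt_Gamma_affine (hd i) (σ i) s₀).1
  have hGm : MeromorphicAt (gammaProd d σ 0) s₀ := by
    rw [hG]; exact MeromorphicAt.fun_prod fun i _ => hm i
  have hEm := (hE.analyticAt s₀)
  refine ⟨hEm.meromorphicAt.mul hGm, ?_⟩
  rw [show (fun s => E s * gammaProd d σ 0 s) = E * gammaProd d σ 0 from rfl,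
    meromorphicOrderAt_mul hEm.meromorphicAt hGm]
  have h2 : meromorphicOrderAt (gammaProd d σ 0) s₀ =
      ((-({i | ∃ k : ℕ, (d i : ℂ) * s₀ + σ i = -k}.ncard : ℤ) : ℤ) : WithTop ℤ) := by
    rw [hG, meromorphicOrderAt_fun_prod fun i _ => hm i,
      Finset.sum_congr rfl fun i _ => (meromorphicOrderAt_Gamma_affine (hd i) (σ i) s₀).2]
    have h3 : ∀ i, (if ∃ k : ℕ, (d i : ℂ) * s₀ + σ i = -k then ((-1 : ℤ) : WithTop ℤ) else 0) =
        ((if ∃ k : ℕ, (d i : ℂ) * s₀ + σ i = -k then -1 else 0 : ℤ) : WithTop ℤ) := fun i => by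
      split_ifs <;> rfl
    rw [Finset.sum_congr rfl fun i _ => h3 i, ← WithTop.coe_sum, Set.ncard_eq_toFinset_card',
      Finset.sum_ite]
    simp
  rw [h2]
  exact le_add_of_nonneg_left hEm.meromorphicOrderAt_nonneg

end Shift

/-! ### Weights and integration by parts -/

section Weights
open MeasureTheory Filter Set

/-- The truncated power `t₊ ^ p`. -/
def ppow (p t : ℝ) : ℝ := if 0 < t then t ^ p else 0

lemma ppow_nonneg (p t : ℝ) : 0 ≤ ppow p t := by
  rw [ppow]; split_ifs with h <;> positivity

lemma measurable_ppow (p : ℝ) : Measurable (ppow p) :=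
  Measurable.ite measurableSet_Ioi (by fun_prop) measurable_const

/-- For `p > 0` the truncated power with exponent `p + 1` is differentiable at `0` as well. -/
lemma hasDerivAt_ppow {p : ℝ} (hp : 0 < p) (t : ℝ) :
    HasDerivAt (ppow (p + 1)) ((p + 1) * ppow p t) t := by
  rcases lt_trichotomy t 0 with h | h | h
  · have : ppow (p + 1) =ᶠ[𝓝 t] fun _ => 0 := by
      filter_upwards [gt_mem_nhds h] with u hu
      rw [ppow, if_neg (not_lt.2 hu.le)]
    rw [ppow, if_neg (not_lt.2 h.le), mul_zero]
    exact (hasDerivAt_const t (0 : ℝ)).congr_of_eventuallyEq this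
  · subst h
    rw [ppow, if_neg (lt_irrefl _), mul_zero, hasDerivAt_iff_tendsto_slope]
    have h0 : ppow (p + 1) 0 = 0 := by rw [ppow, if_neg (lt_irrefl _)]
    have hb : ∀ u : ℝ, |slope (ppow (p + 1)) 0 u| ≤ |u| ^ p := fun u => by
      rw [slope_def_field, h0, ppow]
      split_ifs with hu
      · rw [Real.rpow_add_one hu.ne', sub_zero, sub_zero, mul_div_assoc, div_self hu.ne', mul_one,
          abs_of_nonneg (by positivity), abs_of_pos hu]
      · simpa using by positivity
    have hc : Tendsto (fun u : ℝ => |u| ^ p) (𝓝[≠] 0) (𝓝 0) := by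
      have : Continuous fun u : ℝ => |u| ^ p := continuous_abs.rpow_const fun _ => Or.inr hp.le
      simpa [Real.zero_rpow hp.ne'] using (this.tendsto 0).mono_left nhdsWithin_le_nhds
    exact squeeze_zero_norm hb hc
  · have : ppow (p + 1) =ᶠ[𝓝 t] fun u => u ^ (p + 1) := by
      filter_upwards [lt_mem_nhds h] with u hu
      rw [ppow, if_pos hu]
    rw [ppow, if_pos h]
    have h2 := Real.hasDerivAt_rpow_const (x := t) (p := p + 1) (Or.inl h.ne')
    rw [add_sub_cancel_right] at h2
    exact h2.congr_of_eventuallyEq this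

/-- The weight `∏_{k ∈ A} (y_k)₊ ^ p_k`, cut off to `0 < y_j ≤ 1` in the coordinates `j ∈ B`. -/
def wt (A B : Finset (Fin n)) (p : A → ℝ) (y : Fin n → ℝ) : ℝ :=
  open Classical in
  (if ∀ j ∈ B, 0 < y j ∧ y j ≤ 1 then 1 else 0) * ∏ k : A, ppow (p k) (y k)

variable {A B : Finset (Fin n)} {p : A → ℝ}

lemma wt_nonneg (y : Fin n → ℝ) : 0 ≤ wt A B p y := by
  rw [wt]
  refine mul_nonneg (by split_ifs <;> simp) (Finset.prod_nonneg fun k _ => ppow_nonneg _ _)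

lemma measurableSet_cut (B : Finset (Fin n)) :
    MeasurableSet {y : Fin n → ℝ | ∀ j ∈ B, 0 < y j ∧ y j ≤ 1} := by
  have : {y : Fin n → ℝ | ∀ j ∈ B, 0 < y j ∧ y j ≤ 1} =
      ⋂ j ∈ B, {y : Fin n → ℝ | y j ∈ Ioc (0 : ℝ) 1} := by
    ext y; simp
  rw [this]
  exact Finset.measurableSet_biInter _ fun j _ => measurable_pi_apply j measurableSet_Ioc

lemma measurable_wt : Measurable (wt A B p) := by
  refine Measurable.mul (Measurable.ite (measurableSet_cut B) measurable_const measurable_const) ?_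
  exact Finset.measurable_fun_prod _ fun k _ => (measurable_ppow _).comp (measurable_pi_apply _)

lemma wt_le (y : Fin n → ℝ) : wt A B p y ≤ ∏ k : A, ppow (p k) (y k) := by
  rw [wt]
  refine mul_le_of_le_one_left (Finset.prod_nonneg fun k _ => ppow_nonneg _ _) ?_
  split_ifs <;> simp

lemma wt_add_of_eq_zero {y v : Fin n → ℝ} (hA : ∀ j ∈ A, v j = 0) (hB : ∀ j ∈ B, v j = 0) :
    wt A B p (y + v) = wt A B p y := by
  have h1 : (∀ j ∈ B, 0 < (y + v) j ∧ (y + v) j ≤ 1) ↔ ∀ j ∈ B, 0 < y j ∧ y j ≤ 1 :=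
    forall₂_congr fun j hj => by simp [hB j hj]
  simp only [wt, h1]
  congr 1
  exact Finset.prod_congr rfl fun k _ => by simp [hA k k.2]

lemma integrableOn_ppow {p : ℝ} (hp : -1 < p) {R : ℝ} (hR : 0 < R) :
    Integrable fun t => (Ioo (-R) R).indicator (ppow p) t := by
  have h := (intervalIntegral.integrableOn_Ioo_rpow_iff hR).2 hp
  rw [← integrable_indicator_iff measurableSet_Ioo] at h
  refine h.congr (Eventually.of_forall fun t => ?_)
  beta_reduce
  by_cases ht : 0 < t
  · by_cases h2 : t < R
    · rw [indicator_of_mem (show t ∈ Ioo 0 R from ⟨ht, h2⟩),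
        indicator_of_mem (show t ∈ Ioo (-R) R from ⟨by linarith, h2⟩), ppow, if_pos ht]
    · rw [indicator_of_notMem (fun h => h2 h.2), indicator_of_notMem (fun h => h2 h.2)]
  · rw [indicator_of_notMem (fun h => ht h.1)]
    symm
    rw [indicator_apply_eq_zero]
    intro _
    rw [ppow, if_neg ht]

lemma locallyIntegrable_wt (hp : ∀ k, -1 < p k) : LocallyIntegrable (wt A B p) := by
  rw [MeasureTheory.locallyIntegrable_iff]
  intro K hK
  obtain ⟨R, hR0, hR⟩ : ∃ R : ℝ, 0 < R ∧ ∀ y ∈ K, ∀ i, y i ∈ Ioo (-R) R := by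
    obtain ⟨R, hR⟩ := hK.isBounded.subset_ball_lt 0 0
    refine ⟨R, hR.1, fun y hy i => ?_⟩
    have h1 := mem_ball_zero_iff.1 (hR.2 hy)
    exact abs_lt.1 ((norm_le_pi_norm y i).trans_lt h1)
  have h1 : Integrable fun y : Fin n → ℝ => ∏ i, (Ioo (-R) R).indicator
      (fun t => if h : i ∈ A then ppow (p ⟨i, h⟩) t else 1) (y i) := by
    refine Integrable.fintype_prod (f := fun i => (Ioo (-R) R).indicator
      (fun t => if h : i ∈ A then ppow (p ⟨i, h⟩) t else 1)) fun i => ?_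
    by_cases h : i ∈ A
    · simp only [h, dif_pos]
      exact integrableOn_ppow (hp _) hR0
    · simp only [h]
      rw [integrable_indicator_iff measurableSet_Ioo]
      simp
  refine Integrable.mono' (h1.integrableOn (s := K)) measurable_wt.aestronglyMeasurable ?_
  filter_upwards [ae_restrict_mem hK.measurableSet] with y hy
  rw [Real.norm_of_nonneg (wt_nonneg _)]
  refine (wt_le y).trans_eq ?_
  rw [Finset.prod_congr rfl fun i _ => indicator_of_mem (hR y hy i) _]
  rw [← Finset.prod_subset (Finset.subset_univ A) fun i _ hi => by simp [hi],
    ← Finset.prod_coe_sort A fun i => if h : i ∈ A then ppow (p ⟨i, h⟩) (y i) else 1]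
  exact Finset.prod_congr rfl fun k _ => by simp

variable {F : Type*} [NormedAddCommGroup F] [NormedSpace ℝ F]

lemma integrable_wt_smul (hp : ∀ k, -1 < p k) {u : (Fin n → ℝ) → F} (hu : Continuous u)
    (hc : HasCompactSupport u) : Integrable fun y => wt A B p y • u y :=
  (locallyIntegrable_wt hp).integrable_smul_right_of_hasCompactSupport hu hc

lemma integral_lineDeriv_eq_zero {u u' : (Fin n → ℝ) → F} {v : Fin n → ℝ}
    (hu : Integrable u) (hu' : Integrable u') (h : ∀ x, HasLineDerivAt ℝ u (u' x) x v) :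
    ∫ x, u' x = 0 := by
  have := integral_bilinear_hasLineDerivAt_right_eq_neg_left_of_integrable (μ := volume)
    (f := fun _ : Fin n → ℝ => (1 : ℝ)) (f' := fun _ => 0) (g := u) (g' := u') (v := v)
    (B := ContinuousLinearMap.lsmul ℝ ℝ) (by simp) (by simpa using hu') (by simpa using hu)
    (fun x _ => by simpa [HasLineDerivAt] using hasDerivAt_const (0 : ℝ) (1 : ℝ)) (fun x _ => h x)
  simpa using this

/-- Integration by parts in a direction along which the weight is constant. -/
lemma integral_wt_smul_fderiv_eq_zero (hp : ∀ k, -1 < p k) {r : Fin n → ℝ}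
    (hA : ∀ j ∈ A, r j = 0) (hB : ∀ j ∈ B, r j = 0) {u : (Fin n → ℝ) → F} (hu : ContDiff ℝ 1 u)
    (hc : HasCompactSupport u) : ∫ y, wt A B p y • fderiv ℝ u y r = 0 := by
  have hu' : Continuous fun y => fderiv ℝ u y r :=
    (hu.continuous_fderiv (by simp)).clm_apply continuous_const
  refine integral_lineDeriv_eq_zero (u := fun y => wt A B p y • u y) (v := r)
    (integrable_wt_smul hp hu.continuous hc)
    (integrable_wt_smul hp hu' (hc.fderiv_apply (𝕜 := ℝ) r)) fun x => ?_
  have h1 : HasLineDerivAt ℝ u (fderiv ℝ u x r) x r :=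
    ((hu.differentiable (by simp)) x).hasFDerivAt.hasLineDerivAt r
  have h2 : (fun t : ℝ => wt A B p (x + t • r) • u (x + t • r)) =
      fun t : ℝ => wt A B p x • u (x + t • r) := by
    funext t
    rw [wt_add_of_eq_zero (fun j hj => by simp [hA j hj]) (fun j hj => by simp [hB j hj])]
  rw [HasLineDerivAt, h2]
  exact HasDerivAt.const_smul (wt A B p x) h1

/-- Integration by parts in the direction of a coordinate carrying a power weight. -/
lemma integral_wt_smul_fderiv_single (hp : ∀ k, -1 < p k) (hAB : Disjoint A B) (k : A)
    (hk : 0 < p k) {u : (Fin n → ℝ) → F} (hu : ContDiff ℝ 1 u) (hc : HasCompactSupport u) :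
    (p k + 1) • ∫ y, wt A B p y • u y =
      -∫ y, wt A B (p + Pi.single k 1) y • fderiv ℝ u y (Pi.single (k : Fin n) 1) := by
  set r : Fin n → ℝ := Pi.single (k : Fin n) 1 with hr
  have hu' : Continuous fun y => fderiv ℝ u y r :=
    (hu.continuous_fderiv (by simp)).clm_apply continuous_const
  have hp' : ∀ j, -1 < (p + Pi.single k 1 : A → ℝ) j := fun j => by
    have := hp j
    have h0 : 0 ≤ (Pi.single k 1 : A → ℝ) j := by
      by_cases h : j = k
      · subst h; simp
      · simp [h]
    simp only [Pi.add_apply]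
    linarith
  have hI1 := integrable_wt_smul (A := A) (B := B) hp hu.continuous hc
  have hI2 := integrable_wt_smul (A := A) (B := B) hp' hu' (hc.fderiv_apply (𝕜 := ℝ) r)
  have h := integral_lineDeriv_eq_zero (u := fun y => wt A B (p + Pi.single k 1) y • u y)
    (u' := fun y => wt A B (p + Pi.single k 1) y • fderiv ℝ u y r +
      (p k + 1) • wt A B p y • u y) (v := r)
    (integrable_wt_smul hp' hu.continuous hc) (hI2.add (hI1.smul _)) fun x => ?_
  · have hI3 : Integrable fun y => (p k + 1) • wt A B p y • u y := hI1.smul _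
    rw [integral_add hI2 hI3, integral_smul] at h
    rw [eq_neg_iff_add_eq_zero, add_comm]
    exact h
  have h1 : HasLineDerivAt ℝ u (fderiv ℝ u x r) x r :=
    ((hu.differentiable (by simp)) x).hasFDerivAt.hasLineDerivAt r
  have hrk : r (k : Fin n) = 1 := by simp [hr]
  have hrj : ∀ j : Fin n, j ≠ k → r j = 0 := fun j hj => by simp [hr, hj]
  classical
  have hsplit : ∀ (q : A → ℝ) (t : ℝ), wt A B q (x + t • r) =
      ((if ∀ j ∈ B, 0 < x j ∧ x j ≤ 1 then 1 else 0) *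
        ∏ j ∈ Finset.univ.erase k, ppow (q j) (x j)) * ppow (q k) (x k + t) := fun q t => by
    have h1 : (∀ j ∈ B, 0 < (x + t • r) j ∧ (x + t • r) j ≤ 1) ↔ ∀ j ∈ B, 0 < x j ∧ x j ≤ 1 :=
      forall₂_congr fun j hj => by
        have : j ≠ k := fun h => (Finset.disjoint_left.1 hAB k.2) (h ▸ hj)
        simp [hrj j this]
    rw [wt, ← Finset.mul_prod_erase _ _ (Finset.mem_univ k)]
    simp only [h1]
    rw [mul_assoc, mul_comm (∏ j ∈ Finset.univ.erase k, ppow (q j) (x j))]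
    congr 2
    · simp [hrk]
    · refine Finset.prod_congr rfl fun j hj => ?_
      have : (j : Fin n) ≠ k := fun h => Finset.ne_of_mem_erase hj (Subtype.ext h)
      simp [hrj _ this]
  have h2 : HasDerivAt (fun t : ℝ => wt A B (p + Pi.single k 1) (x + t • r))
      ((p k + 1) * wt A B p x) 0 := by
    have h3 := hsplit p 0
    rw [zero_smul, add_zero, add_zero] at h3
    rw [h3]
    simp only [hsplit]
    have h4 : ∏ j ∈ Finset.univ.erase k, ppow ((p + Pi.single k 1 : A → ℝ) j) (x j) =
        ∏ j ∈ Finset.univ.erase k, ppow (p j) (x j) :=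
      Finset.prod_congr rfl fun j hj => by simp [Finset.ne_of_mem_erase hj]
    rw [h4]
    have h5 : HasDerivAt (fun t : ℝ => ppow (p k + 1) (x k + t))
        ((p k + 1) * ppow (p k) (x k)) 0 := by
      have := (hasDerivAt_ppow hk (x k + 0)).comp_const_add (x k) 0
      simpa using this
    simp only [Pi.add_apply, Pi.single_eq_same]
    refine (h5.const_mul _).congr_deriv ?_
    ring
  have h6 := h2.smul h1
  rw [HasLineDerivAt]
  refine h6.congr_deriv ?_
  rw [zero_smul, add_zero, smul_smul]

end Weights

/-! ### Vector fields adapted to a submersion -/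

section Fields
open MeasureTheory Filter Set
variable {F : Type*} [NormedAddCommGroup F] [NormedSpace ℝ F]

/-- The directional derivative of `ψ` along the constant vector `r`. -/
def dirD (r : Fin n → ℝ) (ψ : (Fin n → ℝ) → F) (y : Fin n → ℝ) : F := fderiv ℝ ψ y r

/-- Smooth functions with compact support in `W`. -/
structure IsTest (W : Set (Fin n → ℝ)) (ψ : (Fin n → ℝ) → F) : Prop where
  contDiff : ContDiff ℝ ∞ ψ
  hasCompactSupport : HasCompactSupport ψ
  tsupport_subset : tsupport ψ ⊆ W

lemma contDiff_dirD {ψ : (Fin n → ℝ) → F} (hψ : ContDiff ℝ ∞ ψ) (r : Fin n → ℝ) :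
    ContDiff ℝ ∞ (dirD r ψ) :=
  (hψ.fderiv_right (m := ∞) (by simp)).clm_apply contDiff_const

lemma dirD_smul {η : (Fin n → ℝ) → ℝ} {ψ : (Fin n → ℝ) → F} {y : Fin n → ℝ}
    (hη : DifferentiableAt ℝ η y) (hψ : DifferentiableAt ℝ ψ y) (r : Fin n → ℝ) :
    dirD r (fun y => η y • ψ y) y = η y • dirD r ψ y + dirD r η y • ψ y := by
  simp only [dirD]
  rw [fderiv_fun_smul hη hψ]
  simp

lemma dirD_sum {ι : Type*} (s : Finset ι) {ψ : ι → (Fin n → ℝ) → F} {y : Fin n → ℝ}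
    (hψ : ∀ i ∈ s, DifferentiableAt ℝ (ψ i) y) (r : Fin n → ℝ) :
    dirD r (fun y => ∑ i ∈ s, ψ i y) y = ∑ i ∈ s, dirD r (ψ i) y := by
  simp only [dirD]
  rw [fderiv_fun_sum hψ]
  simp

namespace IsTest
variable {W : Set (Fin n → ℝ)} {ψ φ : (Fin n → ℝ) → F}

lemma eq_zero (h : IsTest W ψ) {y : Fin n → ℝ} (hy : y ∉ W) : ψ y = 0 :=
  image_eq_zero_of_notMem_tsupport fun h' => hy (h.tsupport_subset h')

lemma differentiableAt (h : IsTest W ψ) {y : Fin n → ℝ} : DifferentiableAt ℝ ψ y :=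
  (h.contDiff.differentiable (by simp)) y

lemma of_support (h : IsTest W ψ) {F' : Type*} [NormedAddCommGroup F'] [NormedSpace ℝ F']
    {φ : (Fin n → ℝ) → F'} (hφ : ContDiff ℝ ∞ φ) (hs : tsupport φ ⊆ tsupport ψ) : IsTest W φ :=
  ⟨hφ, h.hasCompactSupport.of_isClosed_subset (isClosed_tsupport _) hs,
    hs.trans h.tsupport_subset⟩

lemma zero : IsTest W (fun _ => 0 : (Fin n → ℝ) → F) :=
  ⟨contDiff_const, HasCompactSupport.zero, by
    have : tsupport (fun _ => 0 : (Fin n → ℝ) → F) = ∅ := tsupport_eq_empty_iff.2 rfl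
    rw [this]; exact empty_subset _⟩

lemma add (h : IsTest W ψ) (h' : IsTest W φ) : IsTest W (fun y => ψ y + φ y) :=
  ⟨h.contDiff.add h'.contDiff, h.hasCompactSupport.add h'.hasCompactSupport,
    (tsupport_add ψ φ).trans (union_subset h.tsupport_subset h'.tsupport_subset)⟩

lemma sum {ι : Type*} (s : Finset ι) {ψ : ι → (Fin n → ℝ) → F} (h : ∀ i ∈ s, IsTest W (ψ i)) :
    IsTest W (fun y => ∑ i ∈ s, ψ i y) := by
  classical
  induction s using Finset.induction_on with
  | empty => simpa using zero
  | insert i s hi ih =>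
    simp only [Finset.sum_insert hi]
    exact (h i (Finset.mem_insert_self i s)).add
      (ih fun j hj => h j (Finset.mem_insert_of_mem hj))

lemma smul (h : IsTest W ψ) {η : (Fin n → ℝ) → ℝ} (hη : ContDiff ℝ ∞ η) :
    IsTest W (fun y => η y • ψ y) :=
  h.of_support (hη.smul h.contDiff) (tsupport_smul_subset_right η ψ)

lemma const_smul (h : IsTest W ψ) (c : ℝ) : IsTest W (fun y => c • ψ y) :=
  h.smul contDiff_const

lemma neg (h : IsTest W ψ) : IsTest W (fun y => -ψ y) := by
  simpa using h.const_smul (-1)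

lemma dirD (h : IsTest W ψ) (r : Fin n → ℝ) : IsTest W (dirD r ψ) :=
  h.of_support (contDiff_dirD h.contDiff r) (tsupport_fderiv_apply_subset ℝ r)

end IsTest

/-- Data exhibiting `g` as a submersion on `W` along coordinates outside `A` and `B`: constant
directions `r m` and smooth functions `a m q`, the entries of the inverse of the matrix
`(∂g_q / ∂r_m)`. -/
structure TransverseFrame (A B : Finset (Fin n)) (W : Set (Fin n → ℝ))
    (g : (Fin n → ℝ) → EuclideanSpace ℝ (Fin l)) where
  /-- the transverse directions -/
  r : Fin l → Fin n → ℝ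
  /-- the entries of the inverse matrix -/
  a : Fin l → Fin l → (Fin n → ℝ) → ℝ
  r_eq_zero_left : ∀ m, ∀ j ∈ A, r m j = 0
  r_eq_zero_right : ∀ m, ∀ j ∈ B, r m j = 0
  contDiff_g : ContDiff ℝ ∞ g
  contDiff_a : ∀ m q, ContDiff ℝ ∞ (a m q)
  inverse : ∀ y ∈ W, ∀ q q', ∑ m, a m q y * dirD (r m) (fun y => g y q') y = if q = q' then 1 else 0

namespace TransverseFrame
variable {A B : Finset (Fin n)} {W : Set (Fin n → ℝ)}
  {g : (Fin n → ℝ) → EuclideanSpace ℝ (Fin l)} (D : TransverseFrame A B W g)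

lemma contDiff_comp (D : TransverseFrame A B W g) (q : Fin l) : ContDiff ℝ ∞ fun y => g y q :=
  (EuclideanSpace.proj q : EuclideanSpace ℝ (Fin l) →L[ℝ] ℝ).contDiff.comp D.contDiff_g

/-- The coefficients in the frame of the vector field whose derivative of `g` is `Σ_q b_q e_q`. -/
def coef (b : Fin l → (Fin n → ℝ) → ℝ) (m : Fin l) (y : Fin n → ℝ) : ℝ := ∑ q, b q y * D.a m q y

lemma contDiff_coef {b : Fin l → (Fin n → ℝ) → ℝ} (hb : ∀ q, ContDiff ℝ ∞ (b q)) (m : Fin l) :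
    ContDiff ℝ ∞ (D.coef b m) :=
  ContDiff.sum fun q _ => (hb q).mul (D.contDiff_a m q)

lemma sum_coef_mul (b : Fin l → (Fin n → ℝ) → ℝ) {y : Fin n → ℝ} (hy : y ∈ W) (q : Fin l) :
    ∑ m, D.coef b m y * dirD (D.r m) (fun y => g y q) y = b q y := by
  simp only [coef, Finset.sum_mul]
  rw [Finset.sum_comm]
  have h : ∀ q', ∑ m, b q' y * D.a m q' y * dirD (D.r m) (fun y => g y q) y =
      b q' y * if q' = q then 1 else 0 := fun q' => by
    rw [← D.inverse y hy q' q, Finset.mul_sum]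
    exact Finset.sum_congr rfl fun m _ => by ring
  simp [h]

/-- The formal adjoint `ψ ↦ -Σ ∂_{r_m} (coef_m ψ)` of the field with coefficients `coef b`. -/
def adj (b : Fin l → (Fin n → ℝ) → ℝ) (ψ : (Fin n → ℝ) → F) (y : Fin n → ℝ) : F :=
  -∑ m, dirD (D.r m) (fun y => D.coef b m y • ψ y) y

lemma isTest_adj {b : Fin l → (Fin n → ℝ) → ℝ} (hb : ∀ q, ContDiff ℝ ∞ (b q))
    {ψ : (Fin n → ℝ) → F} (hψ : IsTest W ψ) : IsTest W (D.adj b ψ) :=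
  (IsTest.sum _ fun m _ => (hψ.smul (D.contDiff_coef hb m)).dirD _).neg

lemma adj_smul {b : Fin l → (Fin n → ℝ) → ℝ} (hb : ∀ q, ContDiff ℝ ∞ (b q))
    {ψ : (Fin n → ℝ) → F} (hψ : IsTest W ψ) (q : Fin l) (y : Fin n → ℝ) :
    D.adj b (fun y => g y q • ψ y) y = g y q • D.adj b ψ y - b q y • ψ y := by
  have h1 : ∀ m, dirD (D.r m) (fun y => D.coef b m y • g y q • ψ y) y =
      g y q • dirD (D.r m) (fun y => D.coef b m y • ψ y) y +
        (D.coef b m y * dirD (D.r m) (fun y => g y q) y) • ψ y := fun m => by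
    have h2 : (fun y => D.coef b m y • g y q • ψ y) = fun y => g y q • (D.coef b m y • ψ y) := by
      funext y; rw [smul_comm]
    rw [h2, dirD_smul (((D.contDiff_comp q).differentiable (by simp)) y)
      (hψ.smul (D.contDiff_coef hb m)).differentiableAt, smul_smul, mul_comm (D.coef b m y)]
  simp only [adj, h1, Finset.sum_add_distrib, ← Finset.smul_sum, ← Finset.sum_smul]
  by_cases hy : y ∈ W
  · rw [D.sum_coef_mul b hy, neg_add, smul_neg, sub_eq_add_neg]
  · simp [hψ.eq_zero hy]

lemma adj_sum {b : Fin l → (Fin n → ℝ) → ℝ} (hb : ∀ q, ContDiff ℝ ∞ (b q)) {ι : Type*}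
    (s : Finset ι) {ψ : ι → (Fin n → ℝ) → F} (hψ : ∀ i ∈ s, IsTest W (ψ i)) (y : Fin n → ℝ) :
    D.adj b (fun y => ∑ i ∈ s, ψ i y) y = ∑ i ∈ s, D.adj b (ψ i) y := by
  simp only [adj, Finset.smul_sum, Finset.sum_neg_distrib]
  rw [Finset.sum_comm]
  congr 1
  exact Finset.sum_congr rfl fun m _ =>
    dirD_sum s (fun i hi => ((hψ i hi).smul (D.contDiff_coef hb m)).differentiableAt) _

/-- Integration by parts against the field with coefficients `coef b`. The function `G` is a
function of `‖g‖²`, with derivative encoded by `γ`. -/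
lemma integral_adj {p : A → ℝ} (hp : ∀ k, -1 < p k) {b : Fin l → (Fin n → ℝ) → ℝ}
    (hb : ∀ q, ContDiff ℝ ∞ (b q)) {ψ : (Fin n → ℝ) → F} (hψ : IsTest W ψ)
    {G γ : (Fin n → ℝ) → ℝ} (hG : ContDiff ℝ 1 G)
    (hγ : ∀ y r, dirD r G y = γ y * ∑ q, g y q * dirD r (fun y => g y q) y) :
    ∫ y, wt A B p y • (G y • D.adj b ψ y) =
      ∫ y, wt A B p y • ((γ y * ∑ q, g y q * b q y) • ψ y) := by
  have hu : ∀ m, ContDiff ℝ 1 fun y => G y • D.coef b m y • ψ y := fun m =>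
    hG.smul (((D.contDiff_coef hb m).smul hψ.contDiff).of_le (by exact_mod_cast le_top))
  have hc : ∀ m, HasCompactSupport fun y => G y • D.coef b m y • ψ y := fun m =>
    (hψ.smul (D.contDiff_coef hb m)).hasCompactSupport.smul_left
  have hI : ∀ m, Integrable fun y =>
      wt A B p y • dirD (D.r m) (fun y => G y • D.coef b m y • ψ y) y :=
    fun m => integrable_wt_smul hp (((hu m).continuous_fderiv (by simp)).clm_apply continuous_const)
      ((hc m).fderiv_apply (𝕜 := ℝ) _)
  have h0 : ∫ y, ∑ m, wt A B p y • dirD (D.r m) (fun y => G y • D.coef b m y • ψ y) y = 0 := by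
    rw [integral_finsetSum _ fun m _ => hI m]
    exact Finset.sum_eq_zero fun m _ => integral_wt_smul_fderiv_eq_zero hp (D.r_eq_zero_left m)
      (D.r_eq_zero_right m) (hu m) (hc m)
  have hpt : ∀ y, ∑ m, dirD (D.r m) (fun y => G y • D.coef b m y • ψ y) y =
      (γ y * ∑ q, g y q * b q y) • ψ y - G y • D.adj b ψ y := fun y => by
    have h1 : ∀ m, dirD (D.r m) (fun y => G y • D.coef b m y • ψ y) y =
        G y • dirD (D.r m) (fun y => D.coef b m y • ψ y) y +
          (γ y * ∑ q, g y q * (D.coef b m y * dirD (D.r m) (fun y => g y q) y)) • ψ y := fun m => by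
      rw [dirD_smul ((hG.differentiable (by simp)) y)
        (hψ.smul (D.contDiff_coef hb m)).differentiableAt, hγ, smul_smul, mul_assoc, Finset.sum_mul]
      congr 4
      funext q
      ring
    simp only [h1, Finset.sum_add_distrib, ← Finset.smul_sum, ← Finset.sum_smul, ← Finset.mul_sum,
      adj]
    rw [Finset.sum_comm]
    simp only [← Finset.mul_sum]
    by_cases hy : y ∈ W
    · simp only [D.sum_coef_mul b hy, smul_neg]
      abel
    · simp [hψ.eq_zero hy]
  simp only [← Finset.smul_sum, hpt] at h0
  simp only [smul_sub] at h0
  have hI1 : Integrable fun y => wt A B p y • (G y • D.adj b ψ y) :=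
    integrable_wt_smul hp (hG.continuous.smul (D.isTest_adj hb hψ).contDiff.continuous)
      (D.isTest_adj hb hψ).hasCompactSupport.smul_left
  have hI2 : Integrable fun y => wt A B p y • ((γ y * ∑ q, g y q * b q y) • ψ y) := by
    have := integrable_finsetSum Finset.univ fun m (_ : m ∈ Finset.univ) => hI m
    simp only [← Finset.smul_sum, hpt] at this
    refine (this.add hI1).congr (Eventually.of_forall fun y => ?_)
    simp [smul_sub]
  rw [integral_sub hI2 hI1, sub_eq_zero] at h0
  exact h0.symm

/-- Test functions which vanish to order `k` along `g = 0`: sums of products of `k` components of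
`g` with a test function. -/
def Vanishing (W : Set (Fin n → ℝ)) (g : (Fin n → ℝ) → EuclideanSpace ℝ (Fin l)) :
    ℕ → ((Fin n → ℝ) → F) → Prop
  | 0, ψ => IsTest W ψ
  | k + 1, ψ => ∃ φ : Fin l → (Fin n → ℝ) → F, (∀ q, Vanishing W g k (φ q)) ∧
      ψ = fun y => ∑ q, g y q • φ q y

lemma Vanishing.isTest (D : TransverseFrame A B W g) {k : ℕ} {ψ : (Fin n → ℝ) → F}
    (h : Vanishing W g k ψ) : IsTest W ψ := by
  induction k generalizing ψ with
  | zero => exact h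
  | succ k ih =>
    obtain ⟨φ, hφ, rfl⟩ := h
    exact IsTest.sum _ fun q _ => (ih (hφ q)).smul (D.contDiff_comp q)

lemma Vanishing.zero (k : ℕ) : Vanishing W g k (fun _ => 0 : (Fin n → ℝ) → F) := by
  induction k with
  | zero => exact IsTest.zero
  | succ k ih => exact ⟨fun _ _ => 0, fun _ => ih, by simp⟩

/-- The Euler field of `g` has divergence `l` along `g = 0`, and `g_q` is an eigenfunction of it:
hence `l + k` plus its adjoint raises the order of vanishing. -/
lemma Vanishing.euler {k : ℕ} {ψ : (Fin n → ℝ) → F} (h : Vanishing W g k ψ) :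
    Vanishing W g (k + 1) fun y => ((l : ℝ) + k) • ψ y + D.adj (fun q y => g y q) ψ y := by
  induction k generalizing ψ with
  | zero =>
    refine ⟨fun q y => -∑ m, dirD (D.r m) (fun y => D.a m q y • ψ y) y,
      fun q => (IsTest.sum _ fun m _ => (IsTest.smul h (D.contDiff_a m q)).dirD _).neg, ?_⟩
    funext y
    have h' : IsTest W ψ := h
    have h1 : ∀ m, dirD (D.r m) (fun y => D.coef (fun q y => g y q) m y • ψ y) y =
        ∑ q, (g y q • dirD (D.r m) (fun y => D.a m q y • ψ y) y +
          (D.a m q y * dirD (D.r m) (fun y => g y q) y) • ψ y) := fun m => by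
      have h2 : (fun y => D.coef (fun q y => g y q) m y • ψ y) =
          fun y => ∑ q, g y q • (D.a m q y • ψ y) := by
        funext y; simp only [coef, Finset.sum_smul, smul_smul]
      rw [h2, dirD_sum _ fun q _ =>
        ((h'.smul (D.contDiff_a m q)).smul (D.contDiff_comp q)).differentiableAt]
      refine Finset.sum_congr rfl fun q _ => ?_
      rw [dirD_smul (((D.contDiff_comp q).differentiable (by simp)) y)
        (h'.smul (D.contDiff_a m q)).differentiableAt, smul_smul, mul_comm (D.a m q y)]
    simp only [adj, h1, Finset.sum_add_distrib]
    rw [Finset.sum_comm, Finset.sum_comm (f := fun m q => (D.a m q y * _) • ψ y)]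
    simp only [← Finset.smul_sum, ← Finset.sum_smul]
    by_cases hy : y ∈ W
    · simp [D.inverse y hy]
    · simp [h'.eq_zero hy]
  | succ k ih =>
    obtain ⟨φ, hφ, rfl⟩ := h
    refine ⟨_, fun q => ih (hφ q), ?_⟩
    funext y
    have ht : ∀ q, IsTest W (φ q) := fun q => Vanishing.isTest D (hφ q)
    rw [D.adj_sum D.contDiff_comp Finset.univ fun q _ => (ht q).smul (D.contDiff_comp q)]
    rw [Finset.smul_sum, ← Finset.sum_add_distrib]
    refine Finset.sum_congr rfl fun q _ => ?_
    rw [D.adj_smul D.contDiff_comp (ht q)]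
    push_cast
    module

/-- The formal adjoint of the field `∂ / ∂y_k - Σ coef_m ∂_{r_m}`, whose coefficients are chosen
such that it annihilates `g`. -/
def edgeAdj (k : Fin n) (ψ : (Fin n → ℝ) → F) (y : Fin n → ℝ) : F :=
  -dirD (Pi.single k 1) ψ y - D.adj (fun q => dirD (Pi.single k 1) fun y => g y q) ψ y

lemma contDiff_dirD_comp (D : TransverseFrame A B W g) (r : Fin n → ℝ) (q : Fin l) :
    ContDiff ℝ ∞ (dirD r fun y => g y q) :=
  contDiff_dirD (D.contDiff_comp q) r

lemma isTest_edgeAdj (k : Fin n) {ψ : (Fin n → ℝ) → F} (hψ : IsTest W ψ) :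
    IsTest W (D.edgeAdj k ψ) := by
  have := (hψ.dirD (Pi.single k 1)).neg.add
    (D.isTest_adj (D.contDiff_dirD_comp (Pi.single k 1)) hψ).neg
  simp only [← sub_eq_add_neg] at this
  exact this

/-- A field annihilating `g` does not lower the order of vanishing along `g = 0`. -/
lemma Vanishing.edgeAdj (k : Fin n) {j : ℕ} {ψ : (Fin n → ℝ) → F} (h : Vanishing W g j ψ) :
    Vanishing W g j (D.edgeAdj k ψ) := by
  induction j generalizing ψ with
  | zero => exact D.isTest_edgeAdj k h
  | succ j ih =>
    obtain ⟨φ, hφ, rfl⟩ := h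
    refine ⟨_, fun q => ih (hφ q), ?_⟩
    funext y
    have ht : ∀ q, IsTest W (φ q) := fun q => Vanishing.isTest D (hφ q)
    rw [TransverseFrame.edgeAdj, D.adj_sum (D.contDiff_dirD_comp _) Finset.univ
      fun q _ => (ht q).smul (D.contDiff_comp q),
      dirD_sum _ fun q _ => ((ht q).smul (D.contDiff_comp q)).differentiableAt,
      ← Finset.sum_neg_distrib, ← Finset.sum_sub_distrib]
    refine Finset.sum_congr rfl fun q _ => ?_
    rw [D.adj_smul (D.contDiff_dirD_comp _) (ht q),
      dirD_smul (((D.contDiff_comp q).differentiable (by simp)) y) (ht q).differentiableAt,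
      TransverseFrame.edgeAdj, smul_sub, smul_neg]
    abel

/-- Integration by parts against the field which annihilates `g` and restricts to `∂ / ∂y_k` modulo
the frame: no derivative of `G` appears, and the exponent of `y_k` is raised by one. -/
lemma integral_edgeAdj (hAB : Disjoint A B) {p : A → ℝ} (hp : ∀ k, -1 < p k) (k : A) (hk : 0 < p k)
    {ψ : (Fin n → ℝ) → F} (hψ : IsTest W ψ) {G γ : (Fin n → ℝ) → ℝ} (hG : ContDiff ℝ 1 G)
    (hγ : ∀ y r, dirD r G y = γ y * ∑ q, g y q * dirD r (fun y => g y q) y) :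
    (p k + 1) • ∫ y, wt A B p y • (G y • ψ y) =
      ∫ y, wt A B (p + Pi.single k 1) y • (G y • D.edgeAdj k ψ y) := by
  have hp' : ∀ j, -1 < (p + Pi.single k 1 : A → ℝ) j := fun j => by
    have := hp j
    have h0 : 0 ≤ (Pi.single k 1 : A → ℝ) j := by
      by_cases h : j = k
      · subst h; simp
      · simp [h]
    simp only [Pi.add_apply]
    linarith
  set e : Fin n → ℝ := Pi.single (k : Fin n) 1 with he
  have hu : ContDiff ℝ 1 fun y => G y • ψ y :=
    hG.smul (hψ.contDiff.of_le (by exact_mod_cast le_top))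
  have hc : HasCompactSupport fun y => G y • ψ y := hψ.hasCompactSupport.smul_left
  have hb := D.contDiff_dirD_comp e
  have hI := D.integral_adj hp' hb hψ hG hγ
  rw [integral_wt_smul_fderiv_single hp hAB k hk hu hc, ← integral_neg, ← he]
  have hIa : Integrable fun y =>
      wt A B (p + Pi.single k 1) y • (-(fderiv ℝ (fun y => G y • ψ y) y e)) :=
    integrable_wt_smul hp' ((hu.continuous_fderiv (by simp)).clm_apply continuous_const).neg
      (hc.fderiv_apply (𝕜 := ℝ) e).neg
  have hIb : Integrable fun y => wt A B (p + Pi.single k 1) y • (G y • D.edgeAdj k ψ y) :=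
    integrable_wt_smul hp' (hG.continuous.smul (D.isTest_edgeAdj k hψ).contDiff.continuous)
      (D.isTest_edgeAdj k hψ).hasCompactSupport.smul_left
  have hIc : Integrable fun y => wt A B (p + Pi.single k 1) y •
      (G y • D.adj (fun q => dirD e fun y => g y q) ψ y) :=
    integrable_wt_smul hp' (hG.continuous.smul (D.isTest_adj hb hψ).contDiff.continuous)
      (D.isTest_adj hb hψ).hasCompactSupport.smul_left
  have hpt : ∀ y, -(fderiv ℝ (fun y => G y • ψ y) y e) = G y • D.edgeAdj k ψ y +
      G y • D.adj (fun q => dirD e fun y => g y q) ψ y -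
      (γ y * ∑ q, g y q * dirD e (fun y => g y q) y) • ψ y := fun y => by
    have := dirD_smul ((hG.differentiable (by simp)) y) hψ.differentiableAt e
    rw [dirD] at this
    rw [this, hγ, edgeAdj, smul_sub, smul_neg]
    abel
  have hId : Integrable fun y => wt A B (p + Pi.single k 1) y •
      ((γ y * ∑ q, g y q * dirD e (fun y => g y q) y) • ψ y) := by
    refine ((hIb.add hIc).sub hIa).congr (Eventually.of_forall fun y => ?_)
    simp only [Pi.sub_apply, Pi.add_apply, hpt, smul_sub, smul_add]
    abel
  have hpt' : ∀ y, -(wt A B (p + Pi.single k 1) y • fderiv ℝ (fun y => G y • ψ y) y e) =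
      wt A B (p + Pi.single k 1) y • (G y • D.edgeAdj k ψ y) +
      wt A B (p + Pi.single k 1) y • (G y • D.adj (fun q => dirD e fun y => g y q) ψ y) -
      wt A B (p + Pi.single k 1) y •
        ((γ y * ∑ q, g y q * dirD e (fun y => g y q) y) • ψ y) := fun y => by
    rw [← smul_neg, hpt, smul_sub, smul_add]
  simp only [hpt']
  refine (integral_sub (hIb.add hIc) hId).trans ?_
  rw [integral_add' hIb hIc, hI, add_sub_cancel_right]

end TransverseFrame
end Fields

/-! ### Integrability of powers of a submersion -/

section Integrability
open MeasureTheory Filter Set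

/-- A smooth function with compact support in `W` which is `1` on a given compact subset. -/
lemma exists_isTest_eq_one {W K : Set (Fin n → ℝ)} (hW : IsOpen W) (hK : IsCompact K)
    (hKW : K ⊆ W) : ∃ χ : (Fin n → ℝ) → ℝ, IsTest W χ ∧ (∀ y, 0 ≤ χ y) ∧ ∀ y ∈ K, χ y = 1 := by
  obtain ⟨K', hK', hKK', hK'W⟩ := exists_compact_between hK hW hKW
  obtain ⟨f, hf1, hf0, hf⟩ := exists_contMDiffMap_one_nhds_of_subset_interior (n := ⊤)
    (modelWithCornersSelf ℝ (Fin n → ℝ)) hK.isClosed hKK'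
  have hs : tsupport f ⊆ K' := closure_minimal (fun y hy => by
    by_contra h; exact hy (hf0 y h)) hK'.isClosed
  exact ⟨f, ⟨f.contMDiff.contDiff, hK'.of_isClosed_subset (isClosed_tsupport _) hs,
    hs.trans hK'W⟩, fun y => (hf y).1, fun y hy => hf1.self_of_nhdsSet y hy⟩

variable {F : Type*} [NormedAddCommGroup F] [NormedSpace ℝ F]
variable {A B : Finset (Fin n)} {W : Set (Fin n → ℝ)}
  {g : (Fin n → ℝ) → EuclideanSpace ℝ (Fin l)}

lemma IsTest.exists_norm_le (hW : IsOpen W) {ψ : (Fin n → ℝ) → F} (h : IsTest W ψ) :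
    ∃ χ : (Fin n → ℝ) → ℝ, IsTest W χ ∧ (∀ y, 0 ≤ χ y) ∧ ∀ y, ‖ψ y‖ ≤ χ y := by
  obtain ⟨χ, hχ, h0, h1⟩ := exists_isTest_eq_one hW h.hasCompactSupport h.tsupport_subset
  obtain ⟨C, hC⟩ := h.hasCompactSupport.exists_bound_of_continuous h.contDiff.continuous
  have hC0 : 0 ≤ C := (norm_nonneg _).trans (hC 0)
  refine ⟨fun y => C • χ y, hχ.const_smul C, fun y => mul_nonneg hC0 (h0 y), fun y => ?_⟩
  by_cases hy : y ∈ tsupport ψ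
  · simpa [h1 y hy] using hC y
  · rw [image_eq_zero_of_notMem_tsupport hy, norm_zero]
    exact mul_nonneg hC0 (h0 y)

lemma TransverseFrame.Vanishing.exists_norm_le (hW : IsOpen W) {k : ℕ} {ψ : (Fin n → ℝ) → F}
    (h : TransverseFrame.Vanishing W g k ψ) :
    ∃ χ : (Fin n → ℝ) → ℝ, IsTest W χ ∧ (∀ y, 0 ≤ χ y) ∧ ∀ y, ‖ψ y‖ ≤ ‖g y‖ ^ k * χ y := by
  induction k generalizing ψ with
  | zero => simpa using IsTest.exists_norm_le hW h
  | succ k ih =>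
    obtain ⟨φ, hφ, rfl⟩ := h
    choose χ hχ h0 hle using fun q => ih (hφ q)
    refine ⟨fun y => ∑ q, χ q y, IsTest.sum _ fun q _ => hχ q,
      fun y => Finset.sum_nonneg fun q _ => h0 q y, fun y => ?_⟩
    rw [Finset.mul_sum]
    refine (norm_sum_le _ _).trans (Finset.sum_le_sum fun q _ => ?_)
    rw [norm_smul, pow_succ, mul_comm (‖g y‖ ^ k), mul_assoc]
    exact mul_le_mul (PiLp.norm_apply_le _ _) (hle q y) (norm_nonneg _) (norm_nonneg _)

lemma integrable_wt_smul_test {p : A → ℝ} (hp : ∀ k, -1 < p k) {G : (Fin n → ℝ) → ℝ}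
    (hG : Continuous G) {ψ : (Fin n → ℝ) → F} (h : IsTest W ψ) :
    Integrable fun y => wt A B p y • (G y • ψ y) :=
  integrable_wt_smul hp (hG.smul h.contDiff.continuous) h.hasCompactSupport.smul_left

lemma norm_sq_eq_sum (x : EuclideanSpace ℝ (Fin l)) : ‖x‖ ^ 2 = ∑ q, x q * x q := by
  rw [EuclideanSpace.real_norm_sq_eq]
  exact Finset.sum_congr rfl fun q _ => sq _

/-- The regularization `(|g|² + ε) ^ (t / 2)` of `|g| ^ t`. -/
def regPow (g : (Fin n → ℝ) → EuclideanSpace ℝ (Fin l)) (ε t : ℝ) (y : Fin n → ℝ) : ℝ :=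
  (‖g y‖ ^ 2 + ε) ^ (t / 2)

lemma contDiff_regPow (hg : ContDiff ℝ ∞ g) {ε : ℝ} (hε : 0 < ε) (t : ℝ) :
    ContDiff ℝ ∞ (regPow g ε t) :=
  ((hg.norm_sq ℝ).add contDiff_const).rpow_const_of_ne fun y => by positivity

lemma dirD_norm_sq (hg : ContDiff ℝ ∞ g) (y r : Fin n → ℝ) :
    HasFDerivAt (fun y => ‖g y‖ ^ 2) (fderiv ℝ (fun y => ‖g y‖ ^ 2) y) y ∧
    fderiv ℝ (fun y => ‖g y‖ ^ 2) y r = 2 * ∑ q, g y q * dirD r (fun y => g y q) y := by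
  have hd : ∀ q, DifferentiableAt ℝ (fun y => g y q) y := fun q =>
    ((EuclideanSpace.proj q : EuclideanSpace ℝ (Fin l) →L[ℝ] ℝ).contDiff.comp hg).differentiable
      (by simp) y
  refine ⟨((hg.norm_sq ℝ).differentiable (by simp) y).hasFDerivAt, ?_⟩
  simp only [norm_sq_eq_sum]
  rw [fderiv_fun_sum (A := fun q y => g y q * g y q) fun q _ => (hd q).mul (hd q), Finset.mul_sum]
  simp only [sum_apply]
  refine Finset.sum_congr rfl fun q _ => ?_
  rw [fderiv_fun_mul (hd q) (hd q)]
  simp only [dirD, add_apply, smul_apply, smul_eq_mul]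
  ring

lemma dirD_regPow (hg : ContDiff ℝ ∞ g) {ε : ℝ} (hε : 0 < ε) (t : ℝ) (y r : Fin n → ℝ) :
    dirD r (regPow g ε t) y =
      (t * (‖g y‖ ^ 2 + ε) ^ (t / 2 - 1)) * ∑ q, g y q * dirD r (fun y => g y q) y := by
  obtain ⟨h1, h2⟩ := dirD_norm_sq hg y r
  have h3 := (h1.add_const ε).rpow_const (p := t / 2) (Or.inl (by positivity))
  rw [dirD, show regPow g ε t = fun y => (‖g y‖ ^ 2 + ε) ^ (t / 2) from rfl, h3.fderiv]
  simp only [smul_apply, smul_eq_mul, h2]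
  ring

/-- Integrating against the Euler field of `g` bounds the integral of a function `G` of `|g|`,
growing like `|g| ^ t` with `t > -l`, by that of a function growing like `|g| ^ (t + 1)`. -/
lemma TransverseFrame.integral_le_of_euler (D : TransverseFrame A B W g)
    {p : A → ℝ} (hp : ∀ k, -1 < p k) {t : ℝ} {χ χ' : (Fin n → ℝ) → ℝ} (hχ : IsTest W χ)
    (hχ0 : ∀ y, 0 ≤ χ y) (hχ' : IsTest W χ') (hχ'0 : ∀ y, 0 ≤ χ' y)
    (hle : ∀ y, l * χ y + D.adj (fun q y => g y q) χ y ≤ ‖g y‖ * χ' y)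
    {G G' γ : (Fin n → ℝ) → ℝ} (hG : ContDiff ℝ 1 G) (hG' : Continuous G') (hγc : Continuous γ)
    (hγ : ∀ y r, dirD r G y = γ y * ∑ q, g y q * dirD r (fun y => g y q) y)
    (hG0 : ∀ y, 0 ≤ G y) (h1 : ∀ y, t * G y ≤ γ y * ∑ q, g y q * g y q)
    (h2 : ∀ y, G y * ‖g y‖ ≤ G' y) :
    (t + l) * ∫ y, wt A B p y • (G y • χ y) ≤ ∫ y, wt A B p y • (G' y • χ' y) := by
  have hI := D.integral_adj hp D.contDiff_comp hχ hG hγ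
  have hI0 := integrable_wt_smul_test (A := A) (B := B) hp hG.continuous hχ
  have hI1 := integrable_wt_smul_test (A := A) (B := B) hp hG.continuous
    (D.isTest_adj (F := ℝ) D.contDiff_comp hχ)
  have hI2 := integrable_wt_smul_test (A := A) (B := B) hp hG.continuous (hχ.const_smul l)
  have hI3 := integrable_wt_smul_test (A := A) (B := B) hp
    (G := fun y => γ y * ∑ q, g y q * g y q) (hγc.mul (continuous_finsetSum _ fun q _ =>
      (D.contDiff_comp q).continuous.mul (D.contDiff_comp q).continuous)) hχ
  have hI4 := integrable_wt_smul_test (A := A) (B := B) hp hG' hχ'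
  calc (t + l) * ∫ y, wt A B p y • (G y • χ y)
      = ∫ y, (t + l) * (wt A B p y • (G y • χ y)) := (integral_const_mul _ _).symm
    _ ≤ ∫ y, (wt A B p y • ((γ y * ∑ q, g y q * g y q) • χ y) +
          wt A B p y • (G y • ((l : ℝ) • χ y))) := by
        refine integral_mono (hI0.const_mul _) (hI3.add hI2) fun y => ?_
        have := mul_le_mul_of_nonneg_left (mul_le_mul_of_nonneg_right (h1 y) (hχ0 y))
          (wt_nonneg (A := A) (B := B) (p := p) y)
        simp only [smul_eq_mul]
        linarith
    _ = ∫ y, (wt A B p y • (G y • D.adj (fun q y => g y q) χ y) +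
          wt A B p y • (G y • ((l : ℝ) • χ y))) := by
        rw [integral_add hI3 hI2, integral_add hI1 hI2, hI]
    _ ≤ ∫ y, wt A B p y • (G' y • χ' y) := by
        refine integral_mono (hI1.add hI2) hI4 fun y => ?_
        simp only [smul_eq_mul, ← mul_add]
        refine mul_le_mul_of_nonneg_left ?_ (wt_nonneg _)
        calc G y * (D.adj (fun q y => g y q) χ y + l * χ y) ≤ G y * (‖g y‖ * χ' y) :=
              mul_le_mul_of_nonneg_left (by linarith [hle y]) (hG0 y)
          _ = G y * ‖g y‖ * χ' y := by ring
          _ ≤ _ := mul_le_mul_of_nonneg_right (h2 y) (hχ'0 y)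

/-- Along a transverse frame `|g| ^ t` is locally integrable for `t > -l`, uniformly after
regularization. -/
lemma TransverseFrame.exists_integral_regPow_le (D : TransverseFrame A B W g) (hW : IsOpen W)
    {p : A → ℝ} (hp : ∀ k, -1 < p k) (j : ℕ) {t : ℝ} (ht : -(l : ℝ) < t) (htj : -(j : ℝ) ≤ t)
    {χ : (Fin n → ℝ) → ℝ} (hχ : IsTest W χ) (hχ0 : ∀ y, 0 ≤ χ y) :
    ∃ C : ℝ, ∀ ε : ℝ, 0 < ε → ε ≤ 1 → ∫ y, wt A B p y • (regPow g ε t y • χ y) ≤ C := by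
  have hbase : ∀ t : ℝ, 0 ≤ t → ∀ χ : (Fin n → ℝ) → ℝ, IsTest W χ → (∀ y, 0 ≤ χ y) →
      ∃ C : ℝ, ∀ ε : ℝ, 0 < ε → ε ≤ 1 → ∫ y, wt A B p y • (regPow g ε t y • χ y) ≤ C := by
    intro t ht χ hχ hχ0
    refine ⟨∫ y, wt A B p y • (regPow g 1 t y • χ y), fun ε hε hε1 => ?_⟩
    refine integral_mono
      (integrable_wt_smul_test hp (contDiff_regPow D.contDiff_g hε _).continuous hχ)
      (integrable_wt_smul_test hp (contDiff_regPow D.contDiff_g one_pos _).continuous hχ)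
      fun y => ?_
    refine mul_le_mul_of_nonneg_left (mul_le_mul_of_nonneg_right ?_ (hχ0 y)) (wt_nonneg _)
    exact Real.rpow_le_rpow (by positivity) (by linarith) (by positivity)
  induction j generalizing t χ with
  | zero => exact hbase t (by simpa using htj) χ hχ hχ0
  | succ j ih =>
    by_cases ht0 : 0 ≤ t
    · exact hbase t ht0 χ hχ hχ0
    push Not at ht0
    obtain ⟨χ', hχ', hχ'0, hle⟩ :=
      (TransverseFrame.Vanishing.euler D (k := 0) (ψ := χ) hχ).exists_norm_le hW
    obtain ⟨C, hC⟩ := ih (t := t + 1) (χ := χ') (by linarith) (by push_cast at htj; linarith)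
      hχ' hχ'0
    have htl : 0 < t + l := by linarith
    refine ⟨(t + l)⁻¹ * C, fun ε hε hε1 => ?_⟩
    rw [← div_eq_inv_mul, le_div_iff₀ htl, mul_comm]
    have hN : ∀ y, 0 < ‖g y‖ ^ 2 + ε := fun y => by positivity
    have h3 : (fun y => t * (‖g y‖ ^ 2 + ε) ^ (t / 2 - 1)) = fun y => t * regPow g ε (t - 2) y := by
      funext y; rw [regPow]; congr 2; ring
    refine le_trans (D.integral_le_of_euler hp hχ hχ0 hχ' hχ'0 (fun y => ?_)
      (G' := regPow g ε (t + 1)) (γ := fun y => t * (‖g y‖ ^ 2 + ε) ^ (t / 2 - 1))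
      ((contDiff_regPow D.contDiff_g hε t).of_le (by exact_mod_cast le_top))
      (contDiff_regPow D.contDiff_g hε _).continuous ?_
      (fun y r => dirD_regPow D.contDiff_g hε t y r) (fun y => ?_) (fun y => ?_) fun y => ?_)
      (hC ε hε hε1)
    · have := (le_abs_self _).trans (hle y)
      simpa using this
    · rw [h3]
      exact continuous_const.mul (contDiff_regPow D.contDiff_g hε _).continuous
    · exact Real.rpow_nonneg (hN y).le _
    · have h2 : regPow g ε t y = (‖g y‖ ^ 2 + ε) ^ (t / 2 - 1) * (‖g y‖ ^ 2 + ε) := by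
        rw [regPow, ← Real.rpow_add_one (hN y).ne', sub_add_cancel]
      rw [h2, ← norm_sq_eq_sum]
      have h4 : 0 ≤ (‖g y‖ ^ 2 + ε) ^ (t / 2 - 1) * (-t * ε) :=
        mul_nonneg (Real.rpow_nonneg (hN y).le _) (by nlinarith)
      linarith
    · have h6 : regPow g ε (t + 1) y = regPow g ε t y * Real.sqrt (‖g y‖ ^ 2 + ε) := by
        rw [regPow, regPow, Real.sqrt_eq_rpow, ← Real.rpow_add (hN y)]
        congr 1; ring
      rw [h6]
      exact mul_le_mul_of_nonneg_left (Real.le_sqrt_of_sq_le (by linarith))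
        (Real.rpow_nonneg (hN y).le _)

/-- Local integrability of `|g| ^ t` for `t > -l`, and `g ≠ 0` almost everywhere. -/
lemma TransverseFrame.integrable_norm_rpow (D : TransverseFrame A B W g) (hW : IsOpen W)
    {p : A → ℝ} (hp : ∀ k, -1 < p k) {t : ℝ} (ht : -(l : ℝ) < t)
    {χ : (Fin n → ℝ) → ℝ} (hχ : IsTest W χ) (hχ0 : ∀ y, 0 ≤ χ y) :
    Integrable (fun y => wt A B p y * (‖g y‖ ^ t * χ y)) ∧
      (t < 0 → ∀ᵐ y, wt A B p y * χ y ≠ 0 → g y ≠ 0) := by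
  obtain ⟨j, hj⟩ := exists_nat_ge (-t)
  obtain ⟨C, hC⟩ := D.exists_integral_regPow_le hW hp j ht (by linarith) hχ hχ0
  have hg : Measurable g := D.contDiff_g.continuous.measurable
  have hχm : Measurable χ := hχ.contDiff.continuous.measurable
  set ε : ℕ → ℝ := fun k => 1 / ((k : ℝ) + 1) with hε
  have hε0 : ∀ k, 0 < ε k := fun k => by positivity
  have hε1 : ∀ k, ε k ≤ 1 := fun k => by
    rw [hε]; beta_reduce
    rw [div_le_one (by positivity)]
    linarith [(Nat.cast_nonneg k : (0 : ℝ) ≤ k)]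
  have hlim : Tendsto ε atTop (𝓝 0) := tendsto_one_div_add_atTop_nhds_zero_nat (𝕜 := ℝ)
  set f : ℕ → (Fin n → ℝ) → ENNReal := fun k y =>
    ENNReal.ofReal (wt A B p y * χ y) * ENNReal.ofReal (‖g y‖ ^ 2 + ε k) ^ (t / 2) with hf
  set f₀ : (Fin n → ℝ) → ENNReal := fun y =>
    ENNReal.ofReal (wt A B p y * χ y) * ENNReal.ofReal (‖g y‖ ^ 2) ^ (t / 2) with hf₀
  have hfm : ∀ k, Measurable (f k) := fun k => by
    have := measurable_wt (A := A) (B := B) (p := p)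
    fun_prop
  have hf₀m : Measurable f₀ := by
    have := measurable_wt (A := A) (B := B) (p := p)
    fun_prop
  have hle : ∀ k, ∫⁻ y, f k y ≤ ENNReal.ofReal C := fun k => by
    have h1 : ∀ y, f k y = ENNReal.ofReal (wt A B p y • (regPow g (ε k) t y • χ y)) := fun y => by
      have : 0 < ‖g y‖ ^ 2 + ε k := by have := hε0 k; positivity
      rw [hf]
      beta_reduce
      rw [ENNReal.ofReal_rpow_of_pos this, ← ENNReal.ofReal_mul
        (mul_nonneg (wt_nonneg _) (hχ0 y)), smul_eq_mul, smul_eq_mul, regPow]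
      congr 1; ring
    simp only [h1]
    rw [← ofReal_integral_eq_lintegral_ofReal]
    · exact ENNReal.ofReal_le_ofReal (hC _ (hε0 k) (hε1 k))
    · exact integrable_wt_smul_test hp (contDiff_regPow D.contDiff_g (hε0 k) _).continuous hχ
    · refine Eventually.of_forall fun y => mul_nonneg (wt_nonneg _) (mul_nonneg ?_ (hχ0 y))
      rw [regPow]
      have := hε0 k
      positivity
  have hlimf : ∀ y, Tendsto (fun k => f k y) atTop (𝓝 (f₀ y)) := fun y => by
    refine ENNReal.Tendsto.const_mul ?_ (Or.inr ENNReal.ofReal_ne_top)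
    refine ((ENNReal.continuous_rpow_const (y := t / 2)).tendsto _).comp ?_
    refine (ENNReal.continuous_ofReal.tendsto _).comp ?_
    simpa using hlim.const_add (‖g y‖ ^ 2)
  have hfin : ∫⁻ y, f₀ y < ⊤ := by
    have h2 := lintegral_liminf_le (μ := volume) (u := atTop) hfm
    simp only [(hlimf _).liminf_eq] at h2
    refine lt_of_le_of_lt (h2.trans ?_) (ENNReal.ofReal_lt_top (r := C))
    refine (liminf_le_liminf (v := fun _ => ENNReal.ofReal C)
      (Eventually.of_forall hle)).trans_eq ?_
    exact liminf_const _
  refine ⟨⟨?_, ?_⟩, fun ht0 => ?_⟩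
  · have := measurable_wt (A := A) (B := B) (p := p)
    exact (by fun_prop : Measurable fun y => wt A B p y * (‖g y‖ ^ t * χ y)).aestronglyMeasurable
  · rw [hasFiniteIntegral_iff_ofReal (Eventually.of_forall fun y =>
      mul_nonneg (wt_nonneg _) (mul_nonneg (by positivity) (hχ0 y)))]
    refine lt_of_le_of_lt (lintegral_mono fun y => ?_) hfin
    rw [hf₀]
    beta_reduce
    have h3 : wt A B p y * (‖g y‖ ^ t * χ y) = (wt A B p y * χ y) * ‖g y‖ ^ t := by ring
    rw [h3, ENNReal.ofReal_mul (mul_nonneg (wt_nonneg _) (hχ0 y))]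
    refine mul_le_mul_right ?_ _
    rcases (norm_nonneg (g y)).eq_or_lt with h | h
    · rw [← h]
      by_cases ht : t = 0
      · simp [ht]
      · simp [Real.zero_rpow ht]
    · rw [ENNReal.ofReal_rpow_of_pos (by positivity), ← Real.rpow_natCast, ← Real.rpow_mul h.le]
      refine le_of_eq (congrArg (fun t => ENNReal.ofReal (‖g y‖ ^ t)) ?_)
      push_cast; ring
  · filter_upwards [ae_lt_top hf₀m hfin.ne] with y hy hne h0
    have hpos : 0 < wt A B p y * χ y :=
      lt_of_le_of_ne (mul_nonneg (wt_nonneg _) (hχ0 y)) (Ne.symm hne)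
    rw [hf₀] at hy
    simp only [h0, norm_zero] at hy
    rw [zero_pow two_ne_zero, ENNReal.ofReal_zero, ENNReal.zero_rpow_of_neg (by linarith),
      ENNReal.mul_top (by simpa using hpos)] at hy
    exact lt_irrefl _ hy

end Integrability

/-! ### Holomorphy of integrals of complex powers -/

section Holomorphy
open MeasureTheory Filter Set

lemma abs_log_mul_rpow_le {Q ε t u : ℝ} (hQ : 0 < Q) (hε : 0 < ε) (hu : |u - t| ≤ ε) :
    |Real.log Q| * Q ^ u ≤ 2 / ε * (Q ^ (t - 2 * ε) + Q ^ (t + 2 * ε)) := by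
  have hlog : ε * |Real.log Q| ≤ Q ^ ε + Q ^ (-ε) := by
    have h1 : ε * Real.log Q ≤ Q ^ ε := by
      have := Real.add_one_le_exp (Real.log Q * ε)
      rw [← Real.rpow_def_of_pos hQ] at this
      linarith
    have h2 : -(ε * Real.log Q) ≤ Q ^ (-ε) := by
      have := Real.add_one_le_exp (Real.log Q * -ε)
      rw [← Real.rpow_def_of_pos hQ] at this
      linarith
    have h3 : 0 < Q ^ ε := by positivity
    have h4 : 0 < Q ^ (-ε) := by positivity
    rcases abs_cases (Real.log Q) with h | h <;> rw [h.1] <;> linarith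
  have hmid : ∀ v : ℝ, t - 2 * ε ≤ v → v ≤ t + 2 * ε →
      Q ^ v ≤ Q ^ (t - 2 * ε) + Q ^ (t + 2 * ε) := fun v h1 h2 => by
    have h3 : 0 < Q ^ (t - 2 * ε) := by positivity
    have h4 : 0 < Q ^ (t + 2 * ε) := by positivity
    rcases le_total 1 Q with h | h
    · have := Real.rpow_le_rpow_of_exponent_le h h2
      linarith
    · have := Real.rpow_le_rpow_of_exponent_ge hQ h h1
      linarith
  obtain ⟨hu1, hu2⟩ := abs_le.1 hu
  have h5 := hmid (ε + u) (by linarith) (by linarith)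
  have h6 := hmid (-ε + u) (by linarith) (by linarith)
  rw [Real.rpow_add hQ] at h5 h6
  rw [div_mul_eq_mul_div, le_div_iff₀ hε]
  have h7 : 0 < Q ^ u := by positivity
  calc |Real.log Q| * Q ^ u * ε = (ε * |Real.log Q|) * Q ^ u := by ring
    _ ≤ (Q ^ ε + Q ^ (-ε)) * Q ^ u := mul_le_mul_of_nonneg_right hlog h7.le
    _ ≤ _ := by linarith

variable {α : Type*} [MeasurableSpace α] {μ : Measure α}

/-- The integrals `∫ w Q ^ s` are holomorphic in `s` on every open vertical strip of absolute
convergence. -/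
theorem integrable_and_differentiableOn_integral_cpow {w : α → ℂ} {Q : α → ℝ}
    (hw : AEStronglyMeasurable w μ) (hQ : Measurable Q) (hpos : ∀ᵐ y ∂μ, w y ≠ 0 → 0 < Q y)
    {T : Set ℝ} (hT : IsOpen T) (hI : ∀ t ∈ T, Integrable (fun y => ‖w y‖ * Q y ^ t) μ) :
    (∀ s : ℂ, s.re ∈ T → Integrable (fun y => w y * (Q y : ℂ) ^ s) μ) ∧
      DifferentiableOn ℂ (fun s : ℂ => ∫ y, w y * (Q y : ℂ) ^ s ∂μ) {s | s.re ∈ T} := by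
  have hm : ∀ s : ℂ, AEStronglyMeasurable (fun y => w y * (Q y : ℂ) ^ s) μ := fun s =>
    hw.mul ((Complex.measurable_ofReal.comp hQ).pow_const s).aestronglyMeasurable
  have hnorm : ∀ (s : ℂ) (y : α), (w y ≠ 0 → 0 < Q y) →
      ‖w y * (Q y : ℂ) ^ s‖ = ‖w y‖ * Q y ^ s.re := fun s y hy => by
    by_cases h : w y = 0
    · simp [h]
    · rw [norm_mul, Complex.norm_cpow_eq_rpow_re_of_pos (hy h)]
  have hint : ∀ s : ℂ, s.re ∈ T → Integrable (fun y => w y * (Q y : ℂ) ^ s) μ := fun s hs => by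
    refine (hI s.re hs).mono' (hm s) ?_
    filter_upwards [hpos] with y hy
    exact (hnorm s y hy).le
  refine ⟨hint, fun s₀ hs₀ => ?_⟩
  obtain ⟨δ, hδ, hball⟩ := Metric.isOpen_iff.1 hT s₀.re hs₀
  set ε := δ / 4 with hε
  have hε0 : 0 < ε := by positivity
  have hT1 : s₀.re - 2 * ε ∈ T := hball (by
    rw [Metric.mem_ball, Real.dist_eq, abs_lt]; constructor <;> linarith)
  have hT2 : s₀.re + 2 * ε ∈ T := hball (by
    rw [Metric.mem_ball, Real.dist_eq, abs_lt]; constructor <;> linarith)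
  have hder := hasDerivAt_integral_of_dominated_loc_of_deriv_le (μ := μ) (𝕜 := ℂ)
    (F := fun s y => w y * (Q y : ℂ) ^ s)
    (F' := fun s y => w y * ((Q y : ℂ) ^ s * Real.log (Q y))) (x₀ := s₀)
    (bound := fun y => 2 / ε * (‖w y‖ * Q y ^ (s₀.re - 2 * ε) + ‖w y‖ * Q y ^ (s₀.re + 2 * ε)))
    (Metric.ball_mem_nhds s₀ hε0) (Eventually.of_forall hm) (hint s₀ hs₀) ?_ ?_
    (((hI _ hT1).add (hI _ hT2)).const_mul _) ?_
  · exact hder.2.differentiableAt.differentiableWithinAt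
  · refine hw.mul (Measurable.aestronglyMeasurable ?_)
    exact ((Complex.measurable_ofReal.comp hQ).pow_const s₀).mul
      (Complex.measurable_ofReal.comp (Real.measurable_log.comp hQ))
  · filter_upwards [hpos] with y hy s hs
    by_cases h : w y = 0
    · simp [h]
    · have hQy := hy h
      rw [norm_mul, norm_mul, Complex.norm_cpow_eq_rpow_re_of_pos hQy, Complex.norm_real,
        Real.norm_eq_abs, ← mul_add, mul_left_comm (2 / ε)]
      refine mul_le_mul_of_nonneg_left ?_ (norm_nonneg (w y))
      rw [mul_comm]
      refine abs_log_mul_rpow_le hQy hε0 ?_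
      have h1 : |(s - s₀).re| ≤ ‖s - s₀‖ := Complex.abs_re_le_norm _
      rw [Complex.sub_re] at h1
      exact h1.trans (by rw [← dist_eq_norm]; exact (Metric.mem_ball.1 hs).le)
  · filter_upwards [hpos] with y hy s _
    by_cases h : w y = 0
    · simpa [h] using hasDerivAt_const s (0 : ℂ)
    · have hQy := hy h
      have h1 := (hasDerivAt_id s).const_cpow (c := (Q y : ℂ))
        (Or.inl (by exact_mod_cast hQy.ne'))
      rw [Complex.ofReal_log hQy.le]
      simpa using h1.const_mul (w y)

end Holomorphy

/-! ### Local zeta functions -/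

section LocalZeta
open MeasureTheory Filter Set

/-- The exponents `σ_k - 1 + m_k` of the weight of a local zeta function at `s = 0`. -/
def shiftExp {A : Finset (Fin n)} (σ : Fin n → ℕ) (m : A → ℕ) : A → ℝ := fun k => σ k - 1 + m k

/-- The function `∏_{k ∈ A} |y_k| ^ d_k |g(y)|` raised to the power `s` in a local zeta function. -/
def locQ (A : Finset (Fin n)) (d : Fin n → ℕ) (g : (Fin n → ℝ) → EuclideanSpace ℝ (Fin l))
    (y : Fin n → ℝ) : ℝ := (∏ k : A, |y k| ^ d k) * ‖g y‖

/-- The integrand of a local zeta function, with the weight shifted by `m`. -/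
def locIntegrand (A B : Finset (Fin n)) (d σ : Fin n → ℕ)
    (g : (Fin n → ℝ) → EuclideanSpace ℝ (Fin l)) (m : A → ℕ) (ψ : (Fin n → ℝ) → ℂ) (s : ℂ)
    (y : Fin n → ℝ) : ℂ :=
  ((wt A B (shiftExp σ m) y : ℂ) * ψ y) * (locQ A d g y : ℂ) ^ s

/-- The local zeta function `∫ ∏_{k ∈ A} y_k ^ (d_k s + σ_k - 1 + m_k) |g| ^ s ψ`. -/
def locZeta (A B : Finset (Fin n)) (d σ : Fin n → ℕ)
    (g : (Fin n → ℝ) → EuclideanSpace ℝ (Fin l)) (m : A → ℕ) (ψ : (Fin n → ℝ) → ℂ) (s : ℂ) : ℂ :=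
  ∫ y, locIntegrand A B d σ g m ψ s y

variable {A B : Finset (Fin n)} {W : Set (Fin n → ℝ)} {d σ : Fin n → ℕ}
  {g : (Fin n → ℝ) → EuclideanSpace ℝ (Fin l)}

lemma locQ_nonneg (y : Fin n → ℝ) : 0 ≤ locQ A d g y := by
  rw [locQ]; positivity

lemma measurable_locQ (hg : Continuous g) : Measurable (locQ A d g) := by
  have h1 : Measurable fun y : Fin n → ℝ => ∏ k : A, |y k| ^ d k :=
    (by fun_prop : Continuous fun y : Fin n → ℝ => ∏ k : A, |y k| ^ d k).measurable
  exact h1.mul hg.norm.measurable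

/-- The exponents of the weight of a local zeta function at the real point `t`. -/
def expAt {A : Finset (Fin n)} (d σ : Fin n → ℕ) (m : A → ℕ) (t : ℝ) : A → ℝ :=
  fun k => d k * t + σ k - 1 + m k

lemma wt_mul_locQ_rpow (m : A → ℕ) (t : ℝ) (y : Fin n → ℝ) :
    wt A B (shiftExp σ m) y * locQ A d g y ^ t = wt A B (expAt d σ m t) y * ‖g y‖ ^ t := by
  have h : ∀ k : A, ppow (shiftExp σ m k) (y k) * (|y k| ^ d k) ^ t =
      ppow (expAt d σ m t k) (y k) := fun k => by
    rw [ppow, ppow]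
    split_ifs with hk
    · rw [abs_of_pos hk, ← Real.rpow_natCast, ← Real.rpow_mul hk.le, ← Real.rpow_add hk]
      congr 1
      rw [shiftExp, expAt]
      ring
    · simp
  rw [locQ, Real.mul_rpow (Finset.prod_nonneg fun k _ => by positivity) (norm_nonneg _),
    ← Real.finsetProd_rpow _ _ fun k _ => by positivity, wt, wt, ← mul_assoc]
  congr 1
  rw [mul_assoc, ← Finset.prod_mul_distrib]
  simp only [h]

lemma pos_of_wt_ne_zero {p : A → ℝ} {y : Fin n → ℝ} (h : wt A B p y ≠ 0) (k : A) : 0 < y k := by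
  rw [wt] at h
  have h1 := (Finset.prod_ne_zero_iff.1 (right_ne_zero_of_mul h)) k (Finset.mem_univ k)
  by_contra h2
  exact h1 (by rw [ppow, if_neg h2])

lemma locQ_pos {p : A → ℝ} {y : Fin n → ℝ} (h : wt A B p y ≠ 0) (hg : g y ≠ 0) :
    0 < locQ A d g y :=
  mul_pos (Finset.prod_pos fun k _ => pow_pos (abs_pos.2 (pos_of_wt_ne_zero h k).ne') _)
    (norm_pos_iff.2 hg)

lemma locZeta_ofReal (m : A → ℕ) (ψ : (Fin n → ℝ) → ℂ) (t : ℝ) :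
    locZeta A B d σ g m ψ t = ∫ y, wt A B (expAt d σ m t) y • (‖g y‖ ^ t • ψ y) := by
  rw [locZeta]
  refine integral_congr_ae (Eventually.of_forall fun y => ?_)
  simp only [locIntegrand, Complex.real_smul]
  rw [← Complex.ofReal_cpow (locQ_nonneg y), ← mul_assoc, ← Complex.ofReal_mul,
    ← wt_mul_locQ_rpow]
  push_cast
  ring

lemma expAt_add_single (m : A → ℕ) (t : ℝ) (k : A) :
    expAt d σ (m + Pi.single k 1) t = expAt d σ m t + Pi.single k 1 := by
  funext j
  by_cases h : j = k
  · subst h; simp [expAt]; ring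
  · simp [expAt, h]

lemma contDiff_norm_rpow_comp (hg : ContDiff ℝ ∞ g) {t : ℝ} (ht : 1 < t) :
    ContDiff ℝ 1 fun y => ‖g y‖ ^ t :=
  (contDiff_norm_rpow ht).comp (hg.of_le (by exact_mod_cast le_top))

lemma dirD_norm_rpow (hg : ContDiff ℝ ∞ g) {t : ℝ} (ht : 1 < t) (y r : Fin n → ℝ) :
    dirD r (fun y => ‖g y‖ ^ t) y =
      (t * ‖g y‖ ^ (t - 2)) * ∑ q, g y q * dirD r (fun y => g y q) y := by
  have hd : Differentiable ℝ g := hg.differentiable (by simp)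
  rw [dirD, hd.fderiv_norm_rpow ht]
  simp only [smul_apply, ContinuousLinearMap.comp_apply, innerSL_apply_apply, smul_eq_mul]
  congr 1
  rw [PiLp.inner_apply]
  refine Finset.sum_congr rfl fun q _ => ?_
  have h1 : HasFDerivAt (fun y => g y q)
      ((EuclideanSpace.proj q : EuclideanSpace ℝ (Fin l) →L[ℝ] ℝ).comp (fderiv ℝ g y)) y :=
    (EuclideanSpace.proj q : EuclideanSpace ℝ (Fin l) →L[ℝ] ℝ).hasFDerivAt.comp y
      (hd y).hasFDerivAt
  rw [dirD, h1.fderiv]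
  simp [mul_comm]

lemma expAt_pos {d σ : Fin n → ℕ} (hd : ∀ k ∈ A, 0 < d k) (hσ : ∀ k ∈ A, 0 < σ k) (m : A → ℕ)
    {t : ℝ} (ht : 0 < t) (k : A) : 0 < expAt d σ m t k := by
  have h1 : (1 : ℝ) ≤ σ k := by exact_mod_cast hσ k k.2
  have h2 : (0 : ℝ) < d k := by exact_mod_cast hd k k.2
  have h3 := mul_pos h2 ht
  have h4 : (0 : ℝ) ≤ m k := Nat.cast_nonneg _
  rw [expAt]
  linarith

lemma aestronglyMeasurable_wt_mul {p : A → ℝ} {ψ : (Fin n → ℝ) → ℂ} (hψ : Continuous ψ) :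
    AEStronglyMeasurable (fun y => (wt A B p y : ℂ) * ψ y) := by
  refine AEStronglyMeasurable.mul ?_ hψ.aestronglyMeasurable
  exact (Complex.measurable_ofReal.comp measurable_wt).aestronglyMeasurable

/-- The slopes `d_k` of the Gamma factors, together with the slope `1` of `Γ(s + l)`. -/
def slopeOpt (A : Finset (Fin n)) (d : Fin n → ℕ) : Option A → ℝ := fun i => i.elim 1 fun k => d k

/-- The offsets `σ_k` of the Gamma factors, together with the offset `l` of `Γ(s + l)`. -/
def offsetOpt (A : Finset (Fin n)) (l : ℕ) (σ : Fin n → ℕ) : Option A → ℝ :=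
  fun i => i.elim l fun k => σ k

/-- A local zeta function near a point where `g` vanishes and is a submersion transversally to
the weighted coordinates. -/
theorem exists_entire_locZeta_of_frame (D : TransverseFrame A B W g) (hW : IsOpen W)
    (hAB : Disjoint A B) (hl : 0 < l) (hd : ∀ k ∈ A, 0 < d k) (hσ : ∀ k ∈ A, 0 < σ k)
    {ψ : (Fin n → ℝ) → ℂ} (hψ : IsTest W ψ) :
    (∀ s ∈ shiftPlane (slopeOpt A d) (offsetOpt A l σ) 0,
        Integrable (locIntegrand A B d σ g 0 ψ s)) ∧
      ∃ E : ℂ → ℂ, Differentiable ℂ E ∧ ∀ s ∈ shiftPlane (slopeOpt A d) (offsetOpt A l σ) 0,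
        locZeta A B d σ g 0 ψ s = E s * gammaProd (slopeOpt A d) (offsetOpt A l σ) 0 s := by
  classical
  have hl' : (1 : ℝ) ≤ l := by exact_mod_cast hl
  have hhol : ∀ (m : Option A → ℕ) (ψ : (Fin n → ℝ) → ℂ),
      TransverseFrame.Vanishing W g (m none) ψ →
      (∀ s ∈ shiftPlane (slopeOpt A d) (offsetOpt A l σ) m,
        Integrable (locIntegrand A B d σ g (fun k => m (some k)) ψ s)) ∧
      DifferentiableOn ℂ (locZeta A B d σ g (fun k => m (some k)) ψ)
        (shiftPlane (slopeOpt A d) (offsetOpt A l σ) m) := by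
    intro m ψ hψ
    obtain ⟨χ, hχ, hχ0, hle⟩ := hψ.exists_norm_le hW
    have hT : IsOpen {t : ℝ | ∀ i, 0 < slopeOpt A d i * t + offsetOpt A l σ i + m i} := by
      simp only [ofPred_forall]
      exact isOpen_iInter_of_finite fun i => isOpen_lt continuous_const (by fun_prop)
    have hp0 : ∀ k : A, -1 < shiftExp σ (fun k => m (some k)) k := fun k => by
      have h1 : (1 : ℝ) ≤ σ k := by exact_mod_cast hσ k k.2
      have h4 : (0 : ℝ) ≤ m (some k) := Nat.cast_nonneg _
      rw [shiftExp]
      linarith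
    -- a negative power `|g|^(-1/2)` is integrable because `-1/2 > -l`; hence `g ≠ 0` almost
    -- everywhere
    have hne := (D.integrable_norm_rpow hW hp0 (t := -1 / 2) (by linarith) hχ hχ0).2 (by norm_num)
    have hpos : ∀ᵐ y, (wt A B (shiftExp σ fun k => m (some k)) y : ℂ) * ψ y ≠ 0 →
        0 < locQ A d g y := by
      filter_upwards [hne] with y hy h
      have h1 : wt A B (shiftExp σ fun k => m (some k)) y ≠ 0 := fun h0 => h (by simp [h0])
      have h2 : χ y ≠ 0 := fun h0 => right_ne_zero_of_mul h (by simpa [h0] using hle y)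
      exact locQ_pos h1 (hy (mul_ne_zero h1 h2))
    have hker := integrable_and_differentiableOn_integral_cpow (μ := volume)
      (aestronglyMeasurable_wt_mul (A := A) (B := B) (p := shiftExp σ fun k => m (some k))
        (TransverseFrame.Vanishing.isTest D hψ).contDiff.continuous)
      (measurable_locQ (A := A) (d := d) D.contDiff_g.continuous) hpos hT fun t ht => by
        have hp : ∀ k : A, -1 < expAt d σ (fun k => m (some k)) t k := fun k => by
          have := ht (some k)
          simp only [slopeOpt, offsetOpt, Option.elim] at this
          rw [expAt]
          linarith
        have htl : -(l : ℝ) < t + m none := by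
          have := ht none
          simp only [slopeOpt, offsetOpt, Option.elim] at this
          linarith
        refine (D.integrable_norm_rpow hW hp htl hχ hχ0).1.mono' ?_ ?_
        · refine AEStronglyMeasurable.mul ?_
            ((measurable_locQ D.contDiff_g.continuous).pow_const t).aestronglyMeasurable
          exact (aestronglyMeasurable_wt_mul
            (TransverseFrame.Vanishing.isTest D hψ).contDiff.continuous).norm
        · filter_upwards [hpos] with y hy
          by_cases h : (wt A B (shiftExp σ fun k => m (some k)) y : ℂ) * ψ y = 0
          · rw [h]
            simpa using mul_nonneg (wt_nonneg _) (mul_nonneg (by positivity) (hχ0 y))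
          have hgy : 0 < ‖g y‖ := by
            refine (norm_nonneg _).lt_of_ne fun h0 => (hy h).ne' ?_
            rw [locQ, ← h0, mul_zero]
          rw [norm_mul, norm_norm, norm_mul, Complex.norm_real, Real.norm_of_nonneg (wt_nonneg _),
            Real.norm_of_nonneg (Real.rpow_nonneg (locQ_nonneg y) _), mul_right_comm,
            wt_mul_locQ_rpow, mul_assoc, Real.rpow_add hgy, Real.rpow_natCast, mul_assoc]
          exact mul_le_mul_of_nonneg_left (mul_le_mul_of_nonneg_left (hle y) (by positivity))
            (wt_nonneg _)
    exact hker
  -- at level `m` the exponent of `y_k` is shifted by `m (some k)`, and the test function vanishes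
  -- to order `m none` along `g = 0`
  set 𝒞 : (Option A → ℕ) → Set (ℂ → ℂ) := fun m => {F | ∃ ψ : (Fin n → ℝ) → ℂ,
    TransverseFrame.Vanishing W g (m none) ψ ∧
      F = locZeta A B d σ g (fun k => m (some k)) ψ} with h𝒞
  have hzero : ∀ m, ∃ F ∈ 𝒞 m, ∀ s, F s = 0 := fun m =>
    ⟨_, ⟨fun _ => 0, TransverseFrame.Vanishing.zero _, rfl⟩, fun s => by
      simp [locZeta, locIntegrand]⟩
  have hψ0 : locZeta A B d σ g 0 ψ ∈ 𝒞 0 := ⟨ψ, hψ, rfl⟩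
  refine ⟨(hhol 0 ψ hψ).1, exists_entire_mul_gammaProd (𝒞 := 𝒞) ?_ ?_ ?_ ?_ hψ0⟩
  · rintro (_ | k)
    · simp [slopeOpt]
    · simpa [slopeOpt] using hd k k.2
  · rintro (_ | k)
    · simpa [offsetOpt] using hl
    · simpa [offsetOpt] using hσ k k.2
  · rintro m _ ⟨ψ, hψ, rfl⟩
    exact (hhol m ψ hψ).2
  · rintro m _ ⟨ψ, hψ, rfl⟩ i
    obtain ⟨F₂, hF₂, hF₂0⟩ := hzero (m + Pi.single i 1)
    have ht : IsTest W ψ := TransverseFrame.Vanishing.isTest D hψ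
    -- the functional equations are checked for real `x > 2`, where `|g|^x` is continuously
    -- differentiable
    rcases i with _ | k
    · have hm1 : (m + Pi.single none 1 : Option A → ℕ) none = m none + 1 := by simp
      refine ⟨_, ⟨_, hm1 ▸ TransverseFrame.Vanishing.euler D hψ, rfl⟩, F₂, hF₂, 2,
        fun x hx => ?_⟩
      have hm : (fun k : A => (m + Pi.single none 1 : Option A → ℕ) (some k)) =
          fun k => m (some k) := by
        funext k; simp
      rw [hF₂0, mul_zero, add_zero, hm, locZeta_ofReal, locZeta_ofReal]
      have hp : ∀ k, -1 < expAt d σ (fun k => m (some k)) x k := fun k =>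
        (by norm_num : (-1 : ℝ) < 0).trans (expAt_pos hd hσ _ (by linarith) k)
      have hG := contDiff_norm_rpow_comp D.contDiff_g (t := x) (by linarith)
      have hI := D.integral_adj hp D.contDiff_comp ht hG
        fun y r => dirD_norm_rpow D.contDiff_g (by linarith) y r
      have h1 := integrable_wt_smul_test (B := B) hp hG.continuous
        (ht.const_smul ((l : ℝ) + m none))
      have h2 := integrable_wt_smul_test (B := B) hp hG.continuous
        (D.isTest_adj (F := ℂ) D.contDiff_comp ht)
      simp only [smul_add]
      rw [integral_add h1 h2, hI]
      have h3 : ∀ y, (x * ‖g y‖ ^ (x - 2) * ∑ q, g y q * g y q) • ψ y = x • ‖g y‖ ^ x • ψ y :=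
        fun y => by
          rw [smul_smul, ← norm_sq_eq_sum, mul_assoc, ← Real.rpow_natCast,
            ← Real.rpow_add' (norm_nonneg _) (by push_cast; linarith)]
          congr 3
          push_cast; ring
      simp only [h3, smul_comm _ x, smul_comm _ ((l : ℝ) + m none)]
      rw [integral_smul, integral_smul, ← add_smul, ← Complex.real_smul]
      congr 1
      simp only [slopeOpt, offsetOpt, Option.elim]
      ring
    · refine ⟨_, ⟨_, by simpa using TransverseFrame.Vanishing.edgeAdj D k hψ, rfl⟩, F₂, hF₂, 2,
        fun x hx => ?_⟩
      have hm : (fun j : A => (m + Pi.single (some k) 1 : Option A → ℕ) (some j)) =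
          (fun j => m (some j)) + Pi.single k 1 := by
        funext j
        by_cases h : j = k
        · subst h; simp
        · simp [h]
      have hpp : ∀ k, 0 < expAt d σ (fun k => m (some k)) x k := expAt_pos hd hσ _ (by linarith)
      rw [hF₂0, mul_zero, add_zero, hm, locZeta_ofReal, locZeta_ofReal, expAt_add_single,
        ← D.integral_edgeAdj hAB (fun k => (by norm_num : (-1 : ℝ) < 0).trans (hpp k)) k (hpp k) ht
        (contDiff_norm_rpow_comp D.contDiff_g (by linarith))
        fun y r => dirD_norm_rpow D.contDiff_g (by linarith) y r, ← Complex.real_smul]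
      congr 1
      simp only [slopeOpt, offsetOpt, Option.elim, expAt]
      ring

lemma norm_rpow_sub_two {y : Fin n → ℝ} {c : ℝ} (h : c * ‖g y‖ ^ 2 = 1) (x : ℝ) :
    ‖g y‖ ^ (x - 2) = ‖g y‖ ^ x * c := by
  have hgy : 0 < ‖g y‖ := (norm_nonneg _).lt_of_ne fun h0 => by
    simp [← h0] at h
  rw [Real.rpow_sub hgy, div_eq_iff (by positivity), mul_assoc, Real.rpow_two, h, mul_one]

lemma dirD_norm_rpow_smul (hg : ContDiff ℝ ∞ g) {ν : (Fin n → ℝ) → ℝ}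
    (hνg : ∀ y ∈ W, ν y * ‖g y‖ ^ 2 = 1) {x : ℝ} (hx : 1 < x) {ψ : (Fin n → ℝ) → ℂ}
    (hψ : IsTest W ψ) (y e : Fin n → ℝ) :
    dirD e (fun y => ‖g y‖ ^ x • ψ y) y = ‖g y‖ ^ x • dirD e ψ y +
      x • (‖g y‖ ^ x • ((ν y * ∑ q, g y q * dirD e (fun y => g y q) y) • ψ y)) := by
  have hG := contDiff_norm_rpow_comp hg hx
  rw [dirD_smul ((hG.differentiable (by simp)) y) hψ.differentiableAt e,
    dirD_norm_rpow hg hx]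
  by_cases hy : y ∈ W
  · rw [norm_rpow_sub_two (hνg y hy)]
    simp only [smul_smul]
    ring_nf
  · simp [hψ.eq_zero hy]

/-- Integration by parts in an edge variable where `g` does not vanish and `ν = |g|⁻²`. -/
lemma integral_wt_smul_norm_rpow_of_ne_zero (hg : ContDiff ℝ ∞ g) {ν : (Fin n → ℝ) → ℝ}
    (hνg : ∀ y ∈ W, ν y * ‖g y‖ ^ 2 = 1) (hAB : Disjoint A B) {p : A → ℝ} (k : A)
    (hp : ∀ j, -1 < p j) (hk : 0 < p k) {x : ℝ} (hx : 1 < x)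
    {ψ ψ₁ ψ₂ : (Fin n → ℝ) → ℂ} (hψ : IsTest W ψ) (hψ₁ : IsTest W ψ₁) (hψ₂ : IsTest W ψ₂)
    (h₁ : ∀ y, ψ₁ y = -dirD (Pi.single (k : Fin n) 1) ψ y)
    (h₂ : ∀ y, ψ₂ y = -((ν y * ∑ q, g y q * dirD (Pi.single (k : Fin n) 1)
      (fun y => g y q) y) • ψ y)) :
    (p k + 1) • ∫ y, wt A B p y • (‖g y‖ ^ x • ψ y) =
      (∫ y, wt A B (p + Pi.single k 1) y • (‖g y‖ ^ x • ψ₁ y)) +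
        x • ∫ y, wt A B (p + Pi.single k 1) y • (‖g y‖ ^ x • ψ₂ y) := by
  set e : Fin n → ℝ := Pi.single (k : Fin n) 1 with he
  have hp' : ∀ j, -1 < (p + Pi.single k 1 : A → ℝ) j := fun j => by
    have := hp j
    have h0 : 0 ≤ (Pi.single k 1 : A → ℝ) j := by
      by_cases h : j = k
      · subst h; simp
      · simp [h]
    simp only [Pi.add_apply]
    linarith
  have hG := contDiff_norm_rpow_comp hg hx
  have hu : ContDiff ℝ 1 fun y => ‖g y‖ ^ x • ψ y :=
    hG.smul (hψ.contDiff.of_le (by exact_mod_cast le_top))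
  have hc : HasCompactSupport fun y => ‖g y‖ ^ x • ψ y :=
    hψ.hasCompactSupport.mono fun y hy h => hy (by simp [h])
  have hi1 := integrable_wt_smul_test (B := B) hp' hG.continuous hψ₁
  have hi2 := (integrable_wt_smul_test (B := B) hp' hG.continuous hψ₂).fun_smul x
  have hpt : ∀ y, -(wt A B (p + Pi.single k 1) y • fderiv ℝ (fun y => ‖g y‖ ^ x • ψ y) y e) =
      wt A B (p + Pi.single k 1) y • (‖g y‖ ^ x • ψ₁ y) +
        x • (wt A B (p + Pi.single k 1) y • (‖g y‖ ^ x • ψ₂ y)) := fun y => by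
    have h4 := dirD_norm_rpow_smul hg hνg hx hψ y e
    rw [dirD] at h4
    rw [h4, h₁, h₂, smul_add, neg_add, smul_neg, smul_neg, smul_neg, smul_neg, smul_neg]
    congr 2
    simp only [smul_comm x]
  rw [integral_wt_smul_fderiv_single hp hAB k hk hu hc, ← integral_neg, ← integral_smul,
    ← integral_add hi1 hi2]
  exact integral_congr_ae (Eventually.of_forall hpt)

/-- A local zeta function near a point where `g` does not vanish. The function `ν` is `|g|⁻²`. -/
theorem exists_entire_locZeta_of_ne_zero (hg : ContDiff ℝ ∞ g)
    {ν : (Fin n → ℝ) → ℝ} (hν : ContDiff ℝ ∞ ν) (hνg : ∀ y ∈ W, ν y * ‖g y‖ ^ 2 = 1)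
    (hAB : Disjoint A B) (hd : ∀ k ∈ A, 0 < d k) (hσ : ∀ k ∈ A, 0 < σ k)
    {ψ : (Fin n → ℝ) → ℂ} (hψ : IsTest W ψ) :
    (∀ s ∈ shiftPlane (fun k : A => (d k : ℝ)) (fun k => (σ k : ℝ)) 0,
        Integrable (locIntegrand A B d σ g 0 ψ s)) ∧
      ∃ E : ℂ → ℂ, Differentiable ℂ E ∧
        ∀ s ∈ shiftPlane (fun k : A => (d k : ℝ)) (fun k => (σ k : ℝ)) 0,
          locZeta A B d σ g 0 ψ s =
            E s * gammaProd (fun k : A => (d k : ℝ)) (fun k => (σ k : ℝ)) 0 s := by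
  classical
  have hg0 : ∀ y ∈ W, g y ≠ 0 := fun y hy h => by
    have := hνg y hy
    simp [h] at this
  have hhol : ∀ (m : A → ℕ) (ψ : (Fin n → ℝ) → ℂ), IsTest W ψ →
      (∀ s ∈ shiftPlane (fun k : A => (d k : ℝ)) (fun k => (σ k : ℝ)) m,
        Integrable (locIntegrand A B d σ g m ψ s)) ∧
      DifferentiableOn ℂ (locZeta A B d σ g m ψ)
        (shiftPlane (fun k : A => (d k : ℝ)) (fun k => (σ k : ℝ)) m) := by
    intro m ψ hψ
    have hT : IsOpen {t : ℝ | ∀ k : A, 0 < (d k : ℝ) * t + σ k + m k} := by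
      simp only [ofPred_forall]
      exact isOpen_iInter_of_finite fun i => isOpen_lt continuous_const (by fun_prop)
    have hpos : ∀ᵐ y, (wt A B (shiftExp σ m) y : ℂ) * ψ y ≠ 0 → 0 < locQ A d g y := by
      refine Eventually.of_forall fun y h => ?_
      have h1 : wt A B (shiftExp σ m) y ≠ 0 := fun h0 => h (by simp [h0])
      refine locQ_pos h1 (hg0 y ?_)
      by_contra hy
      exact right_ne_zero_of_mul h (hψ.eq_zero hy)
    exact integrable_and_differentiableOn_integral_cpow (μ := volume)
      (aestronglyMeasurable_wt_mul (A := A) (B := B) (p := shiftExp σ m) hψ.contDiff.continuous)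
      (measurable_locQ (A := A) (d := d) hg.continuous) hpos hT fun t ht => by
        have hp : ∀ k : A, -1 < expAt d σ m t k := fun k => by
          have := ht k
          rw [expAt]
          linarith
        have hc : Continuous fun y => ‖g y‖ ^ t * ‖ψ y‖ := by
          refine continuous_iff_continuousAt.2 fun y => ?_
          by_cases hy : y ∈ W
          · exact (hg.continuous.norm.continuousAt.rpow_const
              (Or.inl (norm_ne_zero_iff.2 (hg0 y hy)))).mul hψ.contDiff.continuous.norm.continuousAt
          · have h0 : ψ =ᶠ[𝓝 y] 0 :=
              notMem_tsupport_iff_eventuallyEq.1 fun h => hy (hψ.tsupport_subset h)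
            refine (continuousAt_const (y := (0 : ℝ))).congr ?_
            filter_upwards [h0] with z hz
            simp [hz]
        have hI := integrable_wt_smul (A := A) (B := B) hp hc hψ.hasCompactSupport.norm.mul_left
        refine hI.congr (Eventually.of_forall fun y => ?_)
        beta_reduce
        rw [norm_mul, Complex.norm_real, Real.norm_of_nonneg (wt_nonneg _), mul_right_comm,
          wt_mul_locQ_rpow, smul_eq_mul, mul_assoc]
  set 𝒞 : (A → ℕ) → Set (ℂ → ℂ) := fun m => {F | ∃ ψ : (Fin n → ℝ) → ℂ,
    IsTest W ψ ∧ F = locZeta A B d σ g m ψ} with h𝒞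
  refine ⟨(hhol 0 ψ hψ).1, exists_entire_mul_gammaProd (𝒞 := 𝒞)
    (fun k => by exact_mod_cast hd k k.2) (fun k => by exact_mod_cast hσ k k.2) ?_ ?_ ⟨ψ, hψ, rfl⟩⟩
  · rintro m _ ⟨ψ, hψ, rfl⟩
    exact (hhol m ψ hψ).2
  · rintro m _ ⟨ψ, hψ, rfl⟩ k
    set e : Fin n → ℝ := Pi.single (k : Fin n) 1 with he
    have hgq : ∀ q, ContDiff ℝ ∞ fun y => g y q := fun q =>
      (EuclideanSpace.proj q : EuclideanSpace ℝ (Fin l) →L[ℝ] ℝ).contDiff.comp hg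
    have hη : ContDiff ℝ ∞ fun y => ν y * ∑ q, g y q * dirD e (fun y => g y q) y :=
      hν.mul (ContDiff.sum fun q _ => (hgq q).mul (contDiff_dirD (hgq q) e))
    have ht1 := (hψ.dirD e).neg
    have ht2 := (hψ.smul hη).neg
    refine ⟨_, ⟨_, ht1, rfl⟩, _, ⟨_, ht2, rfl⟩, 2, fun x hx => ?_⟩
    have hpp : ∀ (m : A → ℕ) (k), 0 < expAt d σ m x k := fun m => expAt_pos hd hσ _ (by linarith)
    have hp : ∀ (m : A → ℕ) (k), -1 < expAt d σ m x k := fun m k =>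
      (by norm_num : (-1 : ℝ) < 0).trans (hpp m k)
    rw [locZeta_ofReal, locZeta_ofReal, locZeta_ofReal, ← Complex.real_smul, ← Complex.real_smul,
      expAt_add_single, ← integral_wt_smul_norm_rpow_of_ne_zero hg hνg hAB k (hp m) (hpp m k)
        (by linarith) hψ ht1 ht2 (fun _ => rfl) fun _ => rfl]
    congr 1
    rw [expAt]
    ring

end LocalZeta

/-! ### Faces of the Newton polyhedron -/

section Polyhedron
open Set

lemma toReal_dotProduct_toReal (a m : Fin n → ℕ) :
    toReal a ⬝ᵥ toReal m = ((a ⬝ᵥ m : ℕ) : ℝ) := by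
  simp [dotProduct, toReal]

lemma toReal_dotProduct_mono (a : Fin n → ℕ) {x y : Fin n → ℝ} (h : ∀ j, x j ≤ y j) :
    toReal a ⬝ᵥ x ≤ toReal a ⬝ᵥ y :=
  Finset.sum_le_sum fun j _ => mul_le_mul_of_nonneg_left (h j) (Nat.cast_nonneg _)

variable {f : (Fin n → ℝ) → EuclideanSpace ℝ (Fin l)}

lemma toReal_mem_newtonPolyhedron {m : Fin n → ℕ} (hm : m ∈ taylorSupport f) :
    toReal m ∈ newtonPolyhedron f :=
  subset_convexHull ℝ _ ⟨m, hm, fun _ => le_rfl⟩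

lemma nonneg_of_mem_newtonPolyhedron {x : Fin n → ℝ} (hx : x ∈ newtonPolyhedron f) (j : Fin n) :
    0 ≤ x j := by
  have h : newtonPolyhedron f ⊆ {x | 0 ≤ x j} := by
    refine convexHull_min ?_ (convex_halfSpace_ge (f := fun x : Fin n → ℝ => x j)
      (IsLinearMap.mk (fun _ _ => rfl) fun _ _ => rfl) 0)
    rintro x ⟨m, -, hm⟩
    exact (Nat.cast_nonneg (m j)).trans (hm j)
  exact h hx

lemma dMin_le (a : Fin n → ℕ) {x : Fin n → ℝ} (hx : x ∈ newtonPolyhedron f) :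
    dMin (newtonPolyhedron f) a ≤ toReal a ⬝ᵥ x := by
  refine csInf_le ⟨0, ?_⟩ ⟨x, hx, rfl⟩
  rintro _ ⟨y, hy, rfl⟩
  exact Finset.sum_nonneg fun j _ =>
    mul_nonneg (Nat.cast_nonneg _) (nonneg_of_mem_newtonPolyhedron hy j)

/-- The exponents of the Taylor series of `f` on the face `⋂ i ∈ I, F(a_i)`. -/
def faceSupport (f : (Fin n → ℝ) → EuclideanSpace ℝ (Fin l)) (a : Fin n → Fin n → ℕ)
    (I : Finset (Fin n)) : Set (Fin n → ℕ) :=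
  {m ∈ taylorSupport f | ∀ i ∈ I, toReal (a i) ⬝ᵥ toReal m = dMin (newtonPolyhedron f) (a i)}

variable {a : Fin n → Fin n → ℕ} {I : Finset (Fin n)}

lemma toReal_mem_iInter_iff {m : Fin n → ℕ} (hm : m ∈ taylorSupport f) :
    toReal m ∈ ⋂ i ∈ I, firstMeetLocus (newtonPolyhedron f) (a i) ↔ m ∈ faceSupport f a I := by
  simp only [mem_iInter, firstMeetLocus, mem_ofPred_eq, faceSupport, hm, true_and,
    toReal_mem_newtonPolyhedron hm]

/-- If the vectors `a_i`, `i ∈ I`, involve every coordinate, then the face `⋂ i ∈ I, F(a_i)` has no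
recession directions and is spanned by exponents. -/
lemma iInter_firstMeetLocus_subset (hI : ∀ j, ∃ i ∈ I, a i j ≠ 0) :
    (⋂ i ∈ I, firstMeetLocus (newtonPolyhedron f) (a i)) ∩ newtonPolyhedron f ⊆
      convexHull ℝ (toReal '' faceSupport f a I) := by
  rintro x ⟨hx, hxΓ⟩
  have hx' : ∀ i ∈ I, toReal (a i) ⬝ᵥ x = dMin (newtonPolyhedron f) (a i) := fun i hi =>
    (mem_iInter₂.1 hx i hi).2
  obtain ⟨ι, _, w, z, hw, hw1, hz, rfl⟩ := mem_convexHull_iff_exists_fintype.1 hxΓ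
  choose m hm hmz using hz
  have hzΓ : ∀ k, z k ∈ newtonPolyhedron f := fun k => subset_convexHull ℝ _ ⟨m k, hm k, hmz k⟩
  have hz1 : ∀ k, w k ≠ 0 → ∀ i ∈ I, toReal (a i) ⬝ᵥ z k = dMin (newtonPolyhedron f) (a i) := by
    intro k hk i hi
    have h0 : ∑ k, w k * (toReal (a i) ⬝ᵥ z k - dMin (newtonPolyhedron f) (a i)) = 0 := by
      simp only [mul_sub, Finset.sum_sub_distrib, ← Finset.sum_mul, hw1, one_mul]
      rw [← hx' i hi, dotProduct_sum, sub_eq_zero]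
      exact Finset.sum_congr rfl fun k _ => by rw [dotProduct_smul, smul_eq_mul]
    have h1 := (Finset.sum_eq_zero_iff_of_nonneg fun k _ =>
      mul_nonneg (hw k) (sub_nonneg.2 (dMin_le (a i) (hzΓ k)))).1 h0 k (Finset.mem_univ k)
    exact sub_eq_zero.1 ((mul_eq_zero.1 h1).resolve_left hk)
  have hz2 : ∀ k, w k ≠ 0 → ∀ i ∈ I, toReal (a i) ⬝ᵥ toReal (m k) = toReal (a i) ⬝ᵥ z k :=
    fun k hk i hi => le_antisymm (toReal_dotProduct_mono _ (hmz k))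
      ((hz1 k hk i hi).trans_le (dMin_le _ (toReal_mem_newtonPolyhedron (hm k))))
  have hz3 : ∀ k, w k ≠ 0 → z k = toReal (m k) := by
    intro k hk
    funext j
    obtain ⟨i, hi, hij⟩ := hI j
    have h0 : ∑ j, toReal (a i) j * (z k j - toReal (m k) j) = 0 := by
      simp only [mul_sub, Finset.sum_sub_distrib, sub_eq_zero]
      exact (hz2 k hk i hi).symm
    have h1 := (Finset.sum_eq_zero_iff_of_nonneg fun j _ =>
      mul_nonneg (Nat.cast_nonneg _) (sub_nonneg.2 (hmz k j))).1 h0 j (Finset.mem_univ j)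
    exact sub_eq_zero.1 ((mul_eq_zero.1 h1).resolve_left (Nat.cast_ne_zero.2 hij))
  classical
  have h4 : ∑ k, w k • z k = ∑ k with w k ≠ 0, w k • toReal (m k) := by
    rw [Finset.sum_filter]
    refine Finset.sum_congr rfl fun k _ => ?_
    split_ifs with hk
    · rw [hz3 k hk]
    · rw [not_not.1 hk, zero_smul]
  rw [h4]
  refine (convex_convexHull ℝ _).sum_mem (fun k _ => hw k) ?_ fun k hk => ?_
  · rw [Finset.sum_filter_ne_zero, hw1]
  · have hk' := (Finset.mem_filter.1 hk).2
    refine subset_convexHull ℝ _ ⟨m k, ⟨hm k, fun i hi => ?_⟩, rfl⟩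
    rw [hz2 k hk' i hi, hz1 k hk' i hi]

/-- A vertex of the Newton polyhedron at which all the linear forms `a_i` attain their minimum is an
exponent `m₀` of the Taylor series, so that `d(a_i) = ⟨a_i, m₀⟩`. -/
lemma exists_exponent_of_vertex (hcol : ∀ j, ∃ i, a i j ≠ 0)
    (hτ : ∃ v ∈ newtonPolyhedron f,
      (⋂ i, firstMeetLocus (newtonPolyhedron f) (a i)) = {v}) :
    ∃ m₀ ∈ taylorSupport f, ∀ i, dMin (newtonPolyhedron f) (a i) = ((a i ⬝ᵥ m₀ : ℕ) : ℝ) := by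
  obtain ⟨v, hvΓ, hv⟩ := hτ
  have h1 : v ∈ ⋂ i ∈ Finset.univ, firstMeetLocus (newtonPolyhedron f) (a i) := by
    simp [hv]
  have h2 := iInter_firstMeetLocus_subset (I := Finset.univ) (by simpa using hcol) ⟨h1, hvΓ⟩
  obtain ⟨_, m, hm, rfl⟩ := convexHull_nonempty_iff.1 ⟨v, h2⟩
  refine ⟨m, hm.1, fun i => ?_⟩
  rw [← toReal_dotProduct_toReal, hm.2 i (Finset.mem_univ i)]

variable {m₀ : Fin n → ℕ}

lemma dotProduct_le_of_mem_taylorSupport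
    (hd : ∀ i, dMin (newtonPolyhedron f) (a i) = ((a i ⬝ᵥ m₀ : ℕ) : ℝ)) {m : Fin n → ℕ}
    (hm : m ∈ taylorSupport f) (i : Fin n) : a i ⬝ᵥ m₀ ≤ a i ⬝ᵥ m := by
  have := dMin_le (a i) (toReal_mem_newtonPolyhedron hm)
  rw [hd, toReal_dotProduct_toReal] at this
  exact_mod_cast this

lemma mem_faceSupport_iff (hd : ∀ i, dMin (newtonPolyhedron f) (a i) = ((a i ⬝ᵥ m₀ : ℕ) : ℝ))
    {m : Fin n → ℕ} :
    m ∈ faceSupport f a I ↔ m ∈ taylorSupport f ∧ ∀ i ∈ I, a i ⬝ᵥ m = a i ⬝ᵥ m₀ := by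
  simp only [faceSupport, mem_ofPred_eq, hd, toReal_dotProduct_toReal, Nat.cast_inj]

lemma finite_faceSupport (hd : ∀ i, dMin (newtonPolyhedron f) (a i) = ((a i ⬝ᵥ m₀ : ℕ) : ℝ))
    (hI : ∀ j, ∃ i ∈ I, a i j ≠ 0) : (faceSupport f a I).Finite := by
  refine (Set.finite_Iic (fun _ : Fin n => ∑ i ∈ I, a i ⬝ᵥ m₀)).subset fun m hm => ?_
  intro j
  obtain ⟨i, hi, hij⟩ := hI j
  calc m j ≤ a i j * m j := Nat.le_mul_of_pos_left _ (Nat.pos_of_ne_zero hij)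
    _ ≤ a i ⬝ᵥ m := Finset.single_le_sum (f := fun j => a i j * m j) (fun _ _ => Nat.zero_le _)
        (Finset.mem_univ j)
    _ = a i ⬝ᵥ m₀ := ((mem_faceSupport_iff hd).1 hm).2 i hi
    _ ≤ ∑ i ∈ I, a i ⬝ᵥ m₀ := Finset.single_le_sum (f := fun i => a i ⬝ᵥ m₀)
        (fun _ _ => Nat.zero_le _) hi

lemma nonempty_iInter_firstMeetLocus (hm₀ : m₀ ∈ taylorSupport f)
    (hd : ∀ i, dMin (newtonPolyhedron f) (a i) = ((a i ⬝ᵥ m₀ : ℕ) : ℝ)) :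
    (⋂ i ∈ I, firstMeetLocus (newtonPolyhedron f) (a i)).Nonempty :=
  ⟨toReal m₀, (toReal_mem_iInter_iff hm₀).2 ((mem_faceSupport_iff hd).2 ⟨hm₀, fun _ _ => rfl⟩)⟩

lemma iInter_firstMeetLocus_eq_convexHull (hIne : I.Nonempty) (hI : ∀ j, ∃ i ∈ I, a i j ≠ 0) :
    (⋂ i ∈ I, firstMeetLocus (newtonPolyhedron f) (a i)) =
      convexHull ℝ (toReal '' faceSupport f a I) := by
  refine Subset.antisymm (fun x hx => iInter_firstMeetLocus_subset hI ⟨hx, ?_⟩)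
    (convexHull_min ?_ (convex_iInter₂ fun i _ => ?_))
  · obtain ⟨i, hi⟩ := hIne
    exact (mem_iInter₂.1 hx i hi).1
  · rintro _ ⟨m, hm, rfl⟩
    exact (toReal_mem_iInter_iff hm.1).2 hm
  · exact (convex_convexHull ℝ _).inter (convex_hyperplane
      (IsLinearMap.mk (fun x y => dotProduct_add _ x y) fun c x => dotProduct_smul c _ x) _)

lemma isCompact_iInter_firstMeetLocus
    (hd : ∀ i, dMin (newtonPolyhedron f) (a i) = ((a i ⬝ᵥ m₀ : ℕ) : ℝ))
    (hIne : I.Nonempty) (hI : ∀ j, ∃ i ∈ I, a i j ≠ 0) :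
    IsCompact (⋂ i ∈ I, firstMeetLocus (newtonPolyhedron f) (a i)) := by
  rw [iInter_firstMeetLocus_eq_convexHull hIne hI]
  exact ((finite_faceSupport hd hI).image _).isCompact_convexHull (𝕜 := ℝ)

/-- A nonempty intersection of first meet loci is the face where `∑ i ∈ I, a_i` is minimal. -/
lemma isExposed_iInter_firstMeetLocus (hm₀ : m₀ ∈ taylorSupport f)
    (hd : ∀ i, dMin (newtonPolyhedron f) (a i) = ((a i ⬝ᵥ m₀ : ℕ) : ℝ)) (hIne : I.Nonempty) :
    IsExposed ℝ (newtonPolyhedron f) (⋂ i ∈ I, firstMeetLocus (newtonPolyhedron f) (a i)) := by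
  intro _
  have hlin : ∀ i, ∃ L : (Fin n → ℝ) →L[ℝ] ℝ, ∀ x, L x = toReal (a i) ⬝ᵥ x := fun i =>
    ⟨∑ j, toReal (a i) j • ContinuousLinearMap.proj j, fun x => by simp [dotProduct]⟩
  choose L hL using hlin
  refine ⟨-∑ i ∈ I, L i, ?_⟩
  ext x
  have hmem : x ∈ ⋂ i ∈ I, firstMeetLocus (newtonPolyhedron f) (a i) ↔
      x ∈ newtonPolyhedron f ∧ ∀ i ∈ I, toReal (a i) ⬝ᵥ x = dMin (newtonPolyhedron f) (a i) := by
    simp only [mem_iInter, firstMeetLocus, mem_ofPred_eq]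
    refine ⟨fun h => ⟨?_, fun i hi => (h i hi).2⟩, fun h i hi => ⟨h.1, h.2 i hi⟩⟩
    obtain ⟨i, hi⟩ := hIne
    exact (h i hi).1
  have hneg : ∀ y, (-∑ i ∈ I, L i) y = -∑ i ∈ I, toReal (a i) ⬝ᵥ y := fun y => by
    simp [hL]
  rw [hmem, mem_ofPred_eq]
  refine and_congr_right fun hx => ⟨fun h y hy => ?_, fun h => ?_⟩
  · rw [hneg, hneg, neg_le_neg_iff]
    exact Finset.sum_le_sum fun i hi => (h i hi).trans_le (dMin_le _ hy)
  · have h1 := h _ (toReal_mem_newtonPolyhedron hm₀)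
    rw [hneg, hneg, neg_le_neg_iff] at h1
    simp only [toReal_dotProduct_toReal, ← hd] at h1
    have h2 := (Finset.sum_eq_sum_iff_of_le fun i (_ : i ∈ I) => dMin_le (a i) hx).1
      (le_antisymm (Finset.sum_le_sum fun i _ => dMin_le (a i) hx) h1)
    exact fun i hi => (h2 i hi).symm

/-- The vector of the coefficients of `x ^ m` in the Taylor series of the components of `f`. -/
def taylorVec (f : (Fin n → ℝ) → EuclideanSpace ℝ (Fin l)) (m : Fin n → ℕ) :
    EuclideanSpace ℝ (Fin l) :=
  WithLp.toLp 2 fun i => taylorCoeff (fun x => f x i) m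

lemma taylorVec_eq_zero {m : Fin n → ℕ} (hm : m ∉ taylorSupport f) : taylorVec f m = 0 := by
  ext i
  by_contra h
  exact hm ⟨i, h⟩

/-- The face part as a finite sum. -/
lemma facePart_eq_sum (hfin : (faceSupport f a I).Finite) (x : Fin n → ℝ) :
    facePart f (⋂ i ∈ I, firstMeetLocus (newtonPolyhedron f) (a i)) x =
      ∑ m ∈ hfin.toFinset, mono m x • taylorVec f m := by
  classical
  ext i
  rw [facePart]
  simp only [WithLp.ofLp_sum, Finset.sum_apply, WithLp.ofLp_smul, Pi.smul_apply, smul_eq_mul]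
  rw [tsum_eq_sum (s := hfin.toFinset)]
  · refine Finset.sum_congr rfl fun m hm => ?_
    have hm' := hfin.mem_toFinset.1 hm
    rw [if_pos ((toReal_mem_iInter_iff hm'.1).2 hm'), mul_comm]
    rfl
  · intro m hm
    split_ifs with h
    · by_contra h0
      have hmG : m ∈ taylorSupport f := ⟨i, left_ne_zero_of_mul h0⟩
      exact hm (hfin.mem_toFinset.2 ((toReal_mem_iInter_iff hmG).1 h))
    · rfl

end Polyhedron

/-! ### The map in monomial coordinates -/

section LocalForm
open Set Filter

/-- The monomial map `y ↦ (∏ i, y_i ^ a_{i,j})_j`. -/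
def monoMap (a : Fin n → Fin n → ℕ) (y : Fin n → ℝ) : Fin n → ℝ := fun j => mono (fun i => a i j) y

lemma continuous_mono (e : Fin n → ℕ) : Continuous (mono e) := by
  unfold mono; fun_prop

lemma contDiff_mono (e : Fin n → ℕ) : ContDiff ℝ ∞ (mono e) := by
  unfold mono; fun_prop

lemma continuous_monoMap (a : Fin n → Fin n → ℕ) : Continuous (monoMap a) :=
  continuous_pi fun _ => continuous_mono _

lemma contDiff_monoMap (a : Fin n → Fin n → ℕ) : ContDiff ℝ ∞ (monoMap a) :=
  contDiff_pi.2 fun _ => contDiff_mono _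

lemma mono_monoMap (a : Fin n → Fin n → ℕ) (m : Fin n → ℕ) (y : Fin n → ℝ) :
    mono m (monoMap a y) = mono (fun i => a i ⬝ᵥ m) y := by
  simp only [mono, monoMap, ← Finset.prod_pow, ← pow_mul]
  rw [Finset.prod_comm]
  refine Finset.prod_congr rfl fun i _ => ?_
  rw [Finset.prod_pow_eq_pow_sum]
  rfl

lemma mono_pos {e : Fin n → ℕ} {y : Fin n → ℝ} (h : ∀ i, 0 < y i) : 0 < mono e y :=
  Finset.prod_pos fun i _ => pow_pos (h i) _

lemma log_mono {e : Fin n → ℕ} {y : Fin n → ℝ} (h : ∀ i, 0 < y i) :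
    Real.log (mono e y) = ∑ i, (e i : ℝ) * Real.log (y i) := by
  rw [mono, Real.log_prod fun i _ => (pow_pos (h i) _).ne']
  exact Finset.sum_congr rfl fun i _ => Real.log_pow _ _

lemma mono_le_one {e : Fin n → ℕ} {y : Fin n → ℝ} (h0 : ∀ i, 0 ≤ y i) (h1 : ∀ i, y i ≤ 1) :
    mono e y ≤ 1 :=
  Finset.prod_le_one (fun i _ => pow_nonneg (h0 i) _) fun i _ => pow_le_one₀ (h0 i) (h1 i)

lemma mono_le_mono {e : Fin n → ℕ} {y z : Fin n → ℝ} (h0 : ∀ i, 0 ≤ y i) (h : ∀ i, y i ≤ z i) :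
    mono e y ≤ mono e z :=
  Finset.prod_le_prod (fun i _ => pow_nonneg (h0 i) _) fun i _ => pow_le_pow_left₀ (h0 i) (h i) _

lemma natCast_mul_mono_lower (e : Fin n → ℕ) (i : Fin n) (y : Fin n → ℝ) :
    (e i : ℝ) * mono (lower e i) y * y i = e i * mono e y := by
  rcases Nat.eq_zero_or_pos (e i) with h | h
  · simp [h]
  · rw [mono_lower, mono, ← Finset.mul_prod_erase _ _ (Finset.mem_univ i)]
    have h1 : y i ^ (e i) = y i ^ (e i - 1) * y i := by
      rw [← pow_succ, Nat.sub_add_cancel h]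
    rw [h1]
    ring

variable {f : (Fin n → ℝ) → EuclideanSpace ℝ (Fin l)}

lemma norm_le_sum_abs (x : EuclideanSpace ℝ (Fin l)) : ‖x‖ ≤ ∑ q, |x q| := by
  refine abs_le_of_sq_le_sq' ?_ (Finset.sum_nonneg fun _ _ => abs_nonneg _) |>.2
  rw [EuclideanSpace.real_norm_sq_eq]
  calc ∑ q, x q ^ 2 = ∑ q, |x q| ^ 2 := by simp
    _ ≤ (∑ q, |x q|) ^ 2 := Finset.sum_sq_le_sq_sum_of_nonneg fun _ _ => abs_nonneg _

/-- The Taylor expansion at the origin of an analytic mapping. -/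
lemma exists_hasSum_taylorVec (hf : AnalyticAt ℝ f 0) :
    ∃ r : ℝ, 0 < r ∧ Summable (fun m => ‖taylorVec f m‖ * mono m fun _ => r) ∧
      ∀ x : Fin n → ℝ, (∀ j, |x j| ≤ r) → HasSum (fun m => mono m x • taylorVec f m) (f x) := by
  have hq : ∀ q, AnalyticAt ℝ (fun x => f x q) 0 := fun q =>
    ((EuclideanSpace.proj q : EuclideanSpace ℝ (Fin l) →L[ℝ] ℝ).analyticAt _).comp hf
  choose r hr hS hsum using fun q => exists_hasSum_taylorCoeff (hq q)
  obtain ⟨r₀, hr₀, hle⟩ : ∃ r₀ : ℝ, 0 < r₀ ∧ ∀ q, r₀ ≤ r q := by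
    rcases isEmpty_or_nonempty (Fin l) with h | h
    · exact ⟨1, one_pos, fun q => isEmptyElim q⟩
    · obtain ⟨q₀, hq₀⟩ := Finite.exists_min r
      exact ⟨r q₀, hr q₀, hq₀⟩
  refine ⟨r₀, hr₀, ?_, fun x hx => ?_⟩
  · refine Summable.of_nonneg_of_le (fun m => mul_nonneg (norm_nonneg _)
      (mono_nonneg fun _ => hr₀.le)) (fun m => ?_)
      (summable_sum fun q (_ : q ∈ Finset.univ) => hS q)
    refine (mul_le_mul_of_nonneg_right (norm_le_sum_abs _) (mono_nonneg fun _ => hr₀.le)).trans ?_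
    rw [Finset.sum_mul]
    exact Finset.sum_le_sum fun q _ => mul_le_mul_of_nonneg_left
      (mono_le_mono (fun _ => hr₀.le) fun _ => hle q) (abs_nonneg _)
  · have h1 : HasSum (fun m q => mono m x * taylorCoeff (fun x => f x q) m) fun q => f x q :=
      Pi.hasSum.2 fun q => by
        simpa only [mul_comm, mono] using hsum q x fun j => (hx j).trans (hle q)
    exact h1.mapL (EuclideanSpace.equiv (Fin l) ℝ).symm.toContinuousLinearMap

/-- The exponents of `y` in the term of exponent `m` of the local form of the map along
`{y_i = 0, i ∈ I}`: the order of vanishing `⟨a_i, m₀⟩` is divided out for `i ∈ I`. -/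
def localExp (a : Fin n → Fin n → ℕ) (m₀ : Fin n → ℕ) (I : Finset (Fin n)) (m : Fin n → ℕ) :
    Fin n → ℕ := fun i => if i ∈ I then a i ⬝ᵥ m - a i ⬝ᵥ m₀ else a i ⬝ᵥ m

/-- The local form `g_I` of the map in monomial coordinates `x = φ(y)`, which satisfies
`f (φ y) = ∏ i ∈ I, y_i ^ ⟨a_i, m₀⟩ • g_I y`. -/
def localForm (f : (Fin n → ℝ) → EuclideanSpace ℝ (Fin l)) (a : Fin n → Fin n → ℕ) (m₀ : Fin n → ℕ)
    (I : Finset (Fin n)) (y : Fin n → ℝ) : EuclideanSpace ℝ (Fin l) :=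
  ∑' m, mono (localExp a m₀ I m) y • taylorVec f m

variable {a : Fin n → Fin n → ℕ} {I : Finset (Fin n)} {m₀ : Fin n → ℕ}

lemma mono_dotProduct_eq {m : Fin n → ℕ} (h : ∀ i, a i ⬝ᵥ m₀ ≤ a i ⬝ᵥ m) (y : Fin n → ℝ) :
    mono (fun i => a i ⬝ᵥ m) y = (∏ i ∈ I, y i ^ (a i ⬝ᵥ m₀)) * mono (localExp a m₀ I m) y := by
  have h1 : ∏ i ∈ I, y i ^ (a i ⬝ᵥ m₀) = ∏ i, if i ∈ I then y i ^ (a i ⬝ᵥ m₀) else 1 := by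
    rw [Finset.prod_ite_mem, Finset.univ_inter]
  rw [h1, mono, mono, ← Finset.prod_mul_distrib]
  refine Finset.prod_congr rfl fun i _ => ?_
  rw [localExp]
  split_ifs
  · rw [← pow_add, Nat.add_sub_cancel' (h i)]
  · rw [one_mul]

/-- The local form is smooth, and represents the map, near every point of the closed orthant which
the monomial map sends to the origin. -/
lemma exists_polydisc_localForm (hf : AnalyticAt ℝ f 0)
    (hd : ∀ i, dMin (newtonPolyhedron f) (a i) = ((a i ⬝ᵥ m₀ : ℕ) : ℝ)) (I : Finset (Fin n))
    {y₀ : Fin n → ℝ} (hy₀ : ∀ i, 0 ≤ y₀ i) (h0 : monoMap a y₀ = 0) :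
    ∃ R : Fin n → ℝ, y₀ ∈ polydisc R ∧ ContDiffOn ℝ ∞ (localForm f a m₀ I) (polydisc R) ∧
      ∀ y ∈ polydisc R,
        f (monoMap a y) = (∏ i ∈ I, y i ^ (a i ⬝ᵥ m₀)) • localForm f a m₀ I y := by
  obtain ⟨r, hr, hS, hsum⟩ := exists_hasSum_taylorVec hf
  obtain ⟨ε, hε, hεr⟩ : ∃ ε : ℝ, 0 < ε ∧ ∀ j, monoMap a (fun i => y₀ i + ε) j < r := by
    have hc : Continuous fun ε : ℝ => monoMap a fun i => y₀ i + ε :=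
      (continuous_monoMap a).comp (by fun_prop)
    have h1 : ∀ᶠ ε : ℝ in 𝓝 0, ∀ j, monoMap a (fun i => y₀ i + ε) j < r := by
      refine eventually_all.2 fun j => ?_
      have h2 : Continuous fun ε : ℝ => monoMap a (fun i => y₀ i + ε) j :=
        (continuous_apply j).comp hc
      refine (h2.tendsto 0).eventually_lt_const ?_
      simpa [h0] using hr
    obtain ⟨δ, hδ, hball⟩ := Metric.eventually_nhds_iff.1 h1
    refine ⟨δ / 2, by positivity, hball ?_⟩
    rw [dist_zero_right, Real.norm_of_nonneg (by positivity)]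
    linarith
  set R : Fin n → ℝ := fun i => y₀ i + ε with hR
  have hR0 : ∀ i, 0 < R i := fun i => by have := hy₀ i; simp only [hR]; linarith
  have hbound : ∀ y : Fin n → ℝ, (∀ i, |y i| ≤ R i) → ∀ j, |monoMap a y j| ≤ r := fun y hy j =>
    (abs_mono_le hy).trans (hεr j).le
  set C : ℝ := ∏ i ∈ I, R i ^ (a i ⬝ᵥ m₀) with hC
  have hC0 : 0 < C := Finset.prod_pos fun i _ => pow_pos (hR0 i) _
  have hS' : Summable fun m => ‖taylorVec f m‖ * mono (localExp a m₀ I m) R := by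
    refine Summable.of_nonneg_of_le (fun m => mul_nonneg (norm_nonneg _)
      (mono_nonneg fun i => (hR0 i).le)) (fun m => ?_) (hS.mul_right C⁻¹)
    by_cases hm : m ∈ taylorSupport f
    · rw [mul_assoc]
      refine mul_le_mul_of_nonneg_left ?_ (norm_nonneg _)
      rw [← div_eq_mul_inv, le_div_iff₀ hC0, mul_comm,
        ← mono_dotProduct_eq (dotProduct_le_of_mem_taylorSupport hd hm), ← mono_monoMap]
      exact mono_le_mono (fun j => (mono_pos hR0).le) fun j => (hεr j).le
    · simp [taylorVec_eq_zero hm]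
  refine ⟨R, fun i => ?_, contDiffOn_tsum_mono hS', fun y hy => ?_⟩
  · rw [abs_of_nonneg (hy₀ i)]
    exact lt_add_of_pos_right _ hε
  · rw [← (hsum _ (hbound y fun i => (hy i).le)).tsum_eq, localForm, ← tsum_const_smul'']
    refine tsum_congr fun m => ?_
    by_cases hm : m ∈ taylorSupport f
    · rw [mono_monoMap, mono_dotProduct_eq (dotProduct_le_of_mem_taylorSupport hd hm), mul_smul]
    · simp [taylorVec_eq_zero hm]

/-- The point `y` with the coordinates in `I` replaced by `1`. -/
def fillOne (I : Finset (Fin n)) (y : Fin n → ℝ) : Fin n → ℝ := fun i => if i ∈ I then 1 else y i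

/-- On the coordinate plane `{y_i = 0, i ∈ I}` the local form is the face part of the map. -/
lemma localForm_eq_sum (hd : ∀ i, dMin (newtonPolyhedron f) (a i) = ((a i ⬝ᵥ m₀ : ℕ) : ℝ))
    (hfin : (faceSupport f a I).Finite) {y : Fin n → ℝ} (hy : ∀ i ∈ I, y i = 0) :
    localForm f a m₀ I y =
      ∑ m ∈ hfin.toFinset, mono (fun i => a i ⬝ᵥ m) (fillOne I y) • taylorVec f m := by
  rw [localForm, tsum_eq_sum (s := hfin.toFinset)]
  · refine Finset.sum_congr rfl fun m hm => ?_
    have hm' := ((mem_faceSupport_iff hd).1 (hfin.mem_toFinset.1 hm)).2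
    congr 1
    refine Finset.prod_congr rfl fun i _ => ?_
    rw [localExp, fillOne]
    split_ifs with hi
    · rw [hm' i hi, Nat.sub_self, pow_zero, one_pow]
    · rfl
  · intro m hm
    by_cases hmG : m ∈ taylorSupport f
    · have h1 : ∃ i ∈ I, a i ⬝ᵥ m ≠ a i ⬝ᵥ m₀ := by
        by_contra! h
        exact hm (hfin.mem_toFinset.2 ((mem_faceSupport_iff hd).2 ⟨hmG, h⟩))
      obtain ⟨i, hi, hne⟩ := h1
      have h2 := (dotProduct_le_of_mem_taylorSupport hd hmG i).lt_of_ne hne.symm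
      have h3 : mono (localExp a m₀ I m) y = 0 := by
        refine Finset.prod_eq_zero (Finset.mem_univ i) ?_
        rw [hy i hi, localExp, if_pos hi, zero_pow (by omega)]
      rw [h3, zero_smul]
    · simp [taylorVec_eq_zero hmG]

lemma localForm_eq_facePart (hd : ∀ i, dMin (newtonPolyhedron f) (a i) = ((a i ⬝ᵥ m₀ : ℕ) : ℝ))
    (hfin : (faceSupport f a I).Finite) {y : Fin n → ℝ} (hy : ∀ i ∈ I, y i = 0) :
    localForm f a m₀ I y = facePart f (⋂ i ∈ I, firstMeetLocus (newtonPolyhedron f) (a i))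
      (monoMap a (fillOne I y)) := by
  rw [localForm_eq_sum hd hfin hy, facePart_eq_sum hfin]
  simp only [mono_monoMap]

lemma hasFDerivAt_facePart (hfin : (faceSupport f a I).Finite) (z : Fin n → ℝ) :
    HasFDerivAt (facePart f (⋂ i ∈ I, firstMeetLocus (newtonPolyhedron f) (a i)))
      (∑ m ∈ hfin.toFinset, (∑ j, ((m j : ℝ) * mono (lower m j) z) •
        (ContinuousLinearMap.proj j : (Fin n → ℝ) →L[ℝ] ℝ)).smulRight (taylorVec f m)) z := by
  rw [funext (facePart_eq_sum hfin)]
  exact HasFDerivAt.fun_sum fun m _ => (hasFDerivAt_mono m z).smul_const _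

/-- The derivative of a face part along the invariant vector field of the one-parameter group
`t ↦ (t ^ a_{k,j} z_j)_j`. -/
lemma fderiv_facePart_apply (hfin : (faceSupport f a I).Finite) (z : Fin n → ℝ) (k : Fin n) :
    fderiv ℝ (facePart f (⋂ i ∈ I, firstMeetLocus (newtonPolyhedron f) (a i))) z
        (fun j => z j * (a k j : ℝ)) =
      ∑ m ∈ hfin.toFinset, (((a k ⬝ᵥ m : ℕ) : ℝ) * mono m z) • taylorVec f m := by
  rw [(hasFDerivAt_facePart hfin z).fderiv, sum_apply]
  refine Finset.sum_congr rfl fun m _ => ?_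
  rw [ContinuousLinearMap.smulRight_apply, sum_apply]
  congr 1
  simp only [smul_apply, ContinuousLinearMap.proj_apply, smul_eq_mul, dotProduct]
  push_cast
  rw [Finset.sum_mul]
  refine Finset.sum_congr rfl fun j _ => ?_
  linear_combination (a k j : ℝ) * natCast_mul_mono_lower m j z

/-- Euler's relation: face parts are quasi-homogeneous. -/
lemma fderiv_facePart_apply_of_mem
    (hd : ∀ i, dMin (newtonPolyhedron f) (a i) = ((a i ⬝ᵥ m₀ : ℕ) : ℝ))
    (hfin : (faceSupport f a I).Finite) (z : Fin n → ℝ) {k : Fin n} (hk : k ∈ I) :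
    fderiv ℝ (facePart f (⋂ i ∈ I, firstMeetLocus (newtonPolyhedron f) (a i))) z
        (fun j => z j * (a k j : ℝ)) =
      ((a k ⬝ᵥ m₀ : ℕ) : ℝ) •
        facePart f (⋂ i ∈ I, firstMeetLocus (newtonPolyhedron f) (a i)) z := by
  rw [fderiv_facePart_apply hfin, facePart_eq_sum hfin, Finset.smul_sum]
  refine Finset.sum_congr rfl fun m hm => ?_
  rw [((mem_faceSupport_iff hd).1 (hfin.mem_toFinset.1 hm)).2 k hk, mul_smul]

lemma smul_fderiv_localForm
    (hd : ∀ i, dMin (newtonPolyhedron f) (a i) = ((a i ⬝ᵥ m₀ : ℕ) : ℝ))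
    (hfin : (faceSupport f a I).Finite) {y : Fin n → ℝ} (hy : ∀ i ∈ I, y i = 0)
    (hdiff : DifferentiableAt ℝ (localForm f a m₀ I) y) {k : Fin n} (hk : k ∉ I) :
    y k • fderiv ℝ (localForm f a m₀ I) y (Pi.single k 1) =
      fderiv ℝ (facePart f (⋂ i ∈ I, firstMeetLocus (newtonPolyhedron f) (a i)))
        (monoMap a (fillOne I y)) (fun j => monoMap a (fillOne I y) j * (a k j : ℝ)) := by
  have hline : ∀ z : Fin n → ℝ, HasDerivAt (fun t : ℝ => z + t • (Pi.single k 1 : Fin n → ℝ))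
      (Pi.single k 1) 0 := fun z => by
    simpa using ((hasDerivAt_id (0 : ℝ)).smul_const (Pi.single k 1 : Fin n → ℝ)).const_add z
  have h1 : HasDerivAt (fun t : ℝ => localForm f a m₀ I (y + t • (Pi.single k 1 : Fin n → ℝ)))
      (fderiv ℝ (localForm f a m₀ I) y (Pi.single k 1)) 0 := by
    have h0 : HasFDerivAt (localForm f a m₀ I) (fderiv ℝ (localForm f a m₀ I) y)
        (y + (0 : ℝ) • (Pi.single k 1 : Fin n → ℝ)) := by simpa using hdiff.hasFDerivAt
    exact h0.comp_hasDerivAt 0 (hline y)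
  have hfill : ∀ t : ℝ, fillOne I (y + t • (Pi.single k 1 : Fin n → ℝ)) =
      fillOne I y + t • (Pi.single k 1 : Fin n → ℝ) := fun t => by
    funext i
    by_cases hi : i ∈ I
    · have : i ≠ k := fun h => hk (h ▸ hi)
      simp [fillOne, hi, this]
    · simp [fillOne, hi]
  have h2 : (fun t : ℝ => localForm f a m₀ I (y + t • (Pi.single k 1 : Fin n → ℝ))) = fun t =>
      ∑ m ∈ hfin.toFinset, mono (fun i => a i ⬝ᵥ m)
        (fillOne I y + t • (Pi.single k 1 : Fin n → ℝ)) • taylorVec f m := by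
    funext t
    rw [localForm_eq_sum hd hfin, hfill]
    intro i hi
    have : i ≠ k := fun h => hk (h ▸ hi)
    simp [hy i hi, this]
  have h3 : HasDerivAt (fun t : ℝ => ∑ m ∈ hfin.toFinset, mono (fun i => a i ⬝ᵥ m)
        (fillOne I y + t • (Pi.single k 1 : Fin n → ℝ)) • taylorVec f m)
      (∑ m ∈ hfin.toFinset, (((a k ⬝ᵥ m : ℕ) : ℝ) *
        mono (lower (fun i => a i ⬝ᵥ m) k) (fillOne I y)) • taylorVec f m) 0 := by
    refine HasDerivAt.fun_sum fun m _ => HasDerivAt.smul_const ?_ _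
    have h4 : HasFDerivAt (mono fun i => a i ⬝ᵥ m) _
        (fillOne I y + (0 : ℝ) • (Pi.single k 1 : Fin n → ℝ)) := hasFDerivAt_mono _ _
    refine (h4.comp_hasDerivAt 0 (hline (fillOne I y))).congr_deriv ?_
    rw [sum_apply, Finset.sum_eq_single k]
    · simp
    · intro i _ hi
      simp [hi]
    · simp
  rw [h2] at h1
  rw [h1.unique h3, fderiv_facePart_apply hfin, Finset.smul_sum]
  refine Finset.sum_congr rfl fun m _ => ?_
  rw [smul_smul, mono_monoMap]
  congr 1
  have h5 := natCast_mul_mono_lower (fun i => a i ⬝ᵥ m) k (fillOne I y)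
  have h6 : fillOne I y k = y k := if_neg hk
  rw [h6] at h5
  linarith

end LocalForm

/-! ### Transversality of the local form -/

section Transversality
open Set Filter

variable {f : (Fin n → ℝ) → EuclideanSpace ℝ (Fin l)} {a : Fin n → Fin n → ℕ} {m₀ : Fin n → ℕ}

/-- Under strong non-degeneracy, a face part restricted to the sector `S_K` complementary to the
face has no critical zeros: by Euler's relation the directions `a_i`, `i ∉ K`, lie in the kernel of
its differential. -/
lemma map_sectorTangent_eq_top_of_nonDegenerate (hnd : StronglyNonDegenerate f)
    (ha : LinearIndependent ℝ fun i => toReal (a i)) (hm₀ : m₀ ∈ taylorSupport f)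
    (hd : ∀ i, dMin (newtonPolyhedron f) (a i) = ((a i ⬝ᵥ m₀ : ℕ) : ℝ))
    {I K : Finset (Fin n)} (hIK : Disjoint I K) (hcov : ∀ i, i ∈ I ∨ i ∈ K) (hIne : I.Nonempty)
    (hI : ∀ j, ∃ i ∈ I, a i j ≠ 0) {z : Fin n → ℝ} (hz : ∀ j, z j ≠ 0)
    (h0 : facePart f (⋂ i ∈ I, firstMeetLocus (newtonPolyhedron f) (a i)) z = 0) :
    (sectorTangent a K z).map (fderiv ℝ
      (facePart f (⋂ i ∈ I, firstMeetLocus (newtonPolyhedron f) (a i))) z).toLinearMap = ⊤ := by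
  have hfin := finite_faceSupport hd hI
  set τ := ⋂ i ∈ I, firstMeetLocus (newtonPolyhedron f) (a i) with hτ
  have hrank := hnd τ (isExposed_iInter_firstMeetLocus hm₀ hd hIne)
    (nonempty_iInter_firstMeetLocus hm₀ hd) (isCompact_iInter_firstMeetLocus hd hIne hI) z hz h0
  set L := fderiv ℝ (facePart f τ) z with hL
  have hspan : Submodule.span ℝ (range fun i => toReal (a i)) = ⊤ :=
    ha.span_eq_top_of_card_eq_finrank' (by simp)
  have hle : LinearMap.range L.toLinearMap ≤ (sectorTangent a K z).map L.toLinearMap := by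
    rintro _ ⟨v, rfl⟩
    have hv : (fun j => v j / z j) ∈ Submodule.span ℝ (range fun i => toReal (a i)) := by
      rw [hspan]; trivial
    obtain ⟨c, hc⟩ := (Submodule.mem_span_range_iff_exists_fun ℝ).1 hv
    have hvc : v = ∑ i, c i • fun j => z j * (a i j : ℝ) := by
      funext j
      have h1 := congrFun hc j
      simp only [Finset.sum_apply, Pi.smul_apply, smul_eq_mul, toReal] at h1 ⊢
      rw [eq_div_iff (hz j)] at h1
      rw [← h1, Finset.sum_mul]
      exact Finset.sum_congr rfl fun i _ => by ring
    rw [hvc, map_sum]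
    refine Submodule.sum_mem _ fun i _ => ?_
    rw [map_smul]
    refine Submodule.smul_mem _ _ ?_
    rcases hcov i with hi | hi
    · have h1 := fderiv_facePart_apply_of_mem hd hfin z hi
      rw [h0, smul_zero] at h1
      rw [ContinuousLinearMap.coe_coe, h1]
      exact Submodule.zero_mem _
    · exact Submodule.mem_map_of_mem (Submodule.subset_span ⟨i, hi, rfl⟩)
  have hK : Module.finrank ℝ (sectorTangent a K z) ≤ K.card := by
    classical
    have h1 : sectorTangent a K z =
        Submodule.span ℝ (K.image fun i => fun j => z j * (a i j : ℝ) : Finset (Fin n → ℝ)) := by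
      rw [sectorTangent]
      congr 1
      ext v
      simp [eq_comm]
    rw [h1]
    exact (finrank_span_finset_le_card _).trans Finset.card_image_le
  have hKn : K.card < n := by
    obtain ⟨i, hi⟩ := hIne
    have h1 : K.card < (Finset.univ : Finset (Fin n)).card :=
      Finset.card_lt_card (Finset.ssubset_univ_iff.2 fun h =>
        Finset.disjoint_left.1 hIK hi (h ▸ Finset.mem_univ i))
    simpa using h1
  have h2 : min l n ≤ K.card := by
    rw [← hrank]
    exact (Submodule.finrank_mono hle).trans ((Submodule.finrank_map_le _ _).trans hK)
  have h3 : min l n = l := by omega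
  refine top_le_iff.1 (le_trans (top_le_iff.2 ?_) hle)
  exact Submodule.eq_top_of_finrank_eq (by rw [hrank, h3, finrank_euclideanSpace_fin])

/-- At a zero of the local form over the origin in the unit cube, its derivatives in the coordinates
strictly between `0` and `1` span the target. -/
theorem span_fderiv_localForm_eq_top (hn : 0 < n) (hnd : StronglyNonDegenerate f)
    (hcomp : CompatibleWithCone f a)
    (ha : LinearIndependent ℝ fun i => toReal (a i)) (hm₀ : m₀ ∈ taylorSupport f)
    (hd : ∀ i, dMin (newtonPolyhedron f) (a i) = ((a i ⬝ᵥ m₀ : ℕ) : ℝ))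
    {y₀ : Fin n → ℝ} (hy₀ : ∀ i, 0 ≤ y₀ i ∧ y₀ i ≤ 1) (hy0 : monoMap a y₀ = 0)
    {I K : Finset (Fin n)} (hI : ∀ i, i ∈ I ↔ y₀ i = 0) (hK : ∀ i, i ∈ K ↔ 0 < y₀ i ∧ y₀ i < 1)
    (hdiff : DifferentiableAt ℝ (localForm f a m₀ I) y₀) (h0 : localForm f a m₀ I y₀ = 0) :
    Submodule.span ℝ ((fun k => fderiv ℝ (localForm f a m₀ I) y₀ (Pi.single k 1)) ''
      (K : Set (Fin n))) = ⊤ := by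
  classical
  have hcol : ∀ j, ∃ i ∈ I, a i j ≠ 0 := fun j => by
    have h1 : mono (fun i => a i j) y₀ = 0 := congrFun hy0 j
    obtain ⟨i, -, hi⟩ := Finset.prod_eq_zero_iff.1 h1
    refine ⟨i, (hI i).2 (eq_zero_of_pow_eq_zero hi), fun h => ?_⟩
    simp [h] at hi
  have hIne : I.Nonempty := by
    obtain ⟨i, hi, -⟩ := hcol ⟨0, hn⟩
    exact ⟨i, hi⟩
  have hIK : Disjoint I K := Finset.disjoint_left.2 fun i hi hk => by
    have h1 := (hI i).1 hi
    have h2 := ((hK i).1 hk).1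
    exact h2.ne' h1
  have hfin := finite_faceSupport hd hcol
  have hyI : ∀ i ∈ I, y₀ i = 0 := fun i hi => (hI i).1 hi
  set z := monoMap a (fillOne I y₀) with hz
  have hfill : ∀ i, 0 < fillOne I y₀ i := fun i => by
    rw [fillOne]
    split_ifs with hi
    · exact one_pos
    · exact (hy₀ i).1.lt_of_ne fun h => hi ((hI i).2 h.symm)
  have hzpos : ∀ j, 0 < z j := fun j => mono_pos hfill
  have hz0 : facePart f (⋂ i ∈ I, firstMeetLocus (newtonPolyhedron f) (a i)) z = 0 := by
    rw [hz, ← localForm_eq_facePart hd hfin hyI, h0]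
  have hsec : (sectorTangent a K z).map (fderiv ℝ
      (facePart f (⋂ i ∈ I, firstMeetLocus (newtonPolyhedron f) (a i))) z).toLinearMap = ⊤ := by
    by_cases hcov : ∀ i, i ∈ I ∨ i ∈ K
    · exact map_sectorTangent_eq_top_of_nonDegenerate hnd ha hm₀ hd hIK hcov hIne hcol
        (fun j => (hzpos j).ne') hz0
    · push Not at hcov
      obtain ⟨j₀, hj₀⟩ := hcov
      have hJ : ∀ i, i ∉ I → i ∉ K → y₀ i = 1 := fun i hi hk => by
        by_contra h1
        exact hk ((hK i).2 ⟨(hy₀ i).1.lt_of_ne fun h => hi ((hI i).2 h.symm),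
          (hy₀ i).2.lt_of_ne h1⟩)
      refine hcomp K I (I ∪ K)ᶜ ?_ hIK ?_ ?_ hIne ⟨j₀, by simpa using hj₀⟩
        (isCompact_iInter_firstMeetLocus hd hIne hcol) (nonempty_iInter_firstMeetLocus hm₀ hd)
        z ⟨fun j => ⟨hzpos j, ?_⟩, fun k => -Real.log (y₀ k), ?_, ?_⟩ hz0
      · exact disjoint_compl_right.mono_right (Finset.compl_subset_compl.2 Finset.subset_union_left)
      · exact disjoint_compl_left.mono_left (Finset.compl_subset_compl.2 Finset.subset_union_right)
      · ext i
        simp only [Finset.mem_union, Finset.mem_compl, Finset.mem_univ, iff_true]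
        tauto
      · refine mono_le_one (fun i => (hfill i).le) fun i => ?_
        rw [fillOne]
        split_ifs
        · exact le_rfl
        · exact (hy₀ i).2
      · intro k hk
        have h1 := (hK k).1 hk
        simpa using Real.log_neg h1.1 h1.2
      · funext j
        have h1 : Real.log (z j) = ∑ i, (a i j : ℝ) * Real.log (fillOne I y₀ i) := log_mono hfill
        rw [h1, Finset.sum_apply, ← Finset.sum_neg_distrib]
        symm
        refine Finset.sum_subset_zero_on_sdiff (Finset.subset_univ K) ?_ ?_
        · intro i hi
          have hk : i ∉ K := (Finset.mem_sdiff.1 hi).2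
          rw [fillOne]
          split_ifs with h2
          · simp
          · rw [hJ i h2 hk]
            simp
        · intro i hi
          have h2 : fillOne I y₀ i = y₀ i := if_neg (Finset.disjoint_right.1 hIK hi)
          rw [h2]
          simp only [Pi.smul_apply, smul_eq_mul, toReal]
          ring
  rw [← top_le_iff, ← hsec, sectorTangent, Submodule.map_span_le]
  rintro _ ⟨k, hk, rfl⟩
  rw [ContinuousLinearMap.coe_coe, ← smul_fderiv_localForm hd hfin hyI hdiff
    (Finset.disjoint_right.1 hIK hk)]
  exact Submodule.smul_mem _ _ (Submodule.subset_span ⟨k, hk, rfl⟩)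

end Transversality

/-! ### Existence of transverse frames -/

section Frames
open Set Filter

variable {F : Type*} [NormedAddCommGroup F] [NormedSpace ℝ F]

/-- A function which is smooth near a point agrees there with a globally smooth function. -/
lemma exists_contDiff_eqOn {h : (Fin n → ℝ) → F} {O : Set (Fin n → ℝ)} (hO : IsOpen O)
    (hh : ContDiffOn ℝ ∞ h O) {y₀ : Fin n → ℝ} (hy₀ : y₀ ∈ O) :
    ∃ k : (Fin n → ℝ) → F, ContDiff ℝ ∞ k ∧
      ∃ W, IsOpen W ∧ y₀ ∈ W ∧ W ⊆ O ∧ EqOn k h W := by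
  obtain ⟨ε, hε, hball⟩ := Metric.nhds_basis_closedBall.mem_iff.1 (hO.mem_nhds hy₀)
  obtain ⟨χ, hχ, -, hχ1⟩ := exists_isTest_eq_one hO (isCompact_closedBall y₀ ε) hball
  refine ⟨fun y => χ y • h y, ?_, Metric.ball y₀ ε, Metric.isOpen_ball, Metric.mem_ball_self hε,
    Metric.ball_subset_closedBall.trans hball, fun y hy => ?_⟩
  · refine contDiff_iff_contDiffAt.2 fun y => ?_
    by_cases hy : y ∈ O
    · exact hχ.contDiff.contDiffAt.smul (hh.contDiffAt (hO.mem_nhds hy))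
    · have h0 := notMem_tsupport_iff_eventuallyEq.1 fun h => hy (hχ.tsupport_subset h)
      refine (contDiffAt_const (c := (0 : F))).congr_of_eventuallyEq ?_
      filter_upwards [h0] with w hw
      simp [hw]
  · beta_reduce
    rw [hχ1 y (Metric.ball_subset_closedBall hy), one_smul]

lemma contDiff_det {N : (Fin n → ℝ) → Matrix (Fin l) (Fin l) ℝ}
    (hN : ∀ i j, ContDiff ℝ ∞ fun y => N y i j) : ContDiff ℝ ∞ fun y => (N y).det := by
  simp only [Matrix.det_apply']
  exact ContDiff.sum fun σ _ => contDiff_const.mul (contDiff_prod fun i _ => hN _ _)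

lemma contDiff_adjugate {N : (Fin n → ℝ) → Matrix (Fin l) (Fin l) ℝ}
    (hN : ∀ i j, ContDiff ℝ ∞ fun y => N y i j) (i j : Fin l) :
    ContDiff ℝ ∞ fun y => (N y).adjugate i j := by
  simp only [Matrix.adjugate_apply]
  refine contDiff_det fun p q => ?_
  by_cases h : p = j
  · subst h
    simpa using contDiff_const
  · simpa [Matrix.updateRow_ne h] using hN p q

/-- If the derivatives of `g` at `y₀` in the coordinates `K` span the target, then `g` admits a
transverse frame near `y₀` with directions in the coordinates `K`. -/
theorem exists_transverseFrame {g : (Fin n → ℝ) → EuclideanSpace ℝ (Fin l)} (hg : ContDiff ℝ ∞ g)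
    {y₀ : Fin n → ℝ} {A B K : Finset (Fin n)} (hAK : Disjoint A K) (hBK : Disjoint B K)
    (hspan : Submodule.span ℝ ((fun k => fderiv ℝ g y₀ (Pi.single k 1)) '' (K : Set (Fin n))) = ⊤) :
    ∃ W, IsOpen W ∧ y₀ ∈ W ∧ Nonempty (TransverseFrame A B W g) := by
  have hr : ∀ m : Fin l, ∃ r : Fin n → ℝ, (∀ j ∉ K, r j = 0) ∧
      fderiv ℝ g y₀ r = EuclideanSpace.single m 1 := fun m => by
    have hle : Submodule.span ℝ ((fun k => fderiv ℝ g y₀ (Pi.single k 1)) '' (K : Set (Fin n))) ≤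
        (Submodule.pi (univ : Set (Fin n)) fun j =>
          if j ∈ K then (⊤ : Submodule ℝ ℝ) else ⊥).map (fderiv ℝ g y₀).toLinearMap := by
      rw [Submodule.span_le]
      rintro _ ⟨k, hk, rfl⟩
      refine Submodule.mem_map_of_mem fun j _ => ?_
      change (Pi.single k 1 : Fin n → ℝ) j ∈ if j ∈ K then (⊤ : Submodule ℝ ℝ) else ⊥
      split_ifs with hj
      · trivial
      · have : j ≠ k := fun h => hj (h ▸ hk)
        simp [this]
    have hm : EuclideanSpace.single m (1 : ℝ) ∈ Submodule.span ℝ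
        ((fun k => fderiv ℝ g y₀ (Pi.single k 1)) '' (K : Set (Fin n))) := by
      rw [hspan]; trivial
    obtain ⟨r, hr, hrm⟩ := hle hm
    refine ⟨r, fun j hj => ?_, hrm⟩
    simpa [hj] using hr j (mem_univ j)
  choose r hr0 hr1 using hr
  have hgq : ∀ q, ContDiff ℝ ∞ fun y => g y q := fun q =>
    (EuclideanSpace.proj q : EuclideanSpace ℝ (Fin l) →L[ℝ] ℝ).contDiff.comp hg
  set N : (Fin n → ℝ) → Matrix (Fin l) (Fin l) ℝ := fun y =>
    Matrix.of fun q m => dirD (r m) (fun y => g y q) y with hN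
  have hNc : ∀ i j, ContDiff ℝ ∞ fun y => N y i j := fun i j => contDiff_dirD (hgq i) (r j)
  have hdet : ContDiff ℝ ∞ fun y => (N y).det := contDiff_det hNc
  have hN1 : N y₀ = 1 := by
    ext q m
    have h1 : HasFDerivAt (fun y => g y q)
        ((EuclideanSpace.proj q : EuclideanSpace ℝ (Fin l) →L[ℝ] ℝ).comp (fderiv ℝ g y₀)) y₀ :=
      (EuclideanSpace.proj q : EuclideanSpace ℝ (Fin l) →L[ℝ] ℝ).hasFDerivAt.comp y₀
        (hg.differentiable (by simp) y₀).hasFDerivAt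
    change dirD (r m) (fun y => g y q) y₀ = _
    rw [dirD, h1.fderiv, ContinuousLinearMap.comp_apply, hr1]
    simp [Matrix.one_apply]
  have hO : IsOpen {y | (N y).det ≠ 0} := isOpen_ne_fun hdet.continuous continuous_const
  obtain ⟨κ, hκ, W, hW, hyW, hWO, hκW⟩ := exists_contDiff_eqOn (h := fun y => (N y).det⁻¹) hO
    (fun y hy => (hdet.contDiffAt.inv hy).contDiffWithinAt) (y₀ := y₀) (by simp [hN1])
  refine ⟨W, hW, hyW, ⟨⟨r, fun m q y => κ y * (N y).adjugate m q, fun m j hj => ?_,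
    fun m j hj => ?_, hg, fun m q => hκ.mul (contDiff_adjugate hNc m q), fun y hy q q' => ?_⟩⟩⟩
  · exact hr0 m j (Finset.disjoint_left.1 hAK hj)
  · exact hr0 m j (Finset.disjoint_left.1 hBK hj)
  · have h1 : ∀ m, κ y * (N y).adjugate m q * dirD (r m) (fun y => g y q') y =
        κ y * (N y q' m * (N y).adjugate m q) := fun m => by
      have h2 : N y q' m = dirD (r m) (fun y => g y q') y := rfl
      rw [h2]; ring
    simp only [h1]
    rw [← Finset.mul_sum, ← Matrix.mul_apply, Matrix.mul_adjugate, Matrix.smul_apply,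
      smul_eq_mul, ← mul_assoc, hκW hy, inv_mul_cancel₀ (hWO hy), one_mul, Matrix.one_apply]
    simp only [eq_comm]

end Frames

/-! ### Meromorphic continuation of the localized integrals -/

section Local
open Set Filter MeasureTheory

/-- `F` is holomorphic on `H` and continues meromorphically to `ℂ`, the order of the pole at `s`
being at most `b s`. -/
def HasContinuation (H : Set ℂ) (b : ℂ → ℕ) (F : ℂ → ℂ) : Prop :=
  DifferentiableOn ℂ F H ∧ ∃ M : ℂ → ℂ, (∀ s, MeromorphicAt M s ∧
    ((-(b s : ℤ) : ℤ) : WithTop ℤ) ≤ meromorphicOrderAt M s) ∧ EqOn M F H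

lemma HasContinuation.congr {H : Set ℂ} {b : ℂ → ℕ} {F G : ℂ → ℂ} (h : HasContinuation H b F)
    (hFG : EqOn G F H) : HasContinuation H b G := by
  obtain ⟨hF, M, hM, hMF⟩ := h
  exact ⟨hF.congr hFG, M, hM, hMF.trans hFG.symm⟩

lemma HasContinuation.sum {H : Set ℂ} {b : ℂ → ℕ} {ι : Type*} (t : Finset ι) {F : ι → ℂ → ℂ}
    (h : ∀ p ∈ t, HasContinuation H b (F p)) :
    HasContinuation H b fun s => ∑ p ∈ t, F p s := by
  classical
  induction t using Finset.induction_on with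
  | empty =>
    refine ⟨by simp, fun _ => 0, fun s => ⟨?_, ?_⟩, ?_⟩
    · exact MeromorphicAt.const 0 s
    · rw [show (fun _ : ℂ => (0 : ℂ)) = 0 from rfl, meromorphicOrderAt_eq_top_iff.2 (by simp)]
      exact le_top
    · intro s _
      simp
  | insert p t hp ih =>
    obtain ⟨hF, M, hM, hMF⟩ := h p (Finset.mem_insert_self p t)
    obtain ⟨hG, N, hN, hNG⟩ := ih fun q hq => h q (Finset.mem_insert_of_mem hq)
    simp only [Finset.sum_insert hp]
    refine ⟨hF.add hG, M + N, fun s => ⟨(hM s).1.add (hN s).1, ?_⟩, fun s hs => ?_⟩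
    · exact (le_min (hM s).2 (hN s).2).trans (meromorphicOrderAt_add (hM s).1 (hN s).1)
    · rw [Pi.add_apply, hMF hs, hNG hs]

lemma HasContinuation.of_gammaProd {ι : Type*} [Fintype ι] {d σ : ι → ℝ} (hd : ∀ i, 0 < d i)
    {E : ℂ → ℂ} (hE : Differentiable ℂ E) {H : Set ℂ} (hH : H ⊆ shiftPlane d σ 0) {b : ℂ → ℕ}
    (hb : ∀ s, {i | ∃ k : ℕ, (d i : ℂ) * s + σ i = -k}.ncard ≤ b s) :
    HasContinuation H b fun s => E s * gammaProd d σ 0 s := by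
  have h1 : DifferentiableOn ℂ (gammaProd d σ 0) H := by
    have h2 : DifferentiableOn ℂ (fun s => (gammaProd d σ 0 s)⁻¹⁻¹) H :=
      (differentiable_inv_gammaProd d σ 0).differentiableOn.inv fun s hs =>
        inv_ne_zero (gammaProd_ne_zero (hH hs))
    simpa only [inv_inv] using h2
  refine ⟨hE.differentiableOn.mul h1, _, fun s => ?_, fun s _ => rfl⟩
  obtain ⟨h2, h3⟩ := meromorphicOrderAt_mul_gammaProd (σ := σ) hd hE s
  refine ⟨h2, le_trans ?_ h3⟩
  exact_mod_cast neg_le_neg (by exact_mod_cast hb s)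

/-- The bound for the order of the pole at `s`: the number of `i` with `s ∈ 𝒫(a_i)`, plus one if
`s ∈ -(l + ℕ)`, but at most `n`. -/
def poleBound (f : (Fin n → ℝ) → EuclideanSpace ℝ (Fin l)) (a : Fin n → Fin n → ℕ) (s : ℂ) : ℕ :=
  open Classical in
  min n ({i | s ∈ candidatePoles (newtonPolyhedron f) (a i)}.ncard +
    if s ∈ negShift l then 1 else 0)

/-- The half-open unit cube. -/
def unitBox (n : ℕ) : Set (Fin n → ℝ) := {y | ∀ i, 0 < y i ∧ y i ≤ 1}

lemma measurableSet_unitBox : MeasurableSet (unitBox n) := by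
  have : unitBox n = Set.pi univ fun _ => Ioc 0 1 := by
    ext y; simp [unitBox]
  rw [this]
  exact MeasurableSet.univ_pi fun _ => measurableSet_Ioc

/-- `σ(a_i)` as a natural number. -/
def rowSum (a : Fin n → Fin n → ℕ) (i : Fin n) : ℕ := ∑ j, a i j

lemma sigma_eq_rowSum (a : Fin n → Fin n → ℕ) (i : Fin n) : sigma (a i) = rowSum a i := by
  simp [sigma, rowSum]

/-- The integrand in monomial coordinates, up to the constant `|det a|`. -/
def cubeIntegrand (f : (Fin n → ℝ) → EuclideanSpace ℝ (Fin l)) (a : Fin n → Fin n → ℕ)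
    (ψ : (Fin n → ℝ) → ℂ) (s : ℂ) (y : Fin n → ℝ) : ℂ :=
  ((mono (fun i => rowSum a i - 1) y : ℝ) : ℂ) * ψ y * ((‖f (monoMap a y)‖ : ℝ) : ℂ) ^ s

variable {f : (Fin n → ℝ) → EuclideanSpace ℝ (Fin l)} {a : Fin n → Fin n → ℕ} {m₀ : Fin n → ℕ}

lemma mem_shiftPlane_of_mem_convergenceHalfPlane
    (hd : ∀ i, dMin (newtonPolyhedron f) (a i) = ((a i ⬝ᵥ m₀ : ℕ) : ℝ)) {s : ℂ}
    (hs : s ∈ convergenceHalfPlane f a) {k : Fin n} (hk : a k ⬝ᵥ m₀ ≠ 0) :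
    0 < ((a k ⬝ᵥ m₀ : ℕ) : ℝ) * s.re + rowSum a k := by
  have hk' : (0 : ℝ) < ((a k ⬝ᵥ m₀ : ℕ) : ℝ) := by exact_mod_cast Nat.pos_of_ne_zero hk
  have h1 := hs.2 k (by rw [hd]; exact hk'.ne')
  rw [hd, sigma_eq_rowSum, ← neg_div, div_lt_iff₀ hk'] at h1
  linarith

lemma mem_candidatePoles (hd : ∀ i, dMin (newtonPolyhedron f) (a i) = ((a i ⬝ᵥ m₀ : ℕ) : ℝ))
    {s : ℂ} {k : Fin n} (hk : a k ⬝ᵥ m₀ ≠ 0) {N : ℕ}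
    (h : (((a k ⬝ᵥ m₀ : ℕ) : ℝ) : ℂ) * s + ((rowSum a k : ℝ) : ℂ) = -N) :
    s ∈ candidatePoles (newtonPolyhedron f) (a k) := by
  have hk' : (((a k ⬝ᵥ m₀ : ℕ) : ℝ) : ℂ) ≠ 0 := by exact_mod_cast hk
  refine ⟨by rw [hd]; exact_mod_cast hk, N, ?_⟩
  rw [hd, sigma_eq_rowSum, ← neg_div, Complex.ofReal_div, eq_div_iff hk']
  push_cast at h ⊢
  linear_combination h

lemma ncard_le_poleBound_left (hd : ∀ i, dMin (newtonPolyhedron f) (a i) = ((a i ⬝ᵥ m₀ : ℕ) : ℝ))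
    {A : Finset (Fin n)} (hA : ∀ k ∈ A, a k ⬝ᵥ m₀ ≠ 0) (s : ℂ) :
    {k : A | ∃ N : ℕ, (((a k ⬝ᵥ m₀ : ℕ) : ℝ) : ℂ) * s + ((rowSum a k : ℝ) : ℂ) = -N}.ncard ≤
      {i | s ∈ candidatePoles (newtonPolyhedron f) (a i)}.ncard := by
  rw [← Set.ncard_image_of_injective _ Subtype.val_injective]
  refine Set.ncard_le_ncard ?_ (Set.toFinite _)
  rintro _ ⟨k, ⟨N, hN⟩, rfl⟩
  exact mem_candidatePoles hd (hA k k.2) hN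

lemma ncard_le_poleBound (hd : ∀ i, dMin (newtonPolyhedron f) (a i) = ((a i ⬝ᵥ m₀ : ℕ) : ℝ))
    {A : Finset (Fin n)} (hA : ∀ k ∈ A, a k ⬝ᵥ m₀ ≠ 0) (s : ℂ) :
    {k : A | ∃ N : ℕ, (((a k ⬝ᵥ m₀ : ℕ) : ℝ) : ℂ) * s + ((rowSum a k : ℝ) : ℂ) = -N}.ncard ≤
      poleBound f a s := by
  refine le_min ?_ ((ncard_le_poleBound_left hd hA s).trans (Nat.le_add_right _ _))
  refine (Set.ncard_le_card _).trans ?_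
  simpa using A.card_le_univ

lemma ncard_option_le_poleBound
    (hd : ∀ i, dMin (newtonPolyhedron f) (a i) = ((a i ⬝ᵥ m₀ : ℕ) : ℝ))
    {A : Finset (Fin n)} (hA : ∀ k ∈ A, a k ⬝ᵥ m₀ ≠ 0) (hcard : A.card < n) (s : ℂ) :
    {i : Option A | ∃ N : ℕ, ((slopeOpt A (fun i => a i ⬝ᵥ m₀) i : ℝ) : ℂ) * s +
      ((offsetOpt A l (rowSum a) i : ℝ) : ℂ) = -N}.ncard ≤ poleBound f a s := by
  refine le_min ?_ ?_
  · refine (Set.ncard_le_card _).trans ?_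
    rw [Nat.card_eq_fintype_card, Fintype.card_option, Fintype.card_coe]
    exact hcard
  · have hsub : {i : Option A | ∃ N : ℕ, ((slopeOpt A (fun i => a i ⬝ᵥ m₀) i : ℝ) : ℂ) * s +
        ((offsetOpt A l (rowSum a) i : ℝ) : ℂ) = -N} ⊆
        some '' {k : A | ∃ N : ℕ,
          (((a k ⬝ᵥ m₀ : ℕ) : ℝ) : ℂ) * s + ((rowSum a k : ℝ) : ℂ) = -N} ∪
        {i | i = none ∧ s ∈ negShift l} := by
      rintro (_ | k) ⟨N, hN⟩
      · refine Or.inr ⟨rfl, N, ?_⟩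
        simp only [slopeOpt, offsetOpt, Option.elim] at hN
        push_cast at hN
        linear_combination hN
      · exact Or.inl ⟨k, ⟨N, by simpa [slopeOpt, offsetOpt] using hN⟩, rfl⟩
    refine (Set.ncard_le_ncard hsub (Set.toFinite _)).trans
      ((Set.ncard_union_le _ _).trans (add_le_add ?_ ?_))
    · rw [Set.ncard_image_of_injective _ (Option.some_injective _)]
      exact ncard_le_poleBound_left hd hA s
    · split_ifs with h
      · simp [h]
      · simp [h]

end Local

section LocalContinuation
open Set Filter MeasureTheory

variable {f : (Fin n → ℝ) → EuclideanSpace ℝ (Fin l)} {a : Fin n → Fin n → ℕ} {m₀ : Fin n → ℕ}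

lemma IsTest.mono {F : Type*} [NormedAddCommGroup F] [NormedSpace ℝ F] {W W' : Set (Fin n → ℝ)}
    {ψ : (Fin n → ℝ) → F} (h : IsTest W ψ) (hW : W ⊆ W') : IsTest W' ψ :=
  ⟨h.contDiff, h.hasCompactSupport, h.tsupport_subset.trans hW⟩

/-- On the half-open cube, near a point with `y_k < 1` for `k ∈ A` and `0 < y_i < 1` for the
coordinates outside `A` and `B`, the integrand in monomial coordinates is that of a local zeta
function. -/
lemma indicator_cubeIntegrand_eq {A B : Finset (Fin n)} {g : (Fin n → ℝ) → EuclideanSpace ℝ (Fin l)}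
    {d : Fin n → ℕ} (hσ : ∀ i, 0 < rowSum a i) (ψ : (Fin n → ℝ) → ℂ) (s : ℂ) {y : Fin n → ℝ}
    (hA : ∀ k ∈ A, y k < 1) (hAB : ∀ i, i ∉ A → i ∉ B → 0 < y i ∧ y i < 1)
    (hg : f (monoMap a y) = (∏ k ∈ A, y k ^ d k) • g y) :
    (unitBox n).indicator (cubeIntegrand f a ψ s) y =
      locIntegrand A B d (rowSum a) g 0
        (fun y => (∏ i ∈ Aᶜ, y i ^ (rowSum a i - 1)) • ψ y) s y := by
  by_cases hy : y ∈ unitBox n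
  · have hB : ∀ j ∈ B, 0 < y j ∧ y j ≤ 1 := fun j _ => hy j
    have hp : ∀ k : A, ppow (shiftExp (rowSum a) (0 : A → ℕ) k) (y k) =
        y k ^ (rowSum a k - 1) := fun k => by
      rw [ppow, if_pos (hy k).1, shiftExp, Pi.zero_apply, Nat.cast_zero, add_zero,
        ← Real.rpow_natCast, Nat.cast_pred (hσ k)]
    have hwt : wt A B (shiftExp (rowSum a) 0) y * ∏ i ∈ Aᶜ, y i ^ (rowSum a i - 1) =
        mono (fun i => rowSum a i - 1) y := by
      rw [wt, if_pos hB, one_mul, Finset.prod_congr rfl fun k _ => hp k,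
        Finset.prod_coe_sort A fun k => y k ^ (rowSum a k - 1), Finset.prod_mul_prod_compl, mono]
    have hnorm : ‖f (monoMap a y)‖ = locQ A d g y := by
      rw [hg, norm_smul, locQ, Real.norm_eq_abs, Finset.abs_prod,
        Finset.prod_coe_sort A fun k => |y k| ^ d k]
      simp only [abs_pow]
    rw [indicator_of_mem hy, cubeIntegrand, locIntegrand, hnorm, ← hwt, Complex.real_smul]
    push_cast
    ring
  · rw [indicator_of_notMem hy, locIntegrand]
    have hwt : wt A B (shiftExp (rowSum a) 0) y = 0 := by
      by_contra h
      refine hy fun i => ?_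
      have h2 : ∀ j ∈ B, 0 < y j ∧ y j ≤ 1 := by
        by_contra h2
        exact h (by rw [wt, if_neg h2, zero_mul])
      by_cases hiA : i ∈ A
      · exact ⟨pos_of_wt_ne_zero h ⟨i, hiA⟩, (hA i hiA).le⟩
      · by_cases hiB : i ∈ B
        · exact h2 i hiB
        · exact ⟨(hAB i hiA hiB).1, (hAB i hiA hiB).2.le⟩
    rw [hwt]
    simp

/-- Every point of the closed unit cube over the origin has a neighborhood in which the localized
integral converges on the half-plane and has a continuation with the required poles. -/
theorem exists_nhds_hasContinuation (hn : 0 < n) (hl : 0 < l) (hf : AnalyticAt ℝ f 0)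
    (hnd : StronglyNonDegenerate f) (hcomp : CompatibleWithCone f a)
    (ha : LinearIndependent ℝ fun i => toReal (a i)) (hm₀ : m₀ ∈ taylorSupport f)
    (hd : ∀ i, dMin (newtonPolyhedron f) (a i) = ((a i ⬝ᵥ m₀ : ℕ) : ℝ))
    (hσ : ∀ i, 0 < rowSum a i) {y₀ : Fin n → ℝ} (hy₀ : ∀ i, 0 ≤ y₀ i ∧ y₀ i ≤ 1)
    (hy0 : monoMap a y₀ = 0) :
    ∃ W, IsOpen W ∧ y₀ ∈ W ∧ ∀ ψ : (Fin n → ℝ) → ℂ, IsTest W ψ →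
      (∀ s ∈ convergenceHalfPlane f a, IntegrableOn (cubeIntegrand f a ψ s) (unitBox n)) ∧
      HasContinuation (convergenceHalfPlane f a) (poleBound f a)
        fun s => ∫ y in unitBox n, cubeIntegrand f a ψ s y := by
  classical
  set I : Finset (Fin n) := {i | y₀ i = 0} with hI
  set K : Finset (Fin n) := {i | 0 < y₀ i ∧ y₀ i < 1} with hK
  have hI' : ∀ i, i ∈ I ↔ y₀ i = 0 := fun i => by simp [hI]
  have hK' : ∀ i, i ∈ K ↔ 0 < y₀ i ∧ y₀ i < 1 := fun i => by simp [hK]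
  set d : Fin n → ℕ := fun i => a i ⬝ᵥ m₀ with hdd
  set A : Finset (Fin n) := I.filter fun i => d i ≠ 0 with hA
  set B : Finset (Fin n) := Kᶜ \ A with hB
  have hAd : ∀ k ∈ A, d k ≠ 0 := fun k hk => (Finset.mem_filter.1 hk).2
  have hAI : ∀ k ∈ A, k ∈ I := fun k hk => (Finset.mem_filter.1 hk).1
  have hAK : Disjoint A K := Finset.disjoint_left.2 fun i hi hk => by
    have h1 := (hI' i).1 (hAI i hi)
    have h2 := ((hK' i).1 hk).1
    exact h2.ne' h1
  have hBK : Disjoint B K := Finset.disjoint_left.2 fun i hi hk =>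
    Finset.mem_compl.1 (Finset.mem_sdiff.1 hi).1 hk
  have hAB : Disjoint A B := Finset.disjoint_sdiff
  have hABK : ∀ i, i ∉ A → i ∉ B → i ∈ K := fun i h1 h2 => by
    by_contra h3
    exact h2 (Finset.mem_sdiff.2 ⟨Finset.mem_compl.2 h3, h1⟩)
  obtain ⟨R, hyR, hsm, hfac⟩ := exists_polydisc_localForm hf hd I (fun i => (hy₀ i).1) hy0
  obtain ⟨g, hg, W₁, hW₁, hyW₁, hW₁R, hgW₁⟩ := exists_contDiff_eqOn (isOpen_polydisc R) hsm hyR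
  set W₂ : Set (Fin n → ℝ) := W₁ ∩ ({y | ∀ k ∈ A, y k < 1} ∩ {y | ∀ i ∈ K, 0 < y i ∧ y i < 1})
    with hW₂
  have hW₂o : IsOpen W₂ := by
    refine hW₁.inter (IsOpen.inter ?_ ?_)
    · simp only [Set.ofPred_forall]
      exact isOpen_biInter_finset fun k _ => isOpen_lt (continuous_apply k) continuous_const
    · simp only [Set.ofPred_forall]
      exact isOpen_biInter_finset fun k _ =>
        (isOpen_lt continuous_const (continuous_apply k)).inter
          (isOpen_lt (continuous_apply k) continuous_const)
  have hyW₂ : y₀ ∈ W₂ := by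
    refine ⟨hyW₁, fun k hk => ?_, fun i hi => (hK' i).1 hi⟩
    rw [(hI' k).1 (hAI k hk)]
    exact one_pos
  -- on `W₂` the localized integrand is that of a local zeta function
  have hint : ∀ ψ : (Fin n → ℝ) → ℂ, IsTest W₂ ψ → ∀ s,
      (unitBox n).indicator (cubeIntegrand f a ψ s) = locIntegrand A B d (rowSum a) g 0
        (fun y => (∏ i ∈ Aᶜ, y i ^ (rowSum a i - 1)) • ψ y) s := by
    intro ψ hψ s
    funext y
    by_cases hy : y ∈ W₂
    · refine indicator_cubeIntegrand_eq hσ ψ s hy.2.1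
        (fun i h1 h2 => hy.2.2 i (hABK i h1 h2)) ?_
      rw [hfac y (hW₁R hy.1), hgW₁ hy.1]
      congr 1
      refine (Finset.prod_subset (Finset.filter_subset _ _) fun i hi hiA => ?_).symm
      have h0 : d i = 0 := by
        by_contra h
        exact hiA (Finset.mem_filter.2 ⟨hi, h⟩)
      change y i ^ d i = 1
      rw [h0, pow_zero]
    · have h0 := hψ.eq_zero hy
      have h1 : cubeIntegrand f a ψ s y = 0 := by simp [cubeIntegrand, h0]
      rw [locIntegrand, indicator_apply, h1]
      simp [h0]
  have htest : ∀ (W : Set (Fin n → ℝ)) (ψ : (Fin n → ℝ) → ℂ), IsTest W ψ →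
      IsTest W fun y => (∏ i ∈ Aᶜ, y i ^ (rowSum a i - 1)) • ψ y := fun W ψ hψ =>
    hψ.smul (by fun_prop)
  -- reduction to the corresponding local zeta function
  have hred : ∀ {ι : Type} [Fintype ι] {δ ρ : ι → ℝ} (ψ : (Fin n → ℝ) → ℂ), IsTest W₂ ψ →
      (∀ i, 0 < δ i) → convergenceHalfPlane f a ⊆ shiftPlane δ ρ 0 →
      (∀ s, {i | ∃ k : ℕ, (δ i : ℂ) * s + ρ i = -k}.ncard ≤ poleBound f a s) →
      ((∀ s ∈ shiftPlane δ ρ 0, Integrable (locIntegrand A B d (rowSum a) g 0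
          (fun y => (∏ i ∈ Aᶜ, y i ^ (rowSum a i - 1)) • ψ y) s)) ∧
        ∃ E : ℂ → ℂ, Differentiable ℂ E ∧ ∀ s ∈ shiftPlane δ ρ 0,
          locZeta A B d (rowSum a) g 0 (fun y => (∏ i ∈ Aᶜ, y i ^ (rowSum a i - 1)) • ψ y) s =
            E s * gammaProd δ ρ 0 s) →
      (∀ s ∈ convergenceHalfPlane f a, IntegrableOn (cubeIntegrand f a ψ s) (unitBox n)) ∧
      HasContinuation (convergenceHalfPlane f a) (poleBound f a)
        fun s => ∫ y in unitBox n, cubeIntegrand f a ψ s y := by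
    intro ι _ δ ρ ψ hψ hδ hH hb ⟨h1, E, hE, h2⟩
    refine ⟨fun s hs => ?_, (HasContinuation.of_gammaProd hδ hE hH hb).congr fun s hs => ?_⟩
    · rw [← integrable_indicator_iff measurableSet_unitBox, hint ψ hψ s]
      exact h1 s (hH hs)
    · beta_reduce
      rw [← integral_indicator measurableSet_unitBox, hint ψ hψ s, ← h2 s (hH hs)]
      rfl
  have hAd' : ∀ k ∈ A, 0 < d k := fun k hk => Nat.pos_of_ne_zero (hAd k hk)
  have hHA : ∀ s ∈ convergenceHalfPlane f a, ∀ k : A, 0 < (d k : ℝ) * s.re + rowSum a k :=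
    fun s hs k => mem_shiftPlane_of_mem_convergenceHalfPlane hd hs (hAd k k.2)
  by_cases hg0 : g y₀ = 0
  · have hgev : g =ᶠ[𝓝 y₀] localForm f a m₀ I := by
      filter_upwards [hW₁.mem_nhds hyW₁] with y hy using hgW₁ hy
    have hspan := span_fderiv_localForm_eq_top hn hnd hcomp ha hm₀ hd hy₀ hy0 hI' hK'
      ((hsm.contDiffAt ((isOpen_polydisc R).mem_nhds hyR)).differentiableAt (by simp))
      (by rw [← hgev.self_of_nhds, hg0])
    rw [← hgev.fderiv_eq] at hspan
    have hKne : K.Nonempty := by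
      by_contra h
      rw [Finset.not_nonempty_iff_eq_empty] at h
      rw [h, Finset.coe_empty, image_empty, Submodule.span_empty] at hspan
      have h1 : (EuclideanSpace.single ⟨0, hl⟩ (1 : ℝ) : EuclideanSpace ℝ (Fin l)) ∈
          (⊥ : Submodule ℝ (EuclideanSpace ℝ (Fin l))) := by rw [hspan]; trivial
      simp at h1
    have hcard : A.card < n := by
      obtain ⟨i, hi⟩ := hKne
      have h1 : A.card < (Finset.univ : Finset (Fin n)).card :=
        Finset.card_lt_card (Finset.ssubset_univ_iff.2 fun h =>
          Finset.disjoint_left.1 hAK (h ▸ Finset.mem_univ i) hi)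
      simpa using h1
    obtain ⟨W₃, hW₃, hyW₃, ⟨D⟩⟩ := exists_transverseFrame hg hAK hBK hspan
    refine ⟨W₂ ∩ W₃, hW₂o.inter hW₃, ⟨hyW₂, hyW₃⟩, fun ψ hψ => ?_⟩
    refine hred ψ (hψ.mono inter_subset_left) ?_ ?_
      (fun s => ncard_option_le_poleBound hd hAd hcard s)
      (exists_entire_locZeta_of_frame D hW₃ hAB hl hAd' (fun k _ => hσ k)
        (htest _ _ (hψ.mono inter_subset_right)))
    · rintro (_ | k)
      · exact one_pos
      · exact Nat.cast_pos.2 (hAd' k k.2)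
    · rintro s hs (_ | k)
      · have := hs.1
        simp only [slopeOpt, offsetOpt, Option.elim, Pi.zero_apply, Nat.cast_zero]
        linarith
      · have := hHA s hs k
        simpa [slopeOpt, offsetOpt] using this
  · have hO : IsOpen {y | g y ≠ 0} := isOpen_ne_fun hg.continuous continuous_const
    obtain ⟨ν, hν, W₃, hW₃, hyW₃, hW₃O, hνW⟩ := exists_contDiff_eqOn
      (h := fun y => (‖g y‖ ^ 2)⁻¹) hO (fun y hy => ((hg.norm_sq ℝ).contDiffAt.inv
        (pow_ne_zero 2 (norm_ne_zero_iff.2 hy))).contDiffWithinAt) (y₀ := y₀) hg0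
    refine ⟨W₂ ∩ W₃, hW₂o.inter hW₃, ⟨hyW₂, hyW₃⟩, fun ψ hψ => ?_⟩
    refine hred (δ := fun k : A => (d k : ℝ)) (ρ := fun k : A => (rowSum a k : ℝ)) ψ
      (hψ.mono inter_subset_left) (fun k => Nat.cast_pos.2 (hAd' k k.2)) ?_
      (fun s => ncard_le_poleBound hd hAd s)
      (exists_entire_locZeta_of_ne_zero hg hν (fun y hy => ?_) hAB hAd' (fun k _ => hσ k)
        (htest _ _ (hψ.mono inter_subset_right)))
    · intro s hs k
      simpa using hHA s hs k
    · rw [hνW hy, inv_mul_cancel₀ (pow_ne_zero 2 (norm_ne_zero_iff.2 (hW₃O hy)))]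

end LocalContinuation

/-! ### Monomial change of variables -/

section ChangeOfVariables
open Set Filter MeasureTheory

variable {a : Fin n → Fin n → ℕ}

/-- The Jacobian matrix of the monomial map. -/
def monoJacobian (a : Fin n → Fin n → ℕ) (y : Fin n → ℝ) : Matrix (Fin n) (Fin n) ℝ :=
  Matrix.of fun j i => (a i j : ℝ) * mono (lower (fun i => a i j) i) y

lemma hasFDerivAt_monoMap (a : Fin n → Fin n → ℕ) (y : Fin n → ℝ) :
    HasFDerivAt (monoMap a) (Matrix.toLin' (monoJacobian a y)).toContinuousLinearMap y := by
  refine hasFDerivAt_pi'' fun j => (hasFDerivAt_mono (fun i => a i j) y).congr_fderiv ?_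
  ext v
  simp [monoJacobian, Matrix.mulVec, dotProduct, sum_apply]

lemma prod_monoMap (hσ : ∀ i, 0 < rowSum a i) (y : Fin n → ℝ) :
    ∏ j, monoMap a y j = mono (fun i => rowSum a i - 1) y * ∏ i, y i := by
  have h1 := mono_monoMap a 1 y
  simp only [mono, Pi.one_apply, pow_one] at h1 ⊢
  rw [h1, ← Finset.prod_mul_distrib]
  refine Finset.prod_congr rfl fun i _ => ?_
  rw [← pow_succ, Nat.sub_add_cancel (hσ i)]
  simp [rowSum, dotProduct]

lemma det_monoJacobian (hσ : ∀ i, 0 < rowSum a i) {y : Fin n → ℝ} (hy : ∀ i, y i ≠ 0) :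
    (monoJacobian a y).det =
      (Matrix.of fun i => toReal (a i)).det * mono (fun i => rowSum a i - 1) y := by
  have h1 : monoJacobian a y * Matrix.diagonal y =
      Matrix.diagonal (monoMap a y) * (Matrix.of fun i => toReal (a i)).transpose := by
    ext j i
    rw [Matrix.mul_diagonal, Matrix.diagonal_mul, monoJacobian, Matrix.of_apply,
      natCast_mul_mono_lower (fun i => a i j), Matrix.transpose_apply, Matrix.of_apply, monoMap,
      toReal, mul_comm]
  have h2 := congrArg Matrix.det h1
  rw [Matrix.det_mul, Matrix.det_mul, Matrix.det_diagonal, Matrix.det_diagonal,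
    Matrix.det_transpose, prod_monoMap hσ] at h2
  have h3 : ∏ i, y i ≠ 0 := Finset.prod_ne_zero_iff.2 fun i _ => hy i
  refine mul_right_cancel₀ h3 ?_
  rw [h2]
  ring

lemma injOn_monoMap (ha : LinearIndependent ℝ fun i => toReal (a i)) :
    InjOn (monoMap a) (unitBox n) := by
  intro y hy y' hy' h
  have h1 : ∑ i, (Real.log (y i) - Real.log (y' i)) • toReal (a i) = 0 := by
    funext j
    have h2 := congrArg Real.log (congrFun h j)
    rw [monoMap, monoMap, log_mono fun i => (hy i).1, log_mono fun i => (hy' i).1,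
      ← sub_eq_zero, ← Finset.sum_sub_distrib] at h2
    rw [Finset.sum_apply, Pi.zero_apply, ← h2]
    refine Finset.sum_congr rfl fun i _ => ?_
    simp only [Pi.smul_apply, smul_eq_mul, toReal]
    ring
  funext i
  have h3 := Fintype.linearIndependent_iff.1 ha _ h1 i
  exact Real.log_injOn_pos (hy i).1 (hy' i).1 (sub_eq_zero.1 h3)

lemma image_monoMap : monoMap a '' unitBox n = logPreimage (closedCone a) := by
  ext x
  constructor
  · rintro ⟨y, hy, rfl⟩
    refine ⟨fun j => ⟨mono_pos fun i => (hy i).1, mono_le_one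
      (fun i => (hy i).1.le) fun i => (hy i).2⟩,
      fun i => -Real.log (y i), fun i => ?_, ?_⟩
    · have := Real.log_nonpos (hy i).1.le (hy i).2
      linarith
    · funext j
      rw [monoMap, log_mono fun i => (hy i).1, Finset.sum_apply, ← Finset.sum_neg_distrib]
      refine Finset.sum_congr rfl fun i _ => ?_
      simp only [Pi.smul_apply, smul_eq_mul, toReal]
      ring
  · rintro ⟨hx, t, ht, hxt⟩
    have hy : (fun i => Real.exp (-t i)) ∈ unitBox n := fun i =>
      ⟨Real.exp_pos _, Real.exp_le_one_iff.2 (neg_nonpos.2 (ht i))⟩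
    refine ⟨_, hy, funext fun j => ?_⟩
    refine Real.log_injOn_pos (mono_pos fun i => (hy i).1) (hx j).1 ?_
    rw [log_mono fun i => (hy i).1, ← neg_inj, congrFun hxt j, Finset.sum_apply,
      ← Finset.sum_neg_distrib]
    refine Finset.sum_congr rfl fun i _ => ?_
    simp only [Pi.smul_apply, smul_eq_mul, toReal, Real.log_exp]
    ring

variable {f : (Fin n → ℝ) → EuclideanSpace ℝ (Fin l)}

/-- The number `|det (a_1, …, a_n)|`, the constant factor in the Jacobian of `monoMap a`. -/
def coneIndex (a : Fin n → Fin n → ℕ) : ℝ := |(Matrix.of fun i => toReal (a i)).det|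

lemma abs_det_smul_zetaIntegrand (hσ : ∀ i, 0 < rowSum a i) (Φ : (Fin n → ℝ) → ℂ) (s : ℂ)
    {y : Fin n → ℝ} (hy : y ∈ unitBox n) :
    |(Matrix.toLin' (monoJacobian a y)).toContinuousLinearMap.det| •
        zetaIntegrand f Φ s (monoMap a y) =
      cubeIntegrand f a (fun y => coneIndex a * Φ (monoMap a y)) s y := by
  rw [LinearMap.det_toContinuousLinearMap, LinearMap.det_toLin',
    det_monoJacobian hσ fun i => (hy i).1.ne', abs_mul, abs_of_pos (mono_pos fun i => (hy i).1),
    zetaIntegrand, cubeIntegrand, coneIndex, Complex.real_smul]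
  push_cast
  ring

lemma integrableOn_zetaIntegrand_iff (ha : LinearIndependent ℝ fun i => toReal (a i))
    (hσ : ∀ i, 0 < rowSum a i) (Φ : (Fin n → ℝ) → ℂ) (s : ℂ) :
    IntegrableOn (zetaIntegrand f Φ s) (logPreimage (closedCone a)) ↔
      IntegrableOn (cubeIntegrand f a (fun y => coneIndex a * Φ (monoMap a y)) s) (unitBox n) := by
  rw [← image_monoMap, integrableOn_image_iff_integrableOn_abs_det_fderiv_smul volume
    measurableSet_unitBox (fun y _ => (hasFDerivAt_monoMap a y).hasFDerivWithinAt)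
    (injOn_monoMap ha)]
  exact integrableOn_congr_fun (fun y hy => abs_det_smul_zetaIntegrand hσ Φ s hy)
    measurableSet_unitBox

lemma coneIntegral_eq (ha : LinearIndependent ℝ fun i => toReal (a i))
    (hσ : ∀ i, 0 < rowSum a i) (Φ : (Fin n → ℝ) → ℂ) (s : ℂ) :
    coneIntegral f Φ a s =
      ∫ y in unitBox n, cubeIntegrand f a (fun y => coneIndex a * Φ (monoMap a y)) s y := by
  rw [coneIntegral, ← image_monoMap, integral_image_eq_integral_abs_det_fderiv_smul volume
    measurableSet_unitBox (fun y _ => (hasFDerivAt_monoMap a y).hasFDerivWithinAt)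
    (injOn_monoMap ha)]
  exact setIntegral_congr_fun measurableSet_unitBox fun y hy =>
    abs_det_smul_zetaIntegrand hσ Φ s hy

end ChangeOfVariables

/-! ### Globalization -/

section Globalization
open Set Filter MeasureTheory

/-- A smooth partition of unity on a compact set, subordinate to a finite open cover and consisting
of compactly supported functions. -/
lemma exists_partition {ι : Type*} [Fintype ι] {C : Set (Fin n → ℝ)} (hC : IsCompact C)
    {W : ι → Set (Fin n → ℝ)} (hW : ∀ p, IsOpen (W p)) (hCW : C ⊆ ⋃ p, W p) :
    ∃ χ : ι → (Fin n → ℝ) → ℝ, (∀ p, IsTest (W p) (χ p)) ∧ ∀ y ∈ C, ∑ p, χ p y = 1 := by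
  obtain ⟨r, hr⟩ := hC.isBounded.subset_ball 0
  obtain ⟨χ, hχ⟩ := SmoothPartitionOfUnity.exists_isSubordinate
    (modelWithCornersSelf ℝ (Fin n → ℝ)) hC.isClosed (fun p => W p ∩ Metric.ball 0 r)
    (fun p => (hW p).inter Metric.isOpen_ball) (by
      rw [← iUnion_inter]
      exact subset_inter hCW hr)
  refine ⟨fun p => χ p, fun p => ⟨(χ p).contMDiff.contDiff, ?_, (hχ p).trans inter_subset_left⟩,
    fun y hy => ?_⟩
  · exact (isCompact_closedBall (0 : Fin n → ℝ) r).of_isClosed_subset (isClosed_tsupport _)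
      (((hχ p).trans inter_subset_right).trans Metric.ball_subset_closedBall)
  · rw [← χ.sum_eq_one hy, finsum_eq_sum_of_fintype]

variable {f : (Fin n → ℝ) → EuclideanSpace ℝ (Fin l)} {a : Fin n → Fin n → ℕ} {m₀ : Fin n → ℕ}

lemma cubeIntegrand_sum {ι : Type*} [Fintype ι] (ψ : ι → (Fin n → ℝ) → ℂ) {φ : (Fin n → ℝ) → ℂ}
    (s : ℂ) {y : Fin n → ℝ} (h : φ y = ∑ p, ψ p y) :
    cubeIntegrand f a φ s y = ∑ p, cubeIntegrand f a (ψ p) s y := by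
  simp only [cubeIntegrand]
  rw [h, Finset.mul_sum, Finset.sum_mul]

/-- The cone integral of a test function supported near the origin converges on the half-plane and
has a continuation with the required poles. -/
theorem exists_nhds_hasContinuation_coneIntegral (hn : 0 < n) (hl : 0 < l) {U : Set (Fin n → ℝ)}
    (hU : IsOpen U) (h0U : (0 : Fin n → ℝ) ∈ U) (hf : AnalyticAt ℝ f 0)
    (hnd : StronglyNonDegenerate f) (hcomp : CompatibleWithCone f a)
    (ha : LinearIndependent ℝ fun i => toReal (a i)) (hm₀ : m₀ ∈ taylorSupport f)
    (hd : ∀ i, dMin (newtonPolyhedron f) (a i) = ((a i ⬝ᵥ m₀ : ℕ) : ℝ))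
    (hσ : ∀ i, 0 < rowSum a i) :
    ∃ V : Set (Fin n → ℝ), V ⊆ U ∧ V ∈ 𝓝 (0 : Fin n → ℝ) ∧
      ∀ Φ : (Fin n → ℝ) → ℂ, ContDiff ℝ ∞ Φ → tsupport Φ ⊆ V →
        (∀ s ∈ convergenceHalfPlane f a,
          IntegrableOn (zetaIntegrand f Φ s) (logPreimage (closedCone a))) ∧
        HasContinuation (convergenceHalfPlane f a) (poleBound f a) (coneIntegral f Φ a) := by
  set Q : Set (Fin n → ℝ) := Icc 0 1 with hQ
  have hQc : IsCompact Q := isCompact_Icc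
  have hQ01 : ∀ y ∈ Q, ∀ i, 0 ≤ y i ∧ y i ≤ 1 := fun y hy i => ⟨hy.1 i, hy.2 i⟩
  set C : Set (Fin n → ℝ) := Q ∩ monoMap a ⁻¹' {0} with hC
  have hCc : IsCompact C :=
    hQc.inter_right (isClosed_singleton.preimage (continuous_monoMap a))
  choose! W hWo hyW hW using fun y (hy : y ∈ C) => exists_nhds_hasContinuation hn hl hf hnd hcomp
    ha hm₀ hd hσ (hQ01 y hy.1) hy.2
  obtain ⟨t, htC, hCt⟩ := hCc.elim_nhds_subcover W fun y hy => (hWo y hy).mem_nhds (hyW y hy)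
  have hto : IsOpen (⋃ p ∈ t, W p) := isOpen_biUnion fun p hp => hWo p (htC p hp)
  -- the image of the part of the cube that is not covered is closed and misses the origin
  set T : Set (Fin n → ℝ) := monoMap a '' (Q \ ⋃ p ∈ t, W p) with hT
  have hTc : IsClosed T := ((hQc.diff hto).image (continuous_monoMap a)).isClosed
  have h0T : (0 : Fin n → ℝ) ∉ T := by
    rintro ⟨y, ⟨hyQ, hyt⟩, hy0⟩
    exact hyt (hCt ⟨hyQ, hy0⟩)
  refine ⟨U ∩ Tᶜ, inter_subset_left, inter_mem (hU.mem_nhds h0U) (hTc.isOpen_compl.mem_nhds h0T),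
    fun Φ hΦ hΦV => ?_⟩
  have hΦc : Continuous fun y => monoMap a y := continuous_monoMap a
  set S : Set (Fin n → ℝ) := Q ∩ monoMap a ⁻¹' tsupport Φ with hS
  have hSc : IsCompact S := hQc.inter_right ((isClosed_tsupport Φ).preimage hΦc)
  have hSt : S ⊆ ⋃ p : t, W p := fun y hy => by
    by_contra h
    refine (hΦV hy.2).2 ⟨y, ⟨hy.1, fun h' => h ?_⟩, rfl⟩
    obtain ⟨p, hp, hyp⟩ := mem_iUnion₂.1 h'
    exact mem_iUnion.2 ⟨⟨p, hp⟩, hyp⟩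
  obtain ⟨χ, hχ, hχ1⟩ := exists_partition hSc (fun p : t => hWo p (htC p p.2)) hSt
  set φ : (Fin n → ℝ) → ℂ := fun y => coneIndex a * Φ (monoMap a y) with hφ
  have hφs : ContDiff ℝ ∞ φ := contDiff_const.mul (hΦ.comp (contDiff_monoMap a))
  set ψ : t → (Fin n → ℝ) → ℂ := fun p y => χ p y • φ y with hψ
  have hψt : ∀ p : t, IsTest (W p) (ψ p) := fun p =>
    (hχ p).of_support ((hχ p).contDiff.smul hφs) (tsupport_smul_subset_left (χ p) φ)
  have hsum : ∀ s, ∀ y ∈ unitBox n,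
      cubeIntegrand f a φ s y = ∑ p, cubeIntegrand f a (ψ p) s y := fun s y hy => by
    refine cubeIntegrand_sum ψ s ?_
    by_cases h : monoMap a y ∈ tsupport Φ
    · have hyQ : y ∈ Q := ⟨fun i => (hy i).1.le, fun i => (hy i).2⟩
      rw [← Finset.sum_smul, hχ1 y ⟨hyQ, h⟩, one_smul]
    · have h0 : φ y = 0 := by rw [hφ]; simp [image_eq_zero_of_notMem_tsupport h]
      simp [hψ, h0]
  have hint : ∀ p : t, ∀ s ∈ convergenceHalfPlane f a,
      IntegrableOn (cubeIntegrand f a (ψ p) s) (unitBox n) := fun p =>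
    (hW p (htC p p.2) (ψ p) (hψt p)).1
  refine ⟨fun s hs => ?_, ?_⟩
  · rw [integrableOn_zetaIntegrand_iff ha hσ]
    refine IntegrableOn.congr_fun ?_ (fun y hy => (hsum s y hy).symm) measurableSet_unitBox
    exact integrable_finsetSum _ fun p _ => hint p s hs
  · refine (HasContinuation.sum Finset.univ fun (p : t) _ =>
      (hW p (htC p p.2) (ψ p) (hψt p)).2).congr fun s hs => ?_
    rw [coneIntegral_eq ha hσ, setIntegral_congr_fun measurableSet_unitBox (hsum s)]
    exact integral_finsetSum _ fun p _ => hint p s hs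

lemma pos_of_mem_taylorSupport (hf : AnalyticAt ℝ f 0) (hf0 : f 0 = 0)
    (hm₀ : m₀ ∈ taylorSupport f) : 0 < n ∧ 0 < l := by
  obtain ⟨i, hi⟩ := hm₀
  refine ⟨Nat.pos_of_ne_zero ?_, i.pos⟩
  rintro rfl
  obtain ⟨r, -, -, hsum⟩ := exists_hasSum_taylorVec hf
  have h1 := (hsum 0 fun j => j.elim0).unique (hasSum_unique _)
  rw [hf0, mono, Finset.univ_eq_empty, Finset.prod_empty, one_smul] at h1
  have h2 : taylorVec f m₀ = 0 := (congrArg _ (Subsingleton.elim _ _)).trans h1.symm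
  exact hi (congrArg (fun v : EuclideanSpace ℝ (Fin l) => v i) h2)

end Globalization

end NewtonZeta

end

theorem mainTheorem8 (n l : ℕ) (U : Set (Fin n → ℝ)) (hU : IsOpen U) (h0U : (0 : Fin n → ℝ) ∈ U)
    (f : (Fin n → ℝ) → EuclideanSpace ℝ (Fin l)) (hf : AnalyticOnNhd ℝ f U) (hf0 : f 0 = 0)
    (hnd : NewtonZeta.StronglyNonDegenerate f)
    (a : Fin n → Fin n → ℕ) (ha : LinearIndependent ℝ (fun i => NewtonZeta.toReal (a i)))
    (hτ : ∃ v ∈ NewtonZeta.newtonPolyhedron f,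
      (⋂ i, NewtonZeta.firstMeetLocus (NewtonZeta.newtonPolyhedron f) (a i)) = {v})
    (hcomp : NewtonZeta.CompatibleWithCone f a) :
    ∃ V : Set (Fin n → ℝ), V ⊆ U ∧ V ∈ 𝓝 (0 : Fin n → ℝ) ∧
      ∀ Φ : (Fin n → ℝ) → ℂ, ContDiff ℝ ∞ Φ → HasCompactSupport Φ → tsupport Φ ⊆ V →
        ((∀ s ∈ NewtonZeta.convergenceHalfPlane f a,
            MeasureTheory.IntegrableOn (NewtonZeta.zetaIntegrand f Φ s)
              (NewtonZeta.logPreimage (NewtonZeta.closedCone a))) ∧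
          DifferentiableOn ℂ (NewtonZeta.coneIntegral f Φ a)
            (NewtonZeta.convergenceHalfPlane f a)) ∧
        ∃ M : ℂ → ℂ, (∀ s, MeromorphicAt M s) ∧
          Set.EqOn M (NewtonZeta.coneIntegral f Φ a) (NewtonZeta.convergenceHalfPlane f a) ∧
          (∀ s₀ : ℂ, meromorphicOrderAt M s₀ < 0 →
            ((-(n : ℤ) : ℤ) : WithTop ℤ) ≤ meromorphicOrderAt M s₀ ∧
            s₀ ∈ (⋃ i, NewtonZeta.candidatePoles (NewtonZeta.newtonPolyhedron f) (a i)) ∪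
              NewtonZeta.negShift l) ∧
          (∀ ρ : ℕ, 1 ≤ ρ → ∀ s₀ : ℂ,
            meromorphicOrderAt M s₀ = ((-(ρ : ℤ) : ℤ) : WithTop ℤ) →
            (s₀ ∉ NewtonZeta.negShift l →
              ρ ≤ {i | s₀ ∈ NewtonZeta.candidatePoles
                (NewtonZeta.newtonPolyhedron f) (a i)}.ncard) ∧
            (s₀ ∈ NewtonZeta.negShift l →
              ρ - 1 ≤ {i | s₀ ∈ NewtonZeta.candidatePoles
                (NewtonZeta.newtonPolyhedron f) (a i)}.ncard)) := by
  -- no column of the invertible matrix `(a i j)` vanishes, and no row does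
  have hcol : ∀ j, ∃ i, a i j ≠ 0 := fun j => by
    by_contra! h
    have h1 : IsUnit (Matrix.of fun i => NewtonZeta.toReal (a i)) :=
      Matrix.linearIndependent_rows_iff_isUnit.1 ha
    have h2 := ((Matrix.isUnit_iff_isUnit_det _).1 h1).ne_zero
    exact h2 (Matrix.det_eq_zero_of_column_eq_zero j fun i => by simp [NewtonZeta.toReal, h i])
  have hσ : ∀ i, 0 < NewtonZeta.rowSum a i := fun i => Nat.pos_of_ne_zero fun h => by
    refine ha.ne_zero i (funext fun j => ?_)
    have h1 : a i j = 0 := Finset.sum_eq_zero_iff.1 h j (Finset.mem_univ j)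
    simp [NewtonZeta.toReal, h1]
  have hf' : AnalyticAt ℝ f 0 := hf 0 h0U
  obtain ⟨m₀, hm₀, hd⟩ := NewtonZeta.exists_exponent_of_vertex hcol hτ
  -- `m₀` is a nonzero exponent of some component, because `f 0 = 0`
  obtain ⟨hn, hl⟩ := NewtonZeta.pos_of_mem_taylorSupport hf' hf0 hm₀
  obtain ⟨V, hVU, hV, h⟩ := NewtonZeta.exists_nhds_hasContinuation_coneIntegral hn hl hU h0U hf'
    hnd hcomp ha hm₀ hd hσ
  refine ⟨V, hVU, hV, fun Φ hΦ _ hΦV => ?_⟩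
  obtain ⟨hint, hdiff, M, hM, hMI⟩ := h Φ hΦ hΦV
  refine ⟨⟨hint, hdiff⟩, M, fun s => (hM s).1, hMI, fun s₀ hs₀ => ⟨?_, ?_⟩, fun ρ hρ s₀ hs₀ => ?_⟩
  · refine le_trans ?_ (hM s₀).2
    have h1 : NewtonZeta.poleBound f a s₀ ≤ n := min_le_left _ _
    exact_mod_cast neg_le_neg (by exact_mod_cast h1)
  -- outside the candidate poles the bound for the order of a pole is zero
  · by_contra h1
    rw [Set.mem_union, not_or, Set.mem_iUnion, not_exists] at h1
    have h2 : NewtonZeta.poleBound f a s₀ = 0 := by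
      simp [NewtonZeta.poleBound, h1.1, h1.2]
    have h3 := (hM s₀).2
    rw [h2] at h3
    exact absurd hs₀ (not_lt.2 (by simpa using h3))
  · have h1 := (hM s₀).2
    rw [hs₀] at h1
    have h2 : ρ ≤ NewtonZeta.poleBound f a s₀ := by
      have h3 := WithTop.coe_le_coe.1 h1
      omega
    have h3 := h2.trans (min_le_right _ _)
    refine ⟨fun hs => ?_, fun hs => ?_⟩
    · rwa [if_neg hs, add_zero] at h3
    · rw [if_pos hs] at h3
      exact Nat.sub_le_of_le_add h3
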